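/- Fix an integer $p\ge 1$. A time-varying graph $\mathcal G$ consists of a finite undirected simple graph $G=(V,E)$ and a presence function $\rho:E\times\mathbb N\to\{0,1\}$; an agent at $u$ can cross an edge $e=\{u,v\}$ at time $t$ if $\rho(e,t)=1$, and is then at $v$ at time $t+1$; it may also wait. The graph $\mathcal G$ is periodic with period $p$ if $G$ is connected and $\rho(e,t)=\rho(e,t+kp)$ for all $e\in E$ and $t,k\in\mathbb N$. A spider is a tree in which at most one vertex has degree greater than two. Consider the single-agent Dynamic Map Visitation Problem (DMVP): the input is a time-varying graph $\mathcal G$, periodic with period $p$, whose underlying graph is a spider, together with a starting vertex $s$; $\mathcal G$ is given by a finite sequence $(G_1,t_1),\dots,(G_m,t_m)$ of adjacency matrices with durations written in binary, listing the edges available from time $0$ on and covering at least $p$ time steps. The task is to find a journey that starts at $s$ at time $0$, visits every vertex of $V$, and ends as early as possible (or to report that no journey visits every vertex). Then, for every fixed $p$, this problem can be solved in time polynomial in the size of the input, where the polynomial may depend on $p$. So can its decision variant, in which a number $t$ is also given, and the question is whether some journey that starts at $s$ at time $0$ visits every vertex and ends no later than time $t$. -/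

import Mathlib

/-! ## A random access machine with a step count -/

namespace RAM

/-- Arithmetic terms over natural-number variables and arrays: constants, variables, array look-up
`a[i]`, addition and truncated subtraction. There is deliberately no multiplication. -/
inductive Term : Type
  | const (k : ℕ)
  | var (x : ℕ)
  | get (a : ℕ) (i : Term)
  | add (s t : Term)
  | sub (s t : Term)

/-- Programs. A program mentions finitely many variables and finitely many arrays, each named by
a number. -/
inductive Prog : Type
  | assign (x : ℕ) (e : Term)
  | store (a : ℕ) (i e : Term)
  | emit (e : Term)
  | seq (P Q : Prog)
  | ite (e : Term) (P Q : Prog)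
  | while (e : Term) (P : Prog)

/-- A memory state: the values of the variables, the contents of the arrays, and the list of
numbers written to the output so far. -/
structure State where
  var : ℕ → ℕ
  arr : ℕ → ℕ → ℕ
  out : List ℕ

/-- The value of a term. -/
def Term.eval (σ : State) : Term → ℕ
  | .const k => k
  | .var x => σ.var x
  | .get a i => σ.arr a (i.eval σ)
  | .add s t => s.eval σ + t.eval σ
  | .sub s t => s.eval σ - t.eval σ

/-- The number of steps needed to evaluate a term: one for each constant, each access to a variable
or an array and each arithmetic operation. -/
def Term.cost : Term → ℕ
  | .const _ => 1
  | .var _ => 1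
  | .get _ i => i.cost + 1
  | .add s t => s.cost + t.cost + 1
  | .sub s t => s.cost + t.cost + 1

/-- `Run P σ k σ'`: started in state `σ`, the program `P` halts in state `σ'` after exactly `k`
steps. A condition counts as true when its value is not zero. -/
inductive Run : Prog → State → ℕ → State → Prop
  | assign (x : ℕ) (e : Term) (σ : State) :
      Run (.assign x e) σ (e.cost + 1)
        { σ with var := Function.update σ.var x (e.eval σ) }
  | store (a : ℕ) (i e : Term) (σ : State) :
      Run (.store a i e) σ (i.cost + e.cost + 1)
        { σ with
          arr := Function.update σ.arr a (Function.update (σ.arr a) (i.eval σ) (e.eval σ)) }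
  | emit (e : Term) (σ : State) :
      Run (.emit e) σ (e.cost + 1) { σ with out := σ.out ++ [e.eval σ] }
  | seq {P Q : Prog} {σ σ₁ σ₂ : State} {k l : ℕ} :
      Run P σ k σ₁ → Run Q σ₁ l σ₂ → Run (.seq P Q) σ (k + l) σ₂
  | ite_true {e : Term} {P Q : Prog} {σ σ' : State} {k : ℕ} :
      e.eval σ ≠ 0 → Run P σ k σ' → Run (.ite e P Q) σ (e.cost + 1 + k) σ'
  | ite_false {e : Term} {P Q : Prog} {σ σ' : State} {k : ℕ} :
      e.eval σ = 0 → Run Q σ k σ' → Run (.ite e P Q) σ (e.cost + 1 + k) σ'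
  | while_true {e : Term} {P : Prog} {σ σ₁ σ₂ : State} {k l : ℕ} :
      e.eval σ ≠ 0 → Run P σ k σ₁ → Run (.while e P) σ₁ l σ₂ →
        Run (.while e P) σ (e.cost + 1 + k + l) σ₂
  | while_false {e : Term} {P : Prog} {σ : State} :
      e.eval σ = 0 → Run (.while e P) σ (e.cost + 1) σ

/-- The initial state on the input `w`: the input stands in array `0`, every other cell and every
variable is zero, and nothing has been output. -/
def State.init (w : List ℕ) : State where
  var _ := 0
  arr a i := if a = 0 then w.getD i 0 else 0
  out := []

/-- The size of an input: the number of bits of its entries, plus one separator for each entry. -/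
def inputSize (w : List ℕ) : ℕ := (w.map fun x => Nat.size x + 1).sum

/-- A computational problem is given by its instances, the encoding `code` of an instance as a list
of numbers, and the relation `sol x w` saying that the output `w` is a correct answer to `x`.
It is solvable in polynomial time if one program, on every instance, halts with a correct answer
after a number of steps bounded by a polynomial in the size of the encoded instance. -/
def SolvableInPolyTime {ι : Type} (code : ι → List ℕ) (sol : ι → List ℕ → Prop) : Prop :=
  ∃ (P : Prog) (q : Polynomial ℕ), ∀ x : ι, ∃ (k : ℕ) (σ : State),
    Run P (State.init (code x)) k σ ∧ k ≤ q.eval (inputSize (code x)) ∧ sol x σ.out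

end RAM

/-! ## Time-varying graphs and the map visitation problem -/

namespace DMVP

/-- A time-varying graph in discrete time with lifetime `ℕ`, undirected edges and latency `1`:
the underlying graph and the presence function. The value of `present` matters only on edges
of `graph`. -/
structure TVG (V : Type) where
  graph : SimpleGraph V
  present : Sym2 V → ℕ → Prop

/-- The edge between `u` and `v` exists in the underlying graph and is available at time `t`. -/
def TVG.Avail {V : Type} (G : TVG V) (t : ℕ) (u v : V) : Prop :=
  G.graph.Adj u v ∧ G.present s(u, v) t

/-- The class of time-varying graphs with periodic edges, of period `p`. -/
def TVG.Periodic {V : Type} (G : TVG V) (p : ℕ) : Prop :=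
  G.graph.Connected ∧
    ∀ e ∈ G.graph.edgeSet, ∀ t k : ℕ, G.present e t ↔ G.present e (t + k * p)

/-- A spider: a tree in which at most one vertex has degree greater than two. -/
def IsSpider {V : Type} (H : SimpleGraph V) : Prop :=
  H.IsTree ∧ ∀ u v : V, 2 < (H.neighborSet u).ncard → 2 < (H.neighborSet v).ncard → u = v

/-- `IsJourney G u τ J`: the list `J` is a journey of an agent that is at `u` at time `τ`. An entry
`(v, t)` of `J` says that the agent takes the edge from its current vertex to `v` at time `t`
and is at `v` at time `t + 1`; between entries it waits. -/
def IsJourney {V : Type} (G : TVG V) : V → ℕ → List (V × ℕ) → Prop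
  | _, _, [] => True
  | u, τ, (v, t) :: J => τ ≤ t ∧ G.Avail t u v ∧ IsJourney G v (t + 1) J

/-- The date at which a journey that starts at time `0` ends. -/
def arrival {V : Type} (J : List (V × ℕ)) : ℕ :=
  match J.getLast? with
  | none => 0
  | some (_, t) => t + 1

/-- `J` is a journey from `s`, starting at time `0`, that visits every vertex. -/
def IsCovering {V : Type} (G : TVG V) (s : V) (J : List (V × ℕ)) : Prop :=
  IsJourney G s 0 J ∧ ∀ v : V, v = s ∨ v ∈ J.map Prod.fst

/-- `J` is a covering journey from `s` that ends as early as possible. -/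
def IsOptimal {V : Type} (G : TVG V) (s : V) (J : List (V × ℕ)) : Prop :=
  IsCovering G s J ∧ ∀ J' : List (V × ℕ), IsCovering G s J' → arrival J ≤ arrival J'

/-- A finite sequence of static graphs, each an adjacency matrix with a duration. -/
abbrev Phases (n : ℕ) : Type := List ((Fin n → Fin n → Bool) × ℕ)

/-- The total duration of a sequence of static graphs. -/
def Phases.duration {n : ℕ} (L : Phases n) : ℕ := (L.map Prod.snd).sum

/-- The adjacency matrix in force at time `t`, if `t` is less than the total duration. -/
def Phases.at {n : ℕ} : Phases n → ℕ → Option (Fin n → Fin n → Bool)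
  | [], _ => none
  | (A, d) :: L, t => if t < d then some A else Phases.at L (t - d)

/-- The sequence `L` describes `G` from time `0` up to the total duration of `L`. -/
def Phases.Describes {n : ℕ} (L : Phases n) (G : TVG (Fin n)) : Prop :=
  ∀ (t : ℕ) (A : Fin n → Fin n → Bool), L.at t = some A →
    ∀ u v : Fin n, A u v = true ↔ G.Avail t u v

/-- An instance of the single-agent problem on spiders with edges of period `p`: a periodic
time-varying graph on a spider, described by its first time steps, over at least one period, and
a starting vertex. -/
structure SpiderInstance (p : ℕ) where
  n : ℕ
  G : TVG (Fin n)
  start : Fin n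
  phases : Phases n
  periodic : G.Periodic p
  spider : IsSpider G.graph
  describes : phases.Describes G
  period_le : p ≤ phases.duration

/-- The rows of a Boolean matrix, one after the other, as a list of zeros and ones. -/
def matrixCode {n : ℕ} (A : Fin n → Fin n → Bool) : List ℕ :=
  (List.ofFn fun u => List.ofFn fun v => (A u v).toNat).flatten

/-- The encoding of an instance: the number of vertices, the starting vertex, the number of static
graphs, and for each of these its duration and its adjacency matrix. -/
def SpiderInstance.code {p : ℕ} (I : SpiderInstance p) : List ℕ :=
  I.n :: (I.start : ℕ) :: I.phases.length ::
    I.phases.flatMap fun Ad => Ad.2 :: matrixCode Ad.1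

/-- The encoding of a journey: the vertices reached, each followed by the departure time. -/
def journeyCode {n : ℕ} (J : List (Fin n × ℕ)) : List ℕ :=
  J.flatMap fun vt => [(vt.1 : ℕ), vt.2]

/-- A correct answer to the minimization problem: `1` and an optimal covering journey, or `0` if
there is no covering journey at all. -/
def SpiderInstance.IsSolution {p : ℕ} (I : SpiderInstance p) (w : List ℕ) : Prop :=
  (∃ J, IsOptimal I.G I.start J ∧ w = 1 :: journeyCode J) ∨
    ((∀ J, ¬ IsCovering I.G I.start J) ∧ w = [0])

/-- A correct answer to the decision problem: `1` if some covering journey ends no later than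
`t`, and `0` otherwise. -/
def SpiderInstance.IsDecision {p : ℕ} (I : SpiderInstance p) (t : ℕ) (w : List ℕ) : Prop :=
  ((∃ J, IsCovering I.G I.start J ∧ arrival J ≤ t) ∧ w = [1]) ∨
    ((∀ J, IsCovering I.G I.start J → t < arrival J) ∧ w = [0])

end DMVP

/-!
# Map visitation on spiders with periodic edges

*Reduction to the leaves.* If some journey covers the spider, then every vertex can be reached from
the start, hence every edge is available at some time, since every edge of a tree is a bridge
(`exists_avail`). With period `p` and `n` vertices one then gets from anywhere to anywhere within
`p * n` steps (`net_of_avail`), and every set of vertices can be visited by the time `n * (p * n)`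
(`Net.cov_all`). A walk visits every vertex as soon as it visits the center `c` and all leaves
(`visits_all`), and it cannot get from one leaf to another without passing through `c`
(`sep_leaves`). So, after the first visit to a leaf or to the center, an optimal walk is a tour: a
sequence of earliest-arrival trips from `c` to a leaf and back, in some order of the leaves, the
last trip ending in the leaf (`Net.cov_iff`).

*Residues instead of orders.* The duration of a trip depends only on the leaf and on the residue
modulo `p` of the time at which it starts. Assign to each leaf a mode: the residue at which its trip
starts, and whether the trip is the last one. An assignment comes from an order of the leaves if and
only if the resulting passages between residues can be strung together to a walk, and this depends
only on how often each passage occurs. These multiplicities are at most `n`, and there are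
`p * (p + 1)` kinds of passages, so the multiplicities are the digits of a number below
`(n + 1) ^ (p * (p + 1))`. Two dynamic programs of polynomial size decide which combinations of
multiplicities and total duration can be obtained by assigning modes to the leaves, and which
multiplicities belong to a walk (`Net.hasTour_iff`).

*The journey.* This decides whether an agent at a given vertex at a given time can visit a given set
of leaves by a given time. The optimum is found by trying all times up to `n * (p * n)`, and an
optimal journey by moving step by step to some vertex from which the remaining targets can still be
visited in time (`route`).

*The machine.* The algorithm is written in a language of expressions with bounded sums and tables
filled in order (`RAM.Ex`). Expressions compile to programs whose running time is polynomial in the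
bounds of the loops (`RAM.Ex.compile_ends`), and these bounds are computed from the input first
(`RAM.solvableInPolyTime_of_ex`).
-/

namespace RAM

/-! ### Expressions with bounded sums and tables -/

/-- A side-effect free expression language. `sum x b e` is the sum of `e` over all values of `x`
below the value of the variable `b`, `letv` binds a variable, and `tab a x b e₁ e₂` evaluates `e₂`
after filling the array `a` at the places `x` below `b`, in increasing order, with `e₁`, which may
refer to the entries written before. -/
inductive Ex : Type
  | const (k : ℕ)
  | var (x : ℕ)
  | get (a : ℕ) (e : Ex)
  | add (e f : Ex)
  | sub (e f : Ex)
  | ite (c e f : Ex)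
  | sum (x b : ℕ) (e : Ex)
  | letv (x : ℕ) (e f : Ex)
  | tab (a x b : ℕ) (e f : Ex)

/-- The values of the variables and the contents of the arrays that expressions refer to. -/
structure Env where
  var : ℕ → ℕ
  arr : ℕ → ℕ → ℕ

/-- The environment with the variable `x` set to `i`. -/
def Env.setV (v : Env) (x i : ℕ) : Env := ⟨Function.update v.var x i, v.arr⟩

/-- The environment with the array `a` set to `T`. -/
def Env.setA (v : Env) (a : ℕ) (T : ℕ → ℕ) : Env := ⟨v.var, Function.update v.arr a T⟩

theorem Env.setV_var (v : Env) (x i y : ℕ) :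
    (v.setV x i).var y = if y = x then i else v.var y := by
  simp [Env.setV, Function.update_apply]

@[simp] theorem Env.setV_arr (v : Env) (x i : ℕ) : (v.setV x i).arr = v.arr := rfl

@[simp] theorem Env.setA_var (v : Env) (a : ℕ) (T : ℕ → ℕ) : (v.setA a T).var = v.var := rfl

theorem Env.setA_arr (v : Env) (a : ℕ) (T : ℕ → ℕ) (b : ℕ) :
    (v.setA a T).arr b = if b = a then T else v.arr b := by
  simp [Env.setA, Function.update_apply]

/-- The table obtained by filling in the first `n` entries in order, where `g i T` is the entry at
`i` when `T` holds the entries before it. The entries that have not been filled in are `0`. -/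
def tabSeq (g : ℕ → (ℕ → ℕ) → ℕ) : ℕ → ℕ → ℕ
  | 0 => 0
  | n + 1 => Function.update (tabSeq g n) n (g n (tabSeq g n))

theorem tabSeq_of_le (g : ℕ → (ℕ → ℕ) → ℕ) {n i : ℕ} (h : n ≤ i) : tabSeq g n i = 0 := by
  induction n with
  | zero => rfl
  | succ n ih =>
    rw [tabSeq, Function.update_of_ne (by omega), ih (by omega)]

theorem tabSeq_of_lt (g : ℕ → (ℕ → ℕ) → ℕ) {n i : ℕ} (h : i < n) :
    tabSeq g n i = g i (tabSeq g i) := by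
  induction n with
  | zero => omega
  | succ n ih =>
    rw [tabSeq]
    rcases Nat.lt_succ_iff_lt_or_eq.1 h with h | rfl
    · rw [Function.update_of_ne (by omega), ih h]
    · rw [Function.update_self]

theorem tabSeq_eq_of_lt (g : ℕ → (ℕ → ℕ) → ℕ) {m n i : ℕ} (hm : i < m) (hn : i < n) :
    tabSeq g m i = tabSeq g n i := by
  rw [tabSeq_of_lt g hm, tabSeq_of_lt g hn]

/-- The value of an expression. -/
def Ex.eval : Ex → Env → ℕ
  | .const k, _ => k
  | .var x, v => v.var x
  | .get a e, v => v.arr a (e.eval v)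
  | .add e f, v => e.eval v + f.eval v
  | .sub e f, v => e.eval v - f.eval v
  | .ite c e f, v => if c.eval v = 0 then f.eval v else e.eval v
  | .sum x b e, v => ∑ i ∈ Finset.range (v.var b), e.eval (v.setV x i)
  | .letv x e f, v => f.eval (v.setV x (e.eval v))
  | .tab a x b e f, v =>
      f.eval (v.setA a (tabSeq (fun i T => e.eval ((v.setA a T).setV x i)) (v.var b)))

/-- Loops are bounded by the variables below `m`, and these are never rebound. -/
def Ex.Ok (m : ℕ) : Ex → Prop
  | .const _ => True
  | .var _ => True
  | .get _ e => e.Ok m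
  | .add e f => e.Ok m ∧ f.Ok m
  | .sub e f => e.Ok m ∧ f.Ok m
  | .ite c e f => c.Ok m ∧ e.Ok m ∧ f.Ok m
  | .sum x b e => m ≤ x ∧ b < m ∧ e.Ok m
  | .letv x e f => m ≤ x ∧ e.Ok m ∧ f.Ok m
  | .tab _ x b e f => m ≤ x ∧ b < m ∧ e.Ok m ∧ f.Ok m

/-- A bound for the number of steps of the compiled expression, as a polynomial in a common bound
for the variables that bound loops. -/
noncomputable def Ex.cost : Ex → Polynomial ℕ
  | .const _ => 2
  | .var _ => 2
  | .get _ e => e.cost + 3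
  | .add e f => e.cost + f.cost + 4
  | .sub e f => e.cost + f.cost + 4
  | .ite c e f => c.cost + e.cost + f.cost + 2
  | .sum _ _ e => Polynomial.X * (e.cost + 12) + 8
  | .letv _ e f => e.cost + f.cost + 2
  | .tab _ _ _ e f => Polynomial.X * (e.cost + 11) + f.cost + Polynomial.X * 11 + 12

/-- Compilation of an expression to a program that leaves the value in the variable `k`. The maps
`ρ` and `α` give the places of the variables and arrays; variables from `k` on and arrays from `l`
on are free for use, and the latter are zero before and after the execution. -/
def Ex.compile : Ex → (ℕ → ℕ) → (ℕ → ℕ) → ℕ → ℕ → Prog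
  | .const c, _, _, k, _ => .assign k (.const c)
  | .var x, ρ, _, k, _ => .assign k (.var (ρ x))
  | .get a e, ρ, α, k, l => .seq (e.compile ρ α k l) (.assign k (.get (α a) (.var k)))
  | .add e f, ρ, α, k, l =>
      .seq (e.compile ρ α k l)
        (.seq (f.compile ρ α (k + 1) l) (.assign k (.add (.var k) (.var (k + 1)))))
  | .sub e f, ρ, α, k, l =>
      .seq (e.compile ρ α k l)
        (.seq (f.compile ρ α (k + 1) l) (.assign k (.sub (.var k) (.var (k + 1)))))
  | .ite c e f, ρ, α, k, l =>
      .seq (c.compile ρ α k l) (.ite (.var k) (e.compile ρ α k l) (f.compile ρ α k l))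
  | .sum x b e, ρ, α, k, l =>
      .seq (.assign k (.const 0)) (.seq (.assign (k + 1) (.const 0))
        (.while (.sub (.var (ρ b)) (.var (k + 1)))
          (.seq (e.compile (Function.update ρ x (k + 1)) α (k + 2) l)
            (.seq (.assign k (.add (.var k) (.var (k + 2))))
              (.assign (k + 1) (.add (.var (k + 1)) (.const 1)))))))
  | .letv x e f, ρ, α, k, l =>
      .seq (e.compile ρ α k l)
        (.seq (f.compile (Function.update ρ x k) α (k + 1) l) (.assign k (.var (k + 1))))
  | .tab a x b e f, ρ, α, k, l =>
      .seq (.assign k (.const 0))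
        (.seq (.while (.sub (.var (ρ b)) (.var k))
          (.seq (e.compile (Function.update ρ x k) (Function.update α a l) (k + 1) (l + 1))
            (.seq (.store l (.var k) (.var (k + 1)))
              (.assign k (.add (.var k) (.const 1))))))
        (.seq (f.compile ρ (Function.update α a l) k (l + 1))
          (.seq (.assign (k + 1) (.const 0))
            (.while (.sub (.var (ρ b)) (.var (k + 1)))
              (.seq (.store l (.var (k + 1)) (.const 0))
                (.assign (k + 1) (.add (.var (k + 1)) (.const 1))))))))

/-- `P` halts on `σ` within `B` steps in a state that satisfies `Q`. -/
def Ends (P : Prog) (σ : State) (B : ℕ) (Q : State → Prop) : Prop :=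
  ∃ t σ', Run P σ t σ' ∧ t ≤ B ∧ Q σ'

theorem Ends.mono {P : Prog} {σ : State} {B B' : ℕ} {Q Q' : State → Prop} (h : Ends P σ B Q)
    (hB : B ≤ B') (hQ : ∀ σ', Q σ' → Q' σ') : Ends P σ B' Q' := by
  obtain ⟨t, σ', h1, h2, h3⟩ := h
  exact ⟨t, σ', h1, h2.trans hB, hQ _ h3⟩

theorem Ends.seq {P P' : Prog} {σ : State} {B B' : ℕ} {Q Q' : State → Prop} (h : Ends P σ B Q)
    (h' : ∀ σ', Q σ' → Ends P' σ' B' Q') : Ends (.seq P P') σ (B + B') Q' := by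
  obtain ⟨t, σ', h1, h2, h3⟩ := h
  obtain ⟨t', σ'', h4, h5, h6⟩ := h' _ h3
  exact ⟨_, σ'', .seq h1 h4, by omega, h6⟩

theorem ends_assign {x : ℕ} {e : Term} {σ : State} {Q : State → Prop}
    (h : Q { σ with var := Function.update σ.var x (e.eval σ) }) :
    Ends (.assign x e) σ (e.cost + 1) Q :=
  ⟨_, _, .assign x e σ, le_rfl, h⟩

theorem ends_store {a : ℕ} {i e : Term} {σ : State} {Q : State → Prop}
    (h : Q { σ with
      arr := Function.update σ.arr a (Function.update (σ.arr a) (i.eval σ) (e.eval σ)) }) :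
    Ends (.store a i e) σ (i.cost + e.cost + 1) Q :=
  ⟨_, _, .store a i e σ, le_rfl, h⟩

theorem ends_emit {e : Term} {σ : State} {Q : State → Prop}
    (h : Q { σ with out := σ.out ++ [e.eval σ] }) : Ends (.emit e) σ (e.cost + 1) Q :=
  ⟨_, _, .emit e σ, le_rfl, h⟩

theorem ends_ite {e : Term} {P P' : Prog} {σ : State} {B B' : ℕ} {Q : State → Prop}
    (h : e.eval σ ≠ 0 → Ends P σ B Q) (h' : e.eval σ = 0 → Ends P' σ B' Q) :
    Ends (.ite e P P') σ (e.cost + 1 + B + B') Q := by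
  by_cases he : e.eval σ = 0
  · obtain ⟨t, σ', h1, h2, h3⟩ := h' he
    exact ⟨_, σ', .ite_false he h1, by omega, h3⟩
  · obtain ⟨t, σ', h1, h2, h3⟩ := h he
    exact ⟨_, σ', .ite_true he h1, by omega, h3⟩

/-- The rule for loops that run through the body exactly `n` times. -/
theorem ends_while {e : Term} {P : Prog} {B n : ℕ} (I : ℕ → State → Prop)
    (hstep : ∀ i < n, ∀ σ, I i σ → e.eval σ ≠ 0 ∧ Ends P σ B (I (i + 1)))
    (hend : ∀ σ, I n σ → e.eval σ = 0) {σ : State} (h0 : I 0 σ) :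
    Ends (.while e P) σ (n * (e.cost + 1 + B) + (e.cost + 1)) (I n) := by
  suffices H : ∀ m i, i + m = n → ∀ σ, I i σ →
      Ends (.while e P) σ (m * (e.cost + 1 + B) + (e.cost + 1)) (I n) from H n 0 (by omega) σ h0
  intro m
  induction m with
  | zero =>
    intro i hi σ hσ
    obtain rfl : i = n := by omega
    exact ⟨_, σ, .while_false (hend σ hσ), by omega, hσ⟩
  | succ m ih =>
    intro i hi σ hσ
    obtain ⟨he, t, σ', h1, h2, h3⟩ := hstep i (by omega) σ hσ
    obtain ⟨t', σ'', h4, h5, h6⟩ := ih (i + 1) (by omega) σ' h3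
    refine ⟨_, σ'', .while_true he h1 h4, ?_, h6⟩
    rw [Nat.succ_mul]
    omega

/-- What the compiled expression guarantees: the value is in `k`, and otherwise only variables
above `k` have changed. -/
def Post (σ : State) (k val : ℕ) (σ' : State) : Prop :=
  σ'.var k = val ∧ (∀ y < k, σ'.var y = σ.var y) ∧ σ'.arr = σ.arr ∧ σ'.out = σ.out

/-- Binding `x` to the place `k` binds it to the value that stands there. -/
theorem comp_update_of_eq {f : ℕ → ℕ} {ρ : ℕ → ℕ} {x k : ℕ} :
    f ∘ Function.update ρ x k = Function.update (f ∘ ρ) x (f k) := by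
  funext y
  by_cases h : y = x
  · subst h; simp
  · simp [Function.update_of_ne h]

/-- Correctness of the compilation: the value ends up in the variable `k`, everything below `k` and
`l` is preserved, and the number of steps is at most the cost at any bound `N` for the loops. -/
theorem Ex.compile_ends {m N : ℕ} (e : Ex) : ∀ (ρ α : ℕ → ℕ) (k l : ℕ) (σ : State), e.Ok m →
    (∀ y, ρ y < k) → (∀ a, α a < l) → (∀ a, l ≤ a → σ.arr a = 0) →
    (∀ b < m, σ.var (ρ b) ≤ N) →
    Ends (e.compile ρ α k l) σ (e.cost.eval N)
      (Post σ k (e.eval ⟨σ.var ∘ ρ, σ.arr ∘ α⟩)) := by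
  have comp_congr : ∀ {f g : ℕ → ℕ} {ρ : ℕ → ℕ} {k : ℕ}, (∀ y, ρ y < k) →
      (∀ y < k, f y = g y) → f ∘ ρ = g ∘ ρ := by
    intro f g ρ k h h'
    funext y
    exact h' _ (h y)
  have upd_lt : ∀ {ρ : ℕ → ℕ} {k k' x j : ℕ}, (∀ y, ρ y < k) → k ≤ k' → j < k' →
      ∀ y, Function.update ρ x j y < k' := by
    intro ρ k k' x j h hk hj y
    rw [Function.update_apply]
    split_ifs
    · exact hj
    · exact (h y).trans_le hk
  induction e with
  | const c =>
    intro ρ α k l σ _ hρ hα hz hN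
    refine (ends_assign ?_).mono (B' := (Ex.const c).cost.eval N) ?_ (fun _ h => h)
    · exact ⟨by simp [Term.eval, Ex.eval], fun y hy => Function.update_of_ne (by omega) _ _,
        rfl, rfl⟩
    · simp [Term.cost, Ex.cost]
  | var x =>
    intro ρ α k l σ _ hρ hα hz hN
    refine (ends_assign ?_).mono (B' := (Ex.var x).cost.eval N) ?_ (fun _ h => h)
    · exact ⟨by simp [Term.eval, Ex.eval], fun y hy => Function.update_of_ne (by omega) _ _,
        rfl, rfl⟩
    · simp [Term.cost, Ex.cost]
  | get a e ih =>
    intro ρ α k l σ hok hρ hα hz hN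
    refine ((ih ρ α k l σ hok hρ hα hz hN).seq (B' := 3) (Q' := Post σ k _) ?_).mono
      (by simp [Ex.cost]) (fun _ h => h)
    rintro σ' ⟨h1, h2, h3, h4⟩
    refine ends_assign ⟨?_, fun y hy => ?_, h3, h4⟩
    · simp [Term.eval, Ex.eval, h1, h3]
    · simp [Function.update_of_ne (show y ≠ k by omega), h2 y hy]
  | add e f ihe ihf =>
    intro ρ α k l σ hok hρ hα hz hN
    refine ((ihe ρ α k l σ hok.1 hρ hα hz hN).seq (B' := f.cost.eval N + 4) (Q' := Post σ k _)
      ?_).mono (by simp [Ex.cost]; omega) (fun _ h => h)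
    rintro σ' ⟨h1, h2, h3, h4⟩
    refine (ihf ρ α (k + 1) l σ' hok.2 (fun y => (hρ y).trans_le (by omega)) hα
      (by rw [h3]; exact hz) (fun b hb => by rw [h2 _ (hρ b)]; exact hN b hb)).seq ?_
    rintro σ'' ⟨h5, h6, h7, h8⟩
    refine ends_assign ⟨?_, fun y hy => ?_, h7.trans h3, h8.trans h4⟩
    · simp [Term.eval, Ex.eval, h5, h6 k (by omega), h1, h3, comp_congr hρ h2]
    · simp [Function.update_of_ne (show y ≠ k by omega), h2 y hy, h6 y (by omega)]
  | sub e f ihe ihf =>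
    intro ρ α k l σ hok hρ hα hz hN
    refine ((ihe ρ α k l σ hok.1 hρ hα hz hN).seq (B' := f.cost.eval N + 4) (Q' := Post σ k _)
      ?_).mono (by simp [Ex.cost]; omega) (fun _ h => h)
    rintro σ' ⟨h1, h2, h3, h4⟩
    refine (ihf ρ α (k + 1) l σ' hok.2 (fun y => (hρ y).trans_le (by omega)) hα
      (by rw [h3]; exact hz) (fun b hb => by rw [h2 _ (hρ b)]; exact hN b hb)).seq ?_
    rintro σ'' ⟨h5, h6, h7, h8⟩
    refine ends_assign ⟨?_, fun y hy => ?_, h7.trans h3, h8.trans h4⟩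
    · simp [Term.eval, Ex.eval, h5, h6 k (by omega), h1, h3, comp_congr hρ h2]
    · simp [Function.update_of_ne (show y ≠ k by omega), h2 y hy, h6 y (by omega)]
  | ite c e f ihc ihe ihf =>
    intro ρ α k l σ hok hρ hα hz hN
    refine ((ihc ρ α k l σ hok.1 hρ hα hz hN).seq (B' := 1 + 1 + e.cost.eval N + f.cost.eval N)
      (Q' := Post σ k _) ?_).mono (by simp [Ex.cost]; omega) (fun _ h => h)
    rintro σ' ⟨h1, h2, h3, h4⟩
    have hz' : ∀ a, l ≤ a → σ'.arr a = 0 := by rw [h3]; exact hz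
    have hN' : ∀ b < m, σ'.var (ρ b) ≤ N := fun b hb => by rw [h2 _ (hρ b)]; exact hN b hb
    refine ends_ite (fun hne => ?_) (fun heq => ?_)
    · refine (ihe ρ α k l σ' hok.2.1 hρ hα hz' hN').mono le_rfl ?_
      rintro σ'' ⟨h5, h6, h7, h8⟩
      simp only [Term.eval, h1] at hne
      refine ⟨?_, fun y hy => (h6 y hy).trans (h2 y hy), h7.trans h3, h8.trans h4⟩
      rw [h5, h3, comp_congr hρ h2, Ex.eval, if_neg hne]
    · refine (ihf ρ α k l σ' hok.2.2 hρ hα hz' hN').mono le_rfl ?_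
      rintro σ'' ⟨h5, h6, h7, h8⟩
      simp only [Term.eval, h1] at heq
      refine ⟨?_, fun y hy => (h6 y hy).trans (h2 y hy), h7.trans h3, h8.trans h4⟩
      rw [h5, h3, comp_congr hρ h2, Ex.eval, if_pos heq]
  | letv x e f ihe ihf =>
    intro ρ α k l σ hok hρ hα hz hN
    obtain ⟨hx, hoke, hokf⟩ := hok
    refine ((ihe ρ α k l σ hoke hρ hα hz hN).seq (B' := f.cost.eval N + 2) (Q' := Post σ k _)
      ?_).mono (by simp [Ex.cost]; omega) (fun _ h => h)
    rintro σ' ⟨h1, h2, h3, h4⟩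
    refine (ihf (Function.update ρ x k) α (k + 1) l σ' hokf (upd_lt hρ (by omega) (by omega)) hα
      (by rw [h3]; exact hz) (fun b hb => ?_)).seq ?_
    · rw [Function.update_of_ne (by omega), h2 _ (hρ b)]; exact hN b hb
    rintro σ'' ⟨h5, h6, h7, h8⟩
    refine ends_assign ⟨?_, fun y hy => ?_, h7.trans h3, h8.trans h4⟩
    · simp [Term.eval, Ex.eval, h5, h1, h3, Env.setV, comp_update_of_eq, comp_congr hρ h2]
    · simp [Function.update_of_ne (show y ≠ k by omega), h2 y hy, h6 y (by omega)]
  | sum x b e ih =>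
    intro ρ α k l σ hok hρ hα hz hN
    obtain ⟨hx, hb, hok⟩ := hok
    set v : Env := ⟨σ.var ∘ ρ, σ.arr ∘ α⟩ with hv
    let I : ℕ → State → Prop := fun i σ' =>
      σ'.var k = ∑ j ∈ Finset.range i, e.eval (v.setV x j) ∧ σ'.var (k + 1) = i ∧
        (∀ y < k, σ'.var y = σ.var y) ∧ σ'.arr = σ.arr ∧ σ'.out = σ.out
    have hloop : ∀ σ', I 0 σ' → Ends (.while (.sub (.var (ρ b)) (.var (k + 1)))
          (.seq (e.compile (Function.update ρ x (k + 1)) α (k + 2) l)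
            (.seq (.assign k (.add (.var k) (.var (k + 2))))
              (.assign (k + 1) (.add (.var (k + 1)) (.const 1)))))) σ'
          (σ.var (ρ b) * (4 + (e.cost.eval N + (4 + 4))) + 4) (I (σ.var (ρ b))) := by
      intro σ' h0
      refine ends_while I ?_ ?_ h0
      · rintro i hi τ ⟨h1, h2, h3, h4, h5⟩
        refine ⟨by simp only [Term.eval, h2, h3 _ (hρ b)]; omega, ?_⟩
        refine (ih (Function.update ρ x (k + 1)) α (k + 2) l τ hok
          (upd_lt hρ (by omega) (by omega)) hα (by rw [h4]; exact hz) (fun b hb => ?_)).seq ?_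
        · rw [Function.update_of_ne (by omega), h3 _ (hρ b)]; exact hN b hb
        rintro τ' ⟨h6, h7, h8, h9⟩
        refine Ends.seq (B := 4) (B' := 4) (ends_assign (Q := fun τ'' =>
          τ''.var k = ∑ j ∈ Finset.range (i + 1), e.eval (v.setV x j) ∧ τ''.var (k + 1) = i ∧
          (∀ y < k, τ''.var y = σ.var y) ∧ τ''.arr = σ.arr ∧ τ''.out = σ.out) ?_) ?_
        · refine ⟨?_, ?_, fun y hy => ?_, h8.trans h4, h9.trans h5⟩
          · rw [Finset.sum_range_succ, ← h1]
            simp only [Term.eval, Function.update_self, h6, h7 k (by omega)]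
            rw [h4, comp_update_of_eq, comp_congr hρ h3, h2]
            rfl
          · simp [h7 (k + 1) (by omega), h2]
          · simp [Function.update_of_ne (show y ≠ k by omega), h7 y (by omega), h3 y hy]
        · rintro τ'' ⟨g1, g2, g3, g4, g5⟩
          refine ends_assign ⟨?_, ?_, fun y hy => ?_, g4, g5⟩
          · simp [g1]
          · simp [Term.eval, g2]
          · simp [Function.update_of_ne (show y ≠ k + 1 by omega), g3 y hy]
      · rintro τ ⟨h1, h2, h3, h4, h5⟩
        simp [Term.eval, h2, h3 _ (hρ b)]
    refine (Ends.seq (B := 2) (B' := 2 + (σ.var (ρ b) * (4 + (e.cost.eval N + (4 + 4))) + 4))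
      (ends_assign (Q := Post σ k 0) ⟨by simp [Term.eval], fun y hy =>
        Function.update_of_ne (by omega) _ _, rfl, rfl⟩) fun σ' h => Ends.seq (B := 2)
        (ends_assign (Q := I 0) ?_) fun σ'' h' => (hloop _ h').mono le_rfl (Q' := Post σ k _)
          ?_).mono ?_ fun _ h => h
    · obtain ⟨h1, h2, h3, h4⟩ := h
      refine ⟨?_, ?_, fun y hy => ?_, h3, h4⟩
      · simp [h1]
      · simp [Term.eval]
      · simp [Function.update_of_ne (show y ≠ k + 1 by omega), h2 y hy]
    · rintro τ ⟨h1, h2, h3, h4, h5⟩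
      exact ⟨h1, h3, h4, h5⟩
    · have := Nat.mul_le_mul_right (e.cost.eval N + 12) (hN b hb)
      simp only [Ex.cost, Polynomial.eval_add, Polynomial.eval_mul, Polynomial.eval_X,
        Polynomial.eval_ofNat]
      rw [show 4 + (e.cost.eval N + (4 + 4)) = e.cost.eval N + 12 by omega]
      omega
  | tab a x b e f ihe ihf =>
    intro ρ α k l σ hok hρ hα hz hN
    obtain ⟨hx, hb, hoke, hokf⟩ := hok
    set v : Env := ⟨σ.var ∘ ρ, σ.arr ∘ α⟩ with hv
    set g : ℕ → (ℕ → ℕ) → ℕ := fun i T => e.eval ((v.setA a T).setV x i) with hg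
    have hαl : ∀ y, Function.update α a l y < l + 1 := upd_lt hα (by omega) (by omega)
    have harr : ∀ T : ℕ → ℕ, Function.update σ.arr l T ∘ Function.update α a l
        = Function.update v.arr a T := by
      intro T
      funext y
      by_cases h : y = a
      · subst h; simp
      · simp [Function.update_of_ne h, Function.update_of_ne (hα y).ne, hv]
    let I : ℕ → State → Prop := fun i σ' =>
      σ'.var k = i ∧ (∀ y < k, σ'.var y = σ.var y) ∧
        σ'.arr = Function.update σ.arr l (tabSeq g i) ∧ σ'.out = σ.out
    have hloop : ∀ σ', I 0 σ' → Ends (.while (.sub (.var (ρ b)) (.var k))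
          (.seq (e.compile (Function.update ρ x k) (Function.update α a l) (k + 1) (l + 1))
            (.seq (.store l (.var k) (.var (k + 1)))
              (.assign k (.add (.var k) (.const 1)))))) σ'
          (σ.var (ρ b) * (4 + (e.cost.eval N + (3 + 4))) + 4) (I (σ.var (ρ b))) := by
      intro σ' h0
      refine ends_while I ?_ ?_ h0
      · rintro i hi τ ⟨h1, h2, h3, h4⟩
        refine ⟨by simp only [Term.eval, h1, h2 _ (hρ b)]; omega, ?_⟩
        refine (ihe (Function.update ρ x k) (Function.update α a l) (k + 1) (l + 1) τ hoke
          (upd_lt hρ (by omega) (by omega)) hαl (fun c hc => ?_) (fun b hb => ?_)).seq ?_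
        · rw [h3, Function.update_of_ne (by omega)]; exact hz c (by omega)
        · rw [Function.update_of_ne (by omega), h2 _ (hρ b)]; exact hN b hb
        rintro τ' ⟨h6, h7, h8, h9⟩
        refine Ends.seq (B := 3) (B' := 4) (ends_store (Q := fun τ'' =>
          τ''.var k = i ∧ (∀ y < k, τ''.var y = σ.var y) ∧
          τ''.arr = Function.update σ.arr l (tabSeq g (i + 1)) ∧ τ''.out = σ.out) ?_) ?_
        · refine ⟨(h7 k (by omega)).trans h1, fun y hy => (h7 y (by omega)).trans (h2 y hy), ?_,
            h9.trans h4⟩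
          simp only [Term.eval, h6, h7 k (by omega), h8, h1]
          rw [h3, Function.update_self, Function.update_idem, harr, comp_update_of_eq,
            comp_congr hρ h2, h1]
          rfl
        · rintro τ'' ⟨g1, g2, g3, g4⟩
          refine ends_assign ⟨?_, fun y hy => ?_, g3, g4⟩
          · simp [Term.eval, g1]
          · simp [Function.update_of_ne (show y ≠ k by omega), g2 y hy]
      · rintro τ ⟨h1, h2, h3, h4⟩
        simp [Term.eval, h1, h2 _ (hρ b)]
    set val : ℕ := (Ex.tab a x b e f).eval v with hval
    let I' : ℕ → State → Prop := fun i σ' =>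
      σ'.var k = val ∧ σ'.var (k + 1) = i ∧ (∀ y < k, σ'.var y = σ.var y) ∧
        σ'.arr = Function.update σ.arr l
          (fun j => if j < i then 0 else tabSeq g (σ.var (ρ b)) j) ∧ σ'.out = σ.out
    have hloop' : ∀ σ', I' 0 σ' → Ends (.while (.sub (.var (ρ b)) (.var (k + 1)))
              (.seq (.store l (.var (k + 1)) (.const 0))
                (.assign (k + 1) (.add (.var (k + 1)) (.const 1))))) σ'
          (σ.var (ρ b) * (4 + (3 + 4)) + 4) (I' (σ.var (ρ b))) := by
      intro σ' h0
      refine ends_while I' ?_ ?_ h0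
      · rintro i hi τ ⟨h1, h2, h3, h4, h5⟩
        refine ⟨by simp only [Term.eval, h2, h3 _ (hρ b)]; omega, ?_⟩
        refine Ends.seq (B := 3) (B' := 4) (ends_store (Q := fun τ'' =>
          τ''.var k = val ∧ τ''.var (k + 1) = i ∧ (∀ y < k, τ''.var y = σ.var y) ∧
          τ''.arr = Function.update σ.arr l
            (fun j => if j < i + 1 then 0 else tabSeq g (σ.var (ρ b)) j) ∧ τ''.out = σ.out) ?_) ?_
        · refine ⟨h1, h2, h3, ?_, h5⟩
          simp only [Term.eval, h2, h4, Function.update_self, Function.update_idem]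
          congr 1
          funext j
          rw [Function.update_apply]
          split_ifs <;> first | rfl | omega
        · rintro τ'' ⟨g1, g2, g3, g4, g5⟩
          refine ends_assign ⟨?_, ?_, fun y hy => ?_, g4, g5⟩
          · simp [g1]
          · simp [Term.eval, g2]
          · simp [Function.update_of_ne (show y ≠ k + 1 by omega), g3 y hy]
      · rintro τ ⟨h1, h2, h3, h4, h5⟩
        simp [Term.eval, h2, h3 _ (hρ b)]
    refine (Ends.seq (B := 2) (B' := (σ.var (ρ b) * (4 + (e.cost.eval N + (3 + 4))) + 4) +
      (f.cost.eval N + (2 + (σ.var (ρ b) * (4 + (3 + 4)) + 4))))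
      (ends_assign (Q := I 0) ?_) fun σ' h => (hloop _ h).seq fun σ₁ h1 => Ends.seq
        (B := f.cost.eval N) (Q := Post σ₁ k val) ?_ fun σ₂ h2 => Ends.seq (B := 2)
        (ends_assign (Q := I' 0) ?_) fun σ₃ h3 => (hloop' _ h3).mono le_rfl (Q' := Post σ k _)
          ?_).mono ?_ fun _ h => h
    · refine ⟨by simp [Term.eval], fun y hy => Function.update_of_ne (by omega) _ _, ?_, rfl⟩
      rw [tabSeq, ← hz l le_rfl, Function.update_eq_self]
    · obtain ⟨g1, g2, g3, g4⟩ := h1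
      refine (ihf ρ (Function.update α a l) k (l + 1) σ₁ hokf hρ hαl (fun c hc => ?_)
        (fun b hb => ?_)).mono le_rfl ?_
      · rw [g3, Function.update_of_ne (by omega)]; exact hz c (by omega)
      · rw [g2 _ (hρ b)]; exact hN b hb
      · rintro τ ⟨k1, k2, k3, k4⟩
        refine ⟨?_, k2, k3, k4⟩
        rw [k1, g3, harr, comp_congr hρ g2]
        rfl
    · obtain ⟨g1, g2, g3, g4⟩ := h1
      obtain ⟨k1, k2, k3, k4⟩ := h2
      refine ⟨by simp [k1], by simp [Term.eval], fun y hy => ?_, ?_, k4.trans g4⟩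
      · simp [Function.update_of_ne (show y ≠ k + 1 by omega), k2 y hy, g2 y hy]
      · simp [k3, g3]
    · rintro τ ⟨g1, g2, g3, g4, g5⟩
      refine ⟨g1, g3, ?_, g5⟩
      rw [g4, show (fun j => if j < σ.var (ρ b) then 0 else tabSeq g (σ.var (ρ b)) j) = σ.arr l
        from ?_, Function.update_eq_self]
      funext j
      rw [hz l le_rfl]
      split_ifs with hj
      · rfl
      · exact tabSeq_of_le g (by omega)
    · have h1 := Nat.mul_le_mul_right (e.cost.eval N + 11) (hN b hb)
      have h2 := Nat.mul_le_mul_right 11 (hN b hb)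
      simp only [Ex.cost, Polynomial.eval_add, Polynomial.eval_mul, Polynomial.eval_X,
        Polynomial.eval_ofNat]
      rw [show 4 + (e.cost.eval N + (3 + 4)) = e.cost.eval N + 11 by omega]
      omega

end RAM

namespace RAM

/-! ### Programs assembled from expressions -/

/-- The place of the `j`-th of the first `i` parameters; variable `0` is unused. -/
def place (i : ℕ) : ℕ → ℕ := fun y => if y < i then y + 1 else 0

theorem place_lt (i y : ℕ) : place i y < i + 1 := by
  unfold place
  split_ifs <;> omega

/-- Compute the expressions of a list one after the other as the parameters `i`, `i + 1`, …, and
then run `P`. -/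
def stages : List Ex → ℕ → Prog → Prog
  | [], _, P => P
  | e :: es, i, P => .seq (e.compile (place i) (fun _ => 0) (i + 1) 1) (stages es (i + 1) P)

/-- Write the value of an expression. -/
def write (e : Ex) (ρ : ℕ → ℕ) (k : ℕ) : Prog :=
  .seq (e.compile ρ (fun _ => 0) k 1) (.emit (.var k))

/-- Write `e₀`, and then, for each value of `t` below the parameter `b` at which `c` is not zero,
write `e` and `f`. -/
def report (e₀ c e f : Ex) (t b m : ℕ) : Prog :=
  .seq (write e₀ (place m) (m + 1)) (.seq (.assign (m + 1) (.const 0))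
    (.while (.sub (.var (place m b)) (.var (m + 1)))
      (.seq (c.compile (Function.update (place m) t (m + 1)) (fun _ => 0) (m + 2) 1)
        (.seq (.ite (.var (m + 2))
          (.seq (write e (Function.update (place m) t (m + 1)) (m + 2))
            (write f (Function.update (place m) t (m + 1)) (m + 2)))
          (.assign (m + 2) (.const 0)))
          (.assign (m + 1) (.add (.var (m + 1)) (.const 1)))))))

/-- The list that `report` writes. -/
def reported (e₀ c e f : Ex) (t b : ℕ) (v : Env) : List ℕ :=
  e₀.eval v :: (List.range (v.var b)).flatMap fun i =>
    if c.eval (v.setV t i) = 0 then [] else [e.eval (v.setV t i), f.eval (v.setV t i)]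

theorem write_ends {m N : ℕ} (e : Ex) (ρ : ℕ → ℕ) (k : ℕ) (σ : State) (hok : e.Ok m)
    (hρ : ∀ y, ρ y < k) (hz : ∀ a, 1 ≤ a → σ.arr a = 0) (hN : ∀ b < m, σ.var (ρ b) ≤ N) :
    Ends (write e ρ k) σ (e.cost.eval N + 2) fun σ' =>
      (∀ y < k, σ'.var y = σ.var y) ∧ σ'.arr = σ.arr ∧
        σ'.out = σ.out ++ [e.eval ⟨σ.var ∘ ρ, fun _ => σ.arr 0⟩] := by
  refine (e.compile_ends ρ (fun _ => 0) k 1 σ hok hρ (fun _ => one_pos) hz hN).seq ?_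
  rintro σ' ⟨h1, h2, h3, h4⟩
  refine ends_emit ⟨h2, h3, ?_⟩
  simp only [Term.eval, h1, h4]
  rfl

/-- `report` writes `reported`, in polynomial time. -/
theorem report_ends {m N : ℕ} (e₀ c e f : Ex) (t b : ℕ) (σ : State) (ht : m ≤ t) (hb : b < m)
    (h₀ : e₀.Ok m) (hc : c.Ok m) (he : e.Ok m) (hf : f.Ok m)
    (hz : ∀ a, 1 ≤ a → σ.arr a = 0) (hN : ∀ b < m, σ.var (place m b) ≤ N) (hout : σ.out = []) :
    Ends (report e₀ c e f t b m) σ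
      (e₀.cost.eval N + N * (c.cost.eval N + e.cost.eval N + f.cost.eval N + 16) + 8) fun σ' =>
      σ'.out = reported e₀ c e f t b ⟨σ.var ∘ place m, fun _ => σ.arr 0⟩ := by
  set v : Env := ⟨σ.var ∘ place m, fun _ => σ.arr 0⟩ with hv
  set ρ := Function.update (place m) t (m + 1) with hρ
  have hρlt : ∀ y, ρ y < m + 2 := by
    intro y
    rw [hρ, Function.update_apply]
    split_ifs
    · omega
    · exact (place_lt m y).trans (by omega)
  let g : ℕ → List ℕ := fun i =>
    if c.eval (v.setV t i) = 0 then [] else [e.eval (v.setV t i), f.eval (v.setV t i)]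
  let I : ℕ → State → Prop := fun i τ =>
    (∀ y < m + 1, τ.var y = σ.var y) ∧ τ.var (m + 1) = i ∧ τ.arr = σ.arr ∧
      τ.out = e₀.eval v :: (List.range i).flatMap g
  have henv : ∀ (τ : State) (i : ℕ), (∀ y < m + 1, τ.var y = σ.var y) → τ.var (m + 1) = i →
      τ.arr = σ.arr → (⟨τ.var ∘ ρ, fun _ => τ.arr 0⟩ : Env) = v.setV t i := by
    intro τ i h1 h2 h3
    rw [hρ, comp_update_of_eq, h2, h3, Env.setV, hv]
    congr 2
    funext y
    exact h1 _ (place_lt m y)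
  have hNτ : ∀ τ : State, (∀ y < m + 1, τ.var y = σ.var y) → ∀ b < m, τ.var (ρ b) ≤ N := by
    intro τ h b hb
    rw [hρ, Function.update_of_ne (by omega), h _ (place_lt m b)]
    exact hN b hb
  have hbody : ∀ i < σ.var (place m b), ∀ τ, I i τ → (Term.sub (.var (place m b))
      (.var (m + 1))).eval τ ≠ 0 ∧ Ends
      (.seq (c.compile ρ (fun _ => 0) (m + 2) 1)
        (.seq (.ite (.var (m + 2)) (.seq (write e ρ (m + 2)) (write f ρ (m + 2)))
          (.assign (m + 2) (.const 0)))
          (.assign (m + 1) (.add (.var (m + 1)) (.const 1))))) τ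
      (c.cost.eval N + ((2 + ((e.cost.eval N + 2) + (f.cost.eval N + 2)) + 2) + 4))
      (I (i + 1)) := by
    rintro i hi τ ⟨h1, h2, h3, h4⟩
    refine ⟨by simp only [Term.eval, h2, h1 _ (place_lt m b)]; omega, ?_⟩
    refine (c.compile_ends ρ (fun _ => 0) (m + 2) 1 τ hc hρlt (fun _ => one_pos)
      (by rw [h3]; exact hz) (hNτ τ h1)).seq ?_
    rintro τ₁ ⟨k1, k2, k3, k4⟩
    have e1 : ∀ y < m + 1, τ₁.var y = σ.var y := fun y hy =>
      (k2 y (by omega)).trans (h1 y hy)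
    have e2 : τ₁.var (m + 1) = i := (k2 _ (by omega)).trans h2
    have e3 : τ₁.arr = σ.arr := k3.trans h3
    have hval : τ₁.var (m + 2) = c.eval (v.setV t i) := k1.trans (by rw [← henv τ i h1 h2 h3]; rfl)
    refine Ends.seq (Q := fun τ' => (∀ y < m + 1, τ'.var y = σ.var y) ∧ τ'.var (m + 1) = i ∧
      τ'.arr = σ.arr ∧ τ'.out = e₀.eval v :: (List.range (i + 1)).flatMap g)
      (ends_ite (fun hne => ?_) (fun heq => ends_assign ?_)) ?_
    · refine (write_ends e ρ (m + 2) τ₁ he hρlt (by rw [e3]; exact hz) (hNτ _ e1)).seq ?_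
      rintro τ₂ ⟨l1, l2, l3⟩
      have d1 : ∀ y < m + 1, τ₂.var y = σ.var y := fun y hy =>
        (l1 y (by omega)).trans (e1 y hy)
      have d2 : τ₂.var (m + 1) = i := (l1 _ (by omega)).trans e2
      have d3 : τ₂.arr = σ.arr := l2.trans e3
      refine (write_ends f ρ (m + 2) τ₂ hf hρlt (by rw [d3]; exact hz) (hNτ _ d1)).mono le_rfl ?_
      rintro τ₃ ⟨n1, n2, n3⟩
      refine ⟨fun y hy => (n1 y (by omega)).trans (d1 y hy), (n1 _ (by omega)).trans d2,
        n2.trans d3, ?_⟩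
      simp only [Term.eval, hval] at hne
      rw [n3, l3, k4, h4, henv τ₁ i e1 e2 e3, henv τ₂ i d1 d2 d3, List.range_succ]
      simp [g, hne]
    · simp only [Term.eval, hval] at heq
      refine ⟨fun y hy => ?_, ?_, e3, ?_⟩
      · simp [Function.update_of_ne (show y ≠ m + 2 by omega), e1 y hy]
      · simp [e2]
      · simp only
        rw [k4, h4, List.range_succ]
        simp [g, heq]
    · rintro τ₂ ⟨l1, l2, l3, l4⟩
      refine ends_assign ⟨fun y hy => ?_, ?_, l3, l4⟩
      · simp [Function.update_of_ne (show y ≠ m + 1 by omega), l1 y hy]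
      · simp [Term.eval, l2]
  refine ((write_ends e₀ (place m) (m + 1) σ h₀ (place_lt m) hz hN).seq fun τ h =>
    Ends.seq (B := 2) (ends_assign (Q := I 0) ?_) fun τ' h' =>
      (ends_while I hbody ?_ h').mono le_rfl (Q' := fun σ' => σ'.out = _) ?_).mono ?_ fun _ h => h
  · obtain ⟨h1, h2, h3⟩ := h
    refine ⟨fun y hy => ?_, ?_, h2, ?_⟩
    · simp [Function.update_of_ne (show y ≠ m + 1 by omega), h1 y hy]
    · simp [Term.eval]
    · simp [h3, hout, hv]
  · rintro τ ⟨h1, h2, h3, h4⟩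
    simp [Term.eval, h2, h1 _ (place_lt m b)]
  · rintro τ ⟨h1, h2, h3, h4⟩
    exact h4
  · have := Nat.mul_le_mul_right (c.cost.eval N + e.cost.eval N + f.cost.eval N + 16) (hN b hb)
    simp only [Term.cost]
    rw [show 1 + 1 + 1 + 1 + (c.cost.eval N + ((2 + ((e.cost.eval N + 2) + (f.cost.eval N + 2)) + 2)
      + 4)) = c.cost.eval N + e.cost.eval N + f.cost.eval N + 16 by omega]
    omega

/-- The contents of the input array. -/
def inputArr (w : List ℕ) (i : ℕ) : ℕ := w.getD i 0

/-- The environment holds the input `w` and the values `prm` of the first `m` parameters. -/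
structure Good (w : List ℕ) (prm : ℕ → ℕ) (m : ℕ) (v : Env) : Prop where
  arr : v.arr 0 = inputArr w
  var : ∀ j < m, v.var j = prm j

/-- After the stages, the parameters stand in their places, and `P` takes over. -/
theorem stages_ends {w : List ℕ} {prm : ℕ → ℕ} {N B : ℕ} {P : Prog} {R : State → Prop} :
    ∀ (es : List Ex) (i : ℕ) (σ : State),
    (∀ j (h : j < es.length), (es[j]).Ok (i + j) ∧
      ∀ v, Good w prm (i + j) v → (es[j]).eval v = prm (i + j)) →
    (∀ j < i + es.length, prm j ≤ N) →
    Good w prm i ⟨σ.var ∘ place i, fun _ => σ.arr 0⟩ →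
    (∀ a, 1 ≤ a → σ.arr a = 0) → σ.out = [] →
    (∀ τ : State, Good w prm (i + es.length) ⟨τ.var ∘ place (i + es.length), fun _ => τ.arr 0⟩ →
      (∀ a, 1 ≤ a → τ.arr a = 0) → τ.out = [] → Ends P τ B R) →
    Ends (stages es i P) σ ((es.map fun e => e.cost.eval N).sum + B) R := by
  intro es
  induction es with
  | nil =>
    intro i σ _ _ hg hz ho hP
    exact (hP σ hg hz ho).mono (by simp) fun _ h => h
  | cons e es ih =>
    intro i σ he hN hg hz ho hP
    have hlen : i + (e :: es).length = (i + 1) + es.length := by simp; omega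
    have h0 := he 0 (by simp)
    simp only [List.getElem_cons_zero, add_zero] at h0
    refine ((e.compile_ends (place i) (fun _ => 0) (i + 1) 1 σ h0.1 (place_lt i)
      (fun _ => one_pos) hz (N := N) fun b hb => ?_).seq
      (B' := (es.map fun e => e.cost.eval N).sum + B) (Q' := R) ?_).mono ?_ fun _ h => h
    · have h := hg.var b hb
      simp only [Function.comp] at h
      exact h ▸ hN b (by omega)
    · rintro τ ⟨h1, h2, h3, h4⟩
      refine ih (i + 1) τ (fun j hj => ?_) (fun j hj => hN j (by omega)) ⟨?_, fun j hj => ?_⟩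
        (by rw [h3]; exact hz) (h4.trans ho) (fun τ' => ?_)
      · have := he (j + 1) (by simpa using hj)
        rw [show i + (j + 1) = i + 1 + j by omega] at this
        simpa using this
      · rw [h3]; exact hg.arr
      · simp only [Function.comp, place, if_pos hj]
        rcases Nat.lt_succ_iff_lt_or_eq.1 hj with h | rfl
        · rw [h2 _ (by omega), ← hg.var j h]
          simp [place, h]
        · rw [h1]
          exact h0.2 _ hg
      · rw [← hlen]
        exact hP τ'
    · simp [add_assoc]

/-- A problem is solvable in polynomial time if its solutions are reported by expressions whose
loops are bounded by parameters of polynomial size, each of which is an expression in the input and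
the parameters before it. -/
theorem solvableInPolyTime_of_ex {ι : Type} (code : ι → List ℕ) (sol : ι → List ℕ → Prop)
    (es : List Ex) (prm : ι → ℕ → ℕ) (r : Polynomial ℕ)
    (hes : ∀ j (h : j < es.length), (es[j]).Ok j ∧
      ∀ x v, Good (code x) (prm x) j v → (es[j]).eval v = prm x j)
    (hr : ∀ x, ∀ j < es.length, prm x j ≤ r.eval (inputSize (code x)))
    (e₀ c e f : Ex) (t b : ℕ) (ht : es.length ≤ t) (hb : b < es.length)
    (h₀ : e₀.Ok es.length) (hc : c.Ok es.length) (he : e.Ok es.length) (hf : f.Ok es.length)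
    (hsol : ∀ x v, Good (code x) (prm x) es.length v → sol x (reported e₀ c e f t b v)) :
    SolvableInPolyTime code sol := by
  refine ⟨stages es 0 (report e₀ c e f t b es.length),
    ((es.map fun e : Ex => e.cost).sum + (e₀.cost + Polynomial.X * (c.cost + e.cost + f.cost + 16)
      + 8)).comp r, fun x => ?_⟩
  set N := r.eval (inputSize (code x)) with hN
  obtain ⟨k, σ, h1, h2, h3⟩ := stages_ends (w := code x) (prm := prm x) (N := N)
    (P := report e₀ c e f t b es.length) (R := fun σ => sol x σ.out)
    (B := e₀.cost.eval N + N * (c.cost.eval N + e.cost.eval N + f.cost.eval N + 16) + 8)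
    es 0 (State.init (code x))
    (fun j hj => by simpa using ⟨(hes j hj).1, (hes j hj).2 x⟩)
    (fun j hj => hr x j (by simpa using hj))
    ⟨by funext i; simp [State.init, inputArr], fun j hj => by omega⟩
    (fun a ha => by funext i; simp [State.init]; omega) rfl
    (fun τ hg hz ho => by
      rw [zero_add] at hg
      refine (report_ends e₀ c e f t b τ ht hb h₀ hc he hf hz (fun b hb => ?_) ho).mono le_rfl ?_
      · have h := hg.var b hb
        simp only [Function.comp] at h
        exact h ▸ hr x b hb
      · intro σ' h
        rw [h]
        exact hsol x _ hg)
  refine ⟨k, σ, h1, h2.trans (le_of_eq ?_), h3⟩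
  have hs : ∀ l : List Ex, ((l.map fun e : Ex => e.cost).sum).eval N
      = (l.map fun e => e.cost.eval N).sum := by
    intro l
    induction l with
    | nil => simp
    | cons a l ih => simp [ih]
  simp only [Polynomial.eval_comp, ← hN, Polynomial.eval_add, Polynomial.eval_mul,
    Polynomial.eval_X, Polynomial.eval_ofNat, hs]

end RAM

namespace DMVP

/-! ### Timed walks and earliest arrival -/

/-- `Rch av τ u T w`: an agent that is at `u` at time `τ` can be at `w` at time `T`, when `av t x y`
says that it can cross from `x` to `y` at time `t`. -/
inductive Rch (av : ℕ → ℕ → ℕ → Prop) (τ u : ℕ) : ℕ → ℕ → Prop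
  | refl : Rch av τ u τ u
  | wait {T w : ℕ} : Rch av τ u T w → Rch av τ u (T + 1) w
  | move {T x w : ℕ} : Rch av τ u T x → av T x w → Rch av τ u (T + 1) w

/-- `f` gives the positions of an agent between the times `τ` and `T`. -/
def TW (av : ℕ → ℕ → ℕ → Prop) (τ T : ℕ) (f : ℕ → ℕ) : Prop :=
  ∀ t, τ ≤ t → t < T → f (t + 1) = f t ∨ av t (f t) (f (t + 1))

/-- An agent that is at `u` at time `τ` can visit all of `U` by time `T`. -/
def Cov (av : ℕ → ℕ → ℕ → Prop) (u τ : ℕ) (U : Set ℕ) (T : ℕ) : Prop :=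
  τ ≤ T ∧ ∃ f, TW av τ T f ∧ f τ = u ∧ ∀ x ∈ U, ∃ t, τ ≤ t ∧ t ≤ T ∧ f t = x

/-- The least number of time steps in which an agent that is at `u` at time `τ` can be at `w`. -/
noncomputable def dl (av : ℕ → ℕ → ℕ → Prop) (τ u w : ℕ) : ℕ := sInf {d | Rch av τ u (τ + d) w}

/-- The earliest time at which an agent that is at `u` at time `τ` can be at `w`. -/
noncomputable def arr (av : ℕ → ℕ → ℕ → Prop) (u w τ : ℕ) : ℕ := τ + dl av τ u w

variable {av : ℕ → ℕ → ℕ → Prop}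

theorem Rch.le {τ u T w : ℕ} (h : Rch av τ u T w) : τ ≤ T := by
  induction h <;> omega

theorem Rch.trans {τ u T w T' w' : ℕ} (h : Rch av τ u T w) (h' : Rch av T w T' w') :
    Rch av τ u T' w' := by
  induction h' with
  | refl => exact h
  | wait _ ih => exact ih.wait
  | move _ hm ih => exact ih.move hm

theorem Rch.mono {τ u T w T' : ℕ} (h : Rch av τ u T w) (hT : T ≤ T') : Rch av τ u T' w := by
  induction T', hT using Nat.le_induction with
  | base => exact h
  | succ _ _ ih => exact ih.wait

theorem Rch.stay (av : ℕ → ℕ → ℕ → Prop) {τ T : ℕ} (u : ℕ) (h : τ ≤ T) : Rch av τ u T u :=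
  Rch.refl.mono h

theorem rch_add_succ {τ u d w : ℕ} : Rch av τ u (τ + (d + 1)) w ↔
    Rch av τ u (τ + d) w ∨ ∃ x, Rch av τ u (τ + d) x ∧ av (τ + d) x w := by
  constructor
  · intro h
    generalize hT : τ + (d + 1) = T at h
    cases h with
    | refl => omega
    | @wait T' _ h =>
      obtain rfl : T' = τ + d := by omega
      exact Or.inl h
    | @move T' _ _ h hm =>
      obtain rfl : T' = τ + d := by omega
      exact Or.inr ⟨_, h, hm⟩
  · rintro (h | ⟨x, h, hm⟩)
    · exact h.wait
    · exact h.move hm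

theorem rch_self {τ u w : ℕ} : Rch av τ u τ w ↔ u = w := by
  constructor
  · intro h
    generalize hT : τ = T at h
    cases h with
    | refl => rfl
    | wait h => exact absurd h.le (by omega)
    | move h => exact absurd h.le (by omega)
  · rintro rfl
    exact .refl

theorem TW.mono {τ T τ' T' : ℕ} {f : ℕ → ℕ} (h : TW av τ T f) (h1 : τ ≤ τ') (h2 : T' ≤ T) :
    TW av τ' T' f :=
  fun t ht ht' => h t (h1.trans ht) (ht'.trans_le h2)

theorem TW.rch {τ T : ℕ} {f : ℕ → ℕ} (h : TW av τ T f) (hT : τ ≤ T) :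
    Rch av τ (f τ) T (f T) := by
  induction T, hT using Nat.le_induction with
  | base => exact .refl
  | succ T hT ih =>
    have ih := ih (h.mono le_rfl (by omega))
    rcases h T hT (by omega) with h | h
    · rw [h]; exact ih.wait
    · exact ih.move h

theorem TW.rch_of_le {τ T t t' : ℕ} {f : ℕ → ℕ} (h : TW av τ T f) (h1 : τ ≤ t) (h2 : t ≤ t')
    (h3 : t' ≤ T) : Rch av t (f t) t' (f t') :=
  (h.mono h1 h3).rch h2

/-- The concatenation of two timed walks. -/
theorem TW.append {τ T T' : ℕ} {f g : ℕ → ℕ} (hf : TW av τ T f) (hg : TW av T T' g)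
    (h : f T = g T) : TW av τ T' fun t => if t ≤ T then f t else g t := by
  intro t h1 h2
  rcases lt_trichotomy t T with h3 | rfl | h3
  · simpa [h3.le, Nat.succ_le_of_lt h3] using hf t h1 h3
  · simpa [h] using hg t le_rfl h2
  · simpa [not_le.2 h3, show ¬ t + 1 ≤ T by omega] using hg t h3.le h2

theorem Rch.exists_tw {τ u T w : ℕ} (h : Rch av τ u T w) :
    ∃ f, TW av τ T f ∧ f τ = u ∧ f T = w := by
  induction h with
  | refl => exact ⟨fun _ => u, fun t h1 h2 => by omega, rfl, rfl⟩
  | @wait T w h ih =>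
    obtain ⟨f, h1, h2, h3⟩ := ih
    have := h.le
    exact ⟨_, h1.append (g := fun _ => w) (T' := T + 1) (fun t h1 h2 => Or.inl rfl) h3,
      by simp [this, h2], by simp⟩
  | @move T x w h hm ih =>
    obtain ⟨f, h1, h2, h3⟩ := ih
    have := h.le
    refine ⟨_, h1.append (g := fun t => if t ≤ T then x else w) (T' := T + 1) ?_ (by simp [h3]),
      by simp [this, h2], by simp⟩
    intro t h1 h2
    obtain rfl : t = T := by omega
    exact Or.inr (by simpa using hm)

theorem Cov.subset {u τ T : ℕ} {U U' : Set ℕ} (h : Cov av u τ U T) (hU : U' ⊆ U) :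
    Cov av u τ U' T := by
  obtain ⟨h0, f, h1, h2, h3⟩ := h
  exact ⟨h0, f, h1, h2, fun x hx => h3 x (hU hx)⟩

theorem Cov.mono {u τ T T' : ℕ} {U : Set ℕ} (h : Cov av u τ U T) (hT : T ≤ T') :
    Cov av u τ U T' := by
  obtain ⟨h0, f, h1, h2, h3⟩ := h
  refine ⟨h0.trans hT, _, h1.append (g := fun _ => f T) (T' := T') (fun t h1 h2 => Or.inl rfl) rfl,
    by simp [h0, h2], fun x hx => ?_⟩
  obtain ⟨t, h4, h5, h6⟩ := h3 x hx
  exact ⟨t, h4, h5.trans hT, by simp [h5, h6]⟩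

theorem Rch.cov {u τ w t T : ℕ} {U : Set ℕ} (h : Rch av τ u t w) (hc : Cov av w t U T) :
    Cov av u τ (insert u (insert w U)) T := by
  obtain ⟨f, h1, h2, h3⟩ := h.exists_tw
  obtain ⟨h0, g, k1, k2, k3⟩ := hc
  have hle := h.le
  refine ⟨hle.trans h0, _, h1.append k1 (h3.trans k2.symm), by simp [hle, h2], fun x hx => ?_⟩
  rcases hx with rfl | rfl | hx
  · exact ⟨τ, le_rfl, hle.trans h0, by simp [hle, h2]⟩
  · exact ⟨t, hle, h0, by simp [h3]⟩
  · obtain ⟨t', h4, h5, h6⟩ := k3 x hx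
    refine ⟨t', hle.trans h4, h5, ?_⟩
    rcases h4.eq_or_lt with rfl | h4
    · simpa [h3, ← k2] using h6
    · simpa [not_le.2 h4] using h6

theorem cov_empty {u τ T : ℕ} (h : τ ≤ T) : Cov av u τ ∅ T :=
  ⟨h, fun _ => u, fun _ _ _ => Or.inl rfl, rfl, fun _ hx => absurd hx (Set.notMem_empty _)⟩

/-- The first step of a covering walk. -/
theorem Cov.step {u τ T : ℕ} {U : Set ℕ} (h : Cov av u τ U T) (hT : τ < T) (hu : u ∉ U) :
    ∃ x, (x = u ∨ av τ u x) ∧ Cov av x (τ + 1) (U \ {x}) T := by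
  obtain ⟨h0, f, h1, h2, h3⟩ := h
  refine ⟨f (τ + 1), h2 ▸ h1 τ le_rfl hT, hT, f, h1.mono (by omega) le_rfl, rfl, fun x hx => ?_⟩
  obtain ⟨t, h4, h5, h6⟩ := h3 x hx.1
  refine ⟨t, ?_, h5, h6⟩
  rcases h4.eq_or_lt with rfl | h4
  · exact absurd hx.1 (by rw [← h6, h2]; exact hu)
  · exact h4

theorem Cov.eq_empty {u τ : ℕ} {U : Set ℕ} (h : Cov av u τ U τ) (hu : u ∉ U) : U = ∅ := by
  obtain ⟨h0, f, h1, h2, h3⟩ := h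
  refine Set.eq_empty_of_forall_notMem fun x hx => ?_
  obtain ⟨t, h4, h5, h6⟩ := h3 x hx
  obtain rfl : t = τ := by omega
  exact hu (by rwa [← h2, h6])

/-! ### Connected periodic graphs -/

/-- A periodic time-varying graph on the vertices below `n` in which, starting at any time, one can
get from anywhere to anywhere within `H` steps. -/
structure Net (av : ℕ → ℕ → ℕ → Prop) (n p H : ℕ) : Prop where
  lt : ∀ {t u w}, av t u w → u < n ∧ w < n
  per : ∀ t u w, av (t + p) u w ↔ av t u w
  conn : ∀ τ u w, u < n → w < n → Rch av τ u (τ + H) w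

variable {n p H : ℕ}

/-- By periodicity, reachability is invariant under shifting time by `p`. -/
theorem Net.rch_shift (hn : Net av n p H) {τ u T w : ℕ} :
    Rch av (τ + p) u (T + p) w ↔ Rch av τ u T w := by
  constructor
  · intro h
    generalize hT : T + p = T' at h
    have key : Rch av τ u (T' - p) w := by
      clear hT
      induction h with
      | refl => simpa using Rch.refl
      | @wait T' w h ih =>
        have := h.le
        rw [show T' + 1 - p = T' - p + 1 by omega]
        exact ih.wait
      | @move T' x w h hm ih =>
        have := h.le
        rw [show T' + 1 - p = T' - p + 1 by omega]
        refine ih.move ((hn.per _ _ _).1 ?_)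
        rwa [show T' - p + p = T' by omega]
    rwa [← hT, Nat.add_sub_cancel] at key
  · intro h
    induction h with
    | refl => exact .refl
    | @wait T w h ih =>
      rw [show T + 1 + p = T + p + 1 by omega]
      exact ih.wait
    | @move T x w h hm ih =>
      rw [show T + 1 + p = T + p + 1 by omega]
      exact ih.move ((hn.per _ _ _).2 hm)

theorem Net.dl_add (hn : Net av n p H) (τ u w : ℕ) : dl av (τ + p) u w = dl av τ u w := by
  unfold dl
  congr 1
  ext d
  simp only [Set.mem_ofPred_eq]
  rw [show τ + p + d = τ + d + p by omega, hn.rch_shift]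

theorem Net.dl_mod (hn : Net av n p H) (τ u w : ℕ) : dl av (τ % p) u w = dl av τ u w := by
  conv_rhs => rw [← Nat.mod_add_div τ p]
  induction τ / p with
  | zero => simp
  | succ k ih => rw [Nat.mul_succ, ← add_assoc, hn.dl_add, ih]

theorem Net.rch_arr (hn : Net av n p H) {u w : ℕ} (τ : ℕ) (hu : u < n) (hw : w < n) :
    Rch av τ u (arr av u w τ) w :=
  Nat.sInf_mem (s := {d | Rch av τ u (τ + d) w}) ⟨H, hn.conn τ u w hu hw⟩

theorem Net.dl_le (hn : Net av n p H) {u w : ℕ} (τ : ℕ) (hu : u < n) (hw : w < n) :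
    dl av τ u w ≤ H :=
  Nat.sInf_le (s := {d | Rch av τ u (τ + d) w}) (hn.conn τ u w hu hw)

theorem arr_le {u w τ T : ℕ} (h : Rch av τ u T w) : arr av u w τ ≤ T := by
  have := h.le
  have : dl av τ u w ≤ T - τ := Nat.sInf_le (by
    simp only [Set.mem_ofPred_eq]
    rwa [show τ + (T - τ) = T by omega])
  unfold arr
  omega

theorem Net.arr_mono (hn : Net av n p H) {u w τ τ' : ℕ} (hu : u < n) (hw : w < n) (h : τ ≤ τ') :
    arr av u w τ ≤ arr av u w τ' :=
  arr_le ((Rch.stay av u h).trans (hn.rch_arr τ' hu hw))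

/-- The number of waiting times that do not suffice is the least one that does. -/
theorem Net.dl_eq_sum (hn : Net av n p H) {u w : ℕ} (τ : ℕ) (hu : u < n) (hw : w < n)
    (g : ℕ → ℕ) (hg : ∀ d < H + 1, g d = 0 ↔ ¬ Rch av τ u (τ + d) w) :
    ∑ d ∈ Finset.range (H + 1), (if g d = 0 then 1 else 0) = dl av τ u w := by
  have h1 := hn.dl_le τ hu hw
  have h2 := hn.rch_arr τ hu hw
  rw [← Finset.sum_filter, Finset.sum_const, smul_eq_mul, mul_one]
  conv_rhs => rw [← Finset.card_range (dl av τ u w)]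
  congr 1
  ext d
  simp only [Finset.mem_filter, Finset.mem_range]
  constructor
  · rintro ⟨h3, h4⟩
    by_contra h5
    exact (hg d h3).1 h4 (h2.mono (by unfold arr; omega))
  · intro h
    exact ⟨by omega, (hg d (by omega)).2 fun h' => by
      have := arr_le h'
      unfold arr at this
      omega⟩

/-! ### Tours of the leaves of a spider -/

/-- The time at which an agent that is at `c` at time `t` has visited the vertices of the list `l`
in this order, if it returns to `c` between any two of them. -/
noncomputable def tour (av : ℕ → ℕ → ℕ → Prop) (c : ℕ) : List ℕ → ℕ → ℕ
  | [], t => t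
  | [w], t => arr av c w t
  | w :: w' :: l, t => tour av c (w' :: l) (arr av w c (arr av c w t))

/-- It never pays to start a tour later, since one can wait. -/
theorem Net.tour_mono (hn : Net av n p H) {c : ℕ} (hc : c < n) {l : List ℕ} (hl : ∀ w ∈ l, w < n)
    {t t' : ℕ} (h : t ≤ t') : tour av c l t ≤ tour av c l t' := by
  induction l generalizing t t' with
  | nil => exact h
  | cons w l ih =>
    have hw := hl w (by simp)
    cases l with
    | nil => exact hn.arr_mono hc hw h
    | cons w' l =>
      exact ih (fun x hx => hl x (List.mem_cons_of_mem _ hx))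
        (hn.arr_mono hw hc (hn.arr_mono hc hw h))

/-- An agent at `c` can carry out a tour. -/
theorem Net.cov_tour (hn : Net av n p H) {c : ℕ} (hc : c < n) {l : List ℕ} (hl : ∀ w ∈ l, w < n)
    (t : ℕ) : Cov av c t {x | x ∈ l} (tour av c l t) := by
  induction l generalizing t with
  | nil => exact (cov_empty le_rfl).subset (by intro x; simp)
  | cons w l ih =>
    have hw := hl w (by simp)
    cases l with
    | nil =>
      exact ((hn.rch_arr t hc hw).cov (cov_empty le_rfl)).subset (by intro x; simp; tauto)
    | cons w' l =>
      have h := ih (fun x hx => hl x (List.mem_cons_of_mem _ hx)) (arr av w c (arr av c w t))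
      exact ((hn.rch_arr t hc hw).cov ((hn.rch_arr _ hw hc).cov h)).subset
        (by intro x; simp; tauto)

/-- The set `L` of vertices is separated by `c`: one cannot get from one vertex of `L` to another
without passing through `c`. -/
def Sep (av : ℕ → ℕ → ℕ → Prop) (c : ℕ) (L : Set ℕ) : Prop :=
  ∀ τ T f, TW av τ T f → τ ≤ T → f τ ∈ L → f T ∈ L → f τ ≠ f T →
    ∃ t, τ ≤ t ∧ t ≤ T ∧ f t = c

/-- Among finitely many vertices that are visited, one is visited first. -/
theorem exists_first {S : Finset ℕ} (hS : S.Nonempty) {τ T : ℕ} {f : ℕ → ℕ}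
    (h : ∀ x ∈ S, ∃ t, τ ≤ t ∧ t ≤ T ∧ f t = x) :
    ∃ t₀, τ ≤ t₀ ∧ t₀ ≤ T ∧ f t₀ ∈ S ∧ ∀ x ∈ S, x ≠ f t₀ → ∃ t, t₀ ≤ t ∧ t ≤ T ∧ f t = x := by
  classical
  have hex : ∃ t, τ ≤ t ∧ t ≤ T ∧ f t ∈ S := by
    obtain ⟨x, hx⟩ := hS
    obtain ⟨t, h1, h2, h3⟩ := h x hx
    exact ⟨t, h1, h2, h3 ▸ hx⟩
  obtain ⟨h1, h2, h3⟩ := Nat.find_spec hex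
  refine ⟨Nat.find hex, h1, h2, h3, fun x hx _ => ?_⟩
  obtain ⟨t, h4, h5, h6⟩ := h x hx
  exact ⟨t, Nat.find_min' hex ⟨h4, h5, h6 ▸ hx⟩, h5, h6⟩

/-- A walk that starts at `c` and visits all of `S` takes at least as long as some tour. -/
theorem Net.exists_tour (hn : Net av n p H) {c : ℕ} (hc : c < n) {L : Set ℕ} (hL : Sep av c L)
    (S : Finset ℕ) : (∀ x ∈ S, x ∈ L ∧ x < n) → ∀ {t T : ℕ} {f : ℕ → ℕ}, TW av t T f → t ≤ T →
      f t = c → (∀ x ∈ S, ∃ t', t ≤ t' ∧ t' ≤ T ∧ f t' = x) →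
      ∃ l : List ℕ, l.Nodup ∧ l.toFinset = S ∧ tour av c l t ≤ T := by
  induction S using Finset.strongInduction with
  | H S ih =>
  intro hS t T f hf htT hft hvis
  rcases S.eq_empty_or_nonempty with rfl | hne
  · exact ⟨[], by simp, by simp, htT⟩
  obtain ⟨t₀, h1, h2, h3, h4⟩ := exists_first hne hvis
  set w := f t₀ with hw
  have hwn := (hS w h3).2
  have ha : arr av c w t ≤ t₀ := arr_le (hft ▸ hf.rch_of_le le_rfl h1 h2)
  rcases (S.erase w).eq_empty_or_nonempty with he | ⟨x, hx⟩
  · refine ⟨[w], by simp, ?_, ha.trans h2⟩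
    rw [← Finset.insert_erase h3, he]
    simp
  · obtain ⟨hxw, hxS⟩ := Finset.mem_erase.1 hx
    -- The walk returns to `c` before it visits a second vertex of `S`.
    obtain ⟨t₁, k1, k2, k3, k4⟩ := exists_first (S := S.erase w) ⟨x, hx⟩ (τ := t₀) (T := T) (f := f)
      fun y hy => h4 y (Finset.mem_of_mem_erase hy) (Finset.ne_of_mem_erase hy)
    obtain ⟨hne1, hS1⟩ := Finset.mem_erase.1 k3
    obtain ⟨t₂, l1, l2, l3⟩ := hL t₀ t₁ f (hf.mono h1 k2) k1 (hS w h3).1 (hS _ hS1).1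
      (fun h => hne1 h.symm)
    obtain ⟨l, m1, m2, m3⟩ := ih (S.erase w) (Finset.erase_ssubset h3)
      (fun y hy => hS y (Finset.mem_of_mem_erase hy)) (hf.mono (h1.trans l1) le_rfl)
      (l2.trans k2) l3 (fun y hy => by
        by_cases hy1 : y = f t₁
        · exact ⟨t₁, l2, k2, hy1.symm⟩
        · obtain ⟨t', q1, q2, q3⟩ := k4 y hy hy1
          exact ⟨t', l2.trans q1, q2, q3⟩)
    have hwl : w ∉ l := by
      rw [← List.mem_toFinset, m2]
      simp
    refine ⟨w :: l, List.nodup_cons.2 ⟨hwl, m1⟩, ?_, ?_⟩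
    · rw [List.toFinset_cons, m2, Finset.insert_erase h3]
    · have hln : ∀ y ∈ l, y < n := fun y hy => by
        rw [← List.mem_toFinset, m2] at hy
        exact (hS y (Finset.mem_of_mem_erase hy)).2
      cases l with
      | nil =>
        rw [List.toFinset_nil] at m2
        rw [← m2] at hx
        simp at hx
      | cons w' l =>
        refine (hn.tour_mono hc hln ?_).trans m3
        refine (hn.arr_mono hwn hc ha).trans (arr_le ?_)
        have := hf.rch_of_le h1 l1 (l2.trans k2)
        rwa [l3] at this

/-- Some tour of the vertices in `S` that starts at `c` at time `t` ends by time `T`. -/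
def HasTour (av : ℕ → ℕ → ℕ → Prop) (c : ℕ) (S : Finset ℕ) (t T : ℕ) : Prop :=
  ∃ l : List ℕ, l.Nodup ∧ l.toFinset = S ∧ tour av c l t ≤ T

/-- Reduction of the covering problem to tours, for a set `U` of targets that consists of leaves
and possibly the center: the walk passes through the center before it visits a leaf, or after the
first leaf, or not at all. -/
theorem Net.cov_iff (hn : Net av n p H) {c : ℕ} (hc : c < n) {L : Set ℕ} (hL : Sep av c L)
    {S : Finset ℕ} (hS : ∀ x ∈ S, x ∈ L ∧ x < n) {U : Set ℕ}
    (hU : ∀ x, x ∈ S ↔ x ∈ U ∧ x ≠ c) {u τ T : ℕ} (hu : u < n) :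
    Cov av u τ U T ↔ HasTour av c S (arr av u c τ) T ∨
      (∃ w ∈ S, HasTour av c (S.erase w) (arr av w c (arr av u w τ)) T) ∨
      (c ∉ U ∧ ∃ w ∈ S, S = {w} ∧ arr av u w τ ≤ T) ∨ (U = ∅ ∧ τ ≤ T) := by
  constructor
  · rintro ⟨hτ, f, hf, hfu, hvis⟩
    rcases S.eq_empty_or_nonempty with rfl | hne
    · by_cases hcU : c ∈ U
      · obtain ⟨t, h1, h2, h3⟩ := hvis c hcU
        refine Or.inl ⟨[], by simp, by simp, (arr_le ?_).trans h2⟩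
        have := hf.rch_of_le le_rfl h1 h2
        rwa [hfu, h3] at this
      · refine Or.inr (Or.inr (Or.inr ⟨?_, hτ⟩))
        refine Set.eq_empty_of_forall_notMem fun x hx => ?_
        have := (hU x).2 ⟨hx, fun h => hcU (h ▸ hx)⟩
        simp at this
    obtain ⟨t₀, h1, h2, h3, h4⟩ := exists_first hne fun x hx => hvis x ((hU x).1 hx).1
    set w := f t₀ with hw
    have hwn := (hS w h3).2
    have ha : arr av u w τ ≤ t₀ := arr_le (hfu ▸ hf.rch_of_le le_rfl h1 h2)
    by_cases hbef : ∃ t, τ ≤ t ∧ t ≤ t₀ ∧ f t = c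
    · obtain ⟨t, k1, k2, k3⟩ := hbef
      obtain ⟨l, m1, m2, m3⟩ := hn.exists_tour hc hL S hS (hf.mono k1 le_rfl) (k2.trans h2) k3
        fun x hx => by
          by_cases hxw : x = w
          · exact ⟨t₀, k2, h2, hxw.symm⟩
          · obtain ⟨t', q1, q2, q3⟩ := h4 x hx hxw
            exact ⟨t', k2.trans q1, q2, q3⟩
      refine Or.inl ⟨l, m1, m2, (hn.tour_mono hc (fun y hy => ?_) (arr_le ?_)).trans m3⟩
      · exact (hS y (by rw [← m2]; simpa using hy)).2
      · have := hf.rch_of_le le_rfl k1 (k2.trans h2)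
        rwa [hfu, k3] at this
    -- Unless everything has been visited, the walk passes through `c` after the first leaf.
    by_cases haft : ∃ t, t₀ ≤ t ∧ t ≤ T ∧ f t = c ∧
        ∀ x ∈ S.erase w, ∃ t', t ≤ t' ∧ t' ≤ T ∧ f t' = x
    · obtain ⟨t, k1, k2, k3, k4⟩ := haft
      obtain ⟨l, m1, m2, m3⟩ := hn.exists_tour hc hL (S.erase w)
        (fun y hy => hS y (Finset.mem_of_mem_erase hy)) (hf.mono (h1.trans k1) le_rfl) k2 k3 k4
      refine Or.inr (Or.inl ⟨w, h3, l, m1, m2,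
        (hn.tour_mono hc (fun y hy => ?_) ?_).trans m3⟩)
      · rw [← List.mem_toFinset, m2] at hy
        exact (hS y (Finset.mem_of_mem_erase hy)).2
      · refine (hn.arr_mono hwn hc ha).trans (arr_le ?_)
        have := hf.rch_of_le h1 k1 k2
        rwa [k3] at this
    · rcases (S.erase w).eq_empty_or_nonempty with he | hne'
      · have hSw : S = {w} := by
          rw [← Finset.insert_erase h3, he]
          rfl
        refine Or.inr (Or.inr (Or.inl ⟨fun hcU => ?_, w, h3, hSw, ha.trans h2⟩))
        obtain ⟨t, k1, k2, k3⟩ := hvis c hcU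
        rcases le_total t t₀ with h | h
        · exact hbef ⟨t, k1, h, k3⟩
        · exact haft ⟨t, h, k2, k3, by simp [he]⟩
      · obtain ⟨t₁, k1, k2, k3, k4⟩ := exists_first hne' (τ := t₀) (T := T) (f := f)
          fun y hy => h4 y (Finset.mem_of_mem_erase hy) (Finset.ne_of_mem_erase hy)
        obtain ⟨hne1, hS1⟩ := Finset.mem_erase.1 k3
        obtain ⟨t₂, l1, l2, l3⟩ := hL t₀ t₁ f (hf.mono h1 k2) k1 (hS w h3).1 (hS _ hS1).1
          (fun h => hne1 h.symm)
        refine absurd ⟨t₂, l1, l2.trans k2, l3, fun y hy => ?_⟩ haft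
        by_cases hy1 : y = f t₁
        · exact ⟨t₁, l2, k2, hy1.symm⟩
        · obtain ⟨t', q1, q2, q3⟩ := k4 y hy hy1
          exact ⟨t', l2.trans q1, q2, q3⟩
  · have hlS : ∀ {l : List ℕ} {S' : Finset ℕ}, l.toFinset = S' → S' ⊆ S → ∀ y ∈ l, y < n := by
      intro l S' h1 h2 y hy
      exact (hS y (h2 (by rw [← h1]; simpa using hy))).2
    rintro (⟨l, m1, m2, m3⟩ | ⟨w, hw, l, m1, m2, m3⟩ | ⟨hcU, w, hw, hSw, h⟩ | ⟨rfl, h⟩)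
    · refine (((hn.rch_arr τ hu hc).cov (hn.cov_tour hc (hlS m2 subset_rfl) _)).subset
        fun x hx => ?_).mono m3
      by_cases hxc : x = c
      · simp [hxc]
      · have := (hU x).2 ⟨hx, hxc⟩
        rw [← m2] at this
        simp at this
        simp [this]
    · have hwn := (hS w hw).2
      refine (((hn.rch_arr τ hu hwn).cov ((hn.rch_arr _ hwn hc).cov (hn.cov_tour hc
        (hlS m2 (Finset.erase_subset _ _)) _))).subset fun x hx => ?_).mono m3
      by_cases hxc : x = c
      · simp [hxc]
      by_cases hxw : x = w
      · simp [hxw]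
      · have := Finset.mem_erase.2 ⟨hxw, (hU x).2 ⟨hx, hxc⟩⟩
        rw [← m2] at this
        simp at this
        simp [this]
    · refine (((hn.rch_arr τ hu (hS w hw).2).cov (cov_empty le_rfl)).subset
        fun x hx => ?_).mono h
      have := (hU x).2 ⟨hx, fun h => hcU (h ▸ hx)⟩
      rw [hSw] at this
      simp at this
      simp [this]
    · exact cov_empty h

/-- All vertices can be visited within `n * H` steps. -/
theorem Net.cov_all (hn : Net av n p H) {s : ℕ} (hs : s < n) {U : Set ℕ} (hU : ∀ x ∈ U, x < n) :
    Cov av s 0 U (n * H) := by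
  have key : ∀ k ≤ n, ∀ u < n, ∀ τ, Cov av u τ {x | n - k ≤ x ∧ x < n} (τ + k * H) := by
    intro k
    induction k with
    | zero =>
      intro _ u _ τ
      exact (cov_empty (by simp)).subset fun x hx => by
        simp only [Set.mem_ofPred_eq] at hx; omega
    | succ k ih =>
      intro hk u hu τ
      have h := ih (by omega) (n - (k + 1)) (by omega) (τ + H)
      refine (((hn.conn τ u _ hu (by omega)).cov h).subset fun x hx => ?_).mono ?_
      · simp only [Set.mem_ofPred_eq, Set.mem_insert_iff] at hx ⊢
        omega
      · rw [Nat.succ_mul]; omega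
  have := key n le_rfl s hs 0
  rw [Nat.sub_self, zero_add] at this
  exact this.subset fun x hx => ⟨Nat.zero_le _, hU x hx⟩

end DMVP

namespace DMVP

/-! ### Counting residues instead of ordering leaves -/

/-- The sum of the powers `B ^ y` for `y` in `l`, split at the place `x`: the digit there is the
multiplicity of `x` in `l`, unless that is too large or the lower places produce a carry. -/
theorem exists_sum_pow_eq (B x : ℕ) (l : List ℕ) : ∃ b, (l.map (B ^ ·)).sum =
    ((l.filter (· < x)).map (B ^ ·)).sum + l.count x * B ^ x + B ^ (x + 1) * b := by
  induction l with
  | nil => exact ⟨0, by simp⟩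
  | cons y l ih =>
    obtain ⟨b, hb⟩ := ih
    rcases lt_trichotomy y x with h | rfl | h
    · refine ⟨b, ?_⟩
      simp only [List.map_cons, List.sum_cons, hb, List.filter_cons, h, decide_true, if_true,
        List.count_cons_of_ne h.ne]
      ring
    · refine ⟨b, ?_⟩
      simp only [List.map_cons, List.sum_cons, hb, List.filter_cons, lt_irrefl, decide_false,
        List.count_cons_self]
      simp
      ring
    · obtain ⟨k, rfl⟩ := Nat.exists_eq_add_of_lt h
      refine ⟨b + B ^ k, ?_⟩
      simp only [List.map_cons, List.sum_cons, hb, List.filter_cons, not_lt.2 h.le, decide_false,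
        List.count_cons_of_ne h.ne']
      simp
      ring

/-- Fewer than `B` powers of `B` with exponents below `q` add up to less than `B ^ q`. -/
theorem sum_pow_lt {B q : ℕ} {l : List ℕ} (hl : ∀ x ∈ l, x < q) (hB : l.length < B) :
    (l.map (B ^ ·)).sum < B ^ q := by
  cases q with
  | zero =>
    rw [List.eq_nil_iff_forall_not_mem.2 fun x hx => Nat.not_lt_zero _ (hl x hx)]
    simp
  | succ q =>
    have h := List.sum_le_card_nsmul (l.map (B ^ ·)) (B ^ q) (by
      simp only [List.mem_map]
      rintro _ ⟨x, hx, rfl⟩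
      exact Nat.pow_le_pow_right (by omega) (Nat.lt_succ_iff.1 (hl x hx)))
    rw [List.length_map, smul_eq_mul] at h
    refine h.trans_lt ?_
    rw [pow_succ, mul_comm]
    exact Nat.mul_lt_mul_of_pos_left hB (Nat.pow_pos (by omega))

/-- Short lists with the same sum of powers are permutations of each other. -/
theorem perm_of_sum_pow_eq {B : ℕ} {l l' : List ℕ} (hl : l.length < B) (hl' : l'.length < B)
    (h : (l.map (B ^ ·)).sum = (l'.map (B ^ ·)).sum) : l.Perm l' := by
  rw [List.perm_iff_count]
  intro x
  obtain ⟨b, hb⟩ := exists_sum_pow_eq B x l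
  obtain ⟨b', hb'⟩ := exists_sum_pow_eq B x l'
  have low : ∀ m : List ℕ, m.length < B →
      ((m.filter (· < x)).map (B ^ ·)).sum < B ^ x := fun m hm =>
    sum_pow_lt (by simp) ((List.length_filter_le _ _).trans_lt hm)
  have digit : ∀ a k b : ℕ, a < B ^ x → k < B →
      (a + k * B ^ x + B ^ (x + 1) * b) / B ^ x % B = k := by
    intro a k b ha hk
    rw [show a + k * B ^ x + B ^ (x + 1) * b = a + B ^ x * (k + B * b) by ring,
      Nat.add_mul_div_left _ _ (by omega), Nat.div_eq_of_lt ha, zero_add,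
      Nat.add_mul_mod_self_left, Nat.mod_eq_of_lt hk]
  have h1 := digit _ _ b (low l hl) (List.count_le_length.trans_lt hl : l.count x < B)
  have h2 := digit _ _ b' (low l' hl') (List.count_le_length.trans_lt hl' : l'.count x < B)
  rw [← hb] at h1
  rw [← hb', ← h] at h2
  exact h1.symm.trans h2

/-- A permutation of the images of a list comes from a permutation of the list. -/
theorem exists_perm_map_eq {α β : Type*} {g : α → β} {as : List β} {js : List α}
    (h : as.Perm (js.map g)) : ∃ l : List α, l.Perm js ∧ l.map g = as := by
  have h2 : List.Forall₂ (fun b a => b = g a) (js.map g) js := by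
    rw [List.forall₂_map_left_iff]
    exact List.forall₂_same.2 fun _ _ => rfl
  obtain ⟨l, h3, h4⟩ := List.perm_comp_forall₂ h h2
  refine ⟨l, h4, ?_⟩
  clear h h2 h4
  induction h3 with
  | nil => rfl
  | cons h _ ih => simp [h, ih]

variable (av : ℕ → ℕ → ℕ → Prop) (c p B : ℕ)

/-- A leg can be used in `2 * p` modes. In the mode `μ < p` it is entered at a time that is `μ`
modulo `p`, and left again; in the mode `p + r` it is entered at a time that is `r` modulo `p`, and
the tour ends at the leaf. -/
def src (μ : ℕ) : ℕ := if μ < p then μ else μ - p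

/-- The time spent in the leg of the leaf `j` in the mode `μ`. -/
noncomputable def legTime (j μ : ℕ) : ℕ :=
  if μ < p then dl av μ c j + dl av (μ + dl av μ c j) j c else dl av (μ - p) c j

/-- The residue of the time at which the leg is left, or `p` if the tour ends in it. -/
noncomputable def dst (j μ : ℕ) : ℕ := if μ < p then (μ + legTime av c p j μ) % p else p

/-- The weight of a passage from the residue `r` to the residue `r'`. Sums of at most `B - 1` such
weights determine the multiset of passages. -/
def passage (r r' : ℕ) : ℕ := B ^ (r * (p + 1) + r')

/-- The weight of the leg of `j` in the mode `μ`: the passage in the lower digits, the time spent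
in the higher ones. -/
noncomputable def weight (j μ : ℕ) : ℕ :=
  passage p B (src p μ) (dst av c p j μ) + B ^ (p * (p + 1)) * legTime av c p j μ

/-- The legs of `js` have modes with total weight `C`. -/
def Assignable (js : List ℕ) (C : ℕ) : Prop :=
  ∃ φ : ℕ → ℕ, (∀ j ∈ js, φ j < 2 * p) ∧ (js.map fun j => weight av c p B j (φ j)).sum = C

/-- Walks from a residue to the final state `p`, as lists of passages. -/
inductive Wlk : ℕ → List (ℕ × ℕ) → Prop
  | nil : Wlk p []
  | cons {r r' : ℕ} {as : List (ℕ × ℕ)} : r < p → r' ≤ p → Wlk r' as → Wlk r ((r, r') :: as)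

theorem Wlk.eq_nil_of_final {p : ℕ} {as : List (ℕ × ℕ)} (h : Wlk p p as) : as = [] := by
  generalize hq : p = q at h
  cases h with
  | nil => rfl
  | cons h => omega

/-- There is a walk of length `ℓ` from `r` to the final state whose passages have total weight
`C`. -/
def Walkable (ℓ C r : ℕ) : Prop :=
  ∃ as, Wlk p r as ∧ as.length = ℓ ∧ (as.map fun a => passage p B a.1 a.2).sum = C

variable {av c p B} {n H : ℕ}

theorem assignable_nil {C : ℕ} : Assignable av c p B [] C ↔ C = 0 := by
  simp [Assignable, eq_comm]

/-- The recursion behind the table of total weights: the last leaf has some mode. -/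
theorem assignable_append {js : List ℕ} {j C : ℕ} (hj : j ∉ js) :
    Assignable av c p B (js ++ [j]) C ↔ ∃ μ < 2 * p, weight av c p B j μ ≤ C ∧
      Assignable av c p B js (C - weight av c p B j μ) := by
  constructor
  · rintro ⟨φ, h1, h2⟩
    simp only [List.map_append, List.sum_append, List.map_cons, List.map_nil, List.sum_cons,
      List.sum_nil, add_zero] at h2
    exact ⟨φ j, h1 j (by simp), by omega, φ, fun i hi => h1 i (by simp [hi]), by omega⟩
  · rintro ⟨μ, hμ, hC, φ, h1, h2⟩
    refine ⟨Function.update φ j μ, fun i hi => ?_, ?_⟩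
    · rw [Function.update_apply]
      split_ifs with h
      · exact hμ
      · exact h1 i (by simpa [h] using hi)
    · have : js.map (fun i => weight av c p B i (Function.update φ j μ i))
          = js.map fun i => weight av c p B i (φ i) :=
        List.map_congr_left fun i hi => by
          rw [Function.update_of_ne fun h : i = j => hj (h ▸ hi)]
      simp only [List.map_append, List.sum_append, this, List.map_cons, List.map_nil,
        List.sum_cons, List.sum_nil, add_zero, Function.update_self]
      omega

theorem walkable_zero {C r : ℕ} : Walkable p B 0 C r ↔ r = p ∧ C = 0 := by
  constructor
  · rintro ⟨as, h1, h2, h3⟩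
    obtain rfl := List.length_eq_zero_iff.1 h2
    cases h1
    exact ⟨rfl, by simpa using h3.symm⟩
  · rintro ⟨rfl, rfl⟩
    exact ⟨[], .nil, rfl, rfl⟩

/-- The recursion behind the table of walks: the first passage leads to some residue. -/
theorem walkable_succ {ℓ C r : ℕ} : Walkable p B (ℓ + 1) C r ↔ r < p ∧ ∃ r' < p + 1,
    passage p B r r' ≤ C ∧ Walkable p B ℓ (C - passage p B r r') r' := by
  constructor
  · rintro ⟨as, h1, h2, h3⟩
    cases h1 with
    | nil => simp at h2
    | @cons _ r' as h4 h5 h6 =>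
      simp only [List.map_cons, List.sum_cons, List.length_cons] at h2 h3
      exact ⟨h4, r', by omega, by omega, as, h6, by omega, by omega⟩
  · rintro ⟨h4, r', h5, h6, as, h1, h2, h3⟩
    refine ⟨(r, r') :: as, .cons h4 (by omega) h1, by simp [h2], ?_⟩
    simp only [List.map_cons, List.sum_cons]
    omega

/-- The passage of the leg of `j` in the mode `φ j`. -/
noncomputable def arc (av : ℕ → ℕ → ℕ → Prop) (c p : ℕ) (φ : ℕ → ℕ) (j : ℕ) : ℕ × ℕ :=
  (src p (φ j), dst av c p j (φ j))

/-- A trip from `c` to the leaf `j` and back, in the mode given by the starting time. -/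
theorem Net.legTime_mod (hn : Net av n p H) (hp : 0 < p) (j t : ℕ) :
    t + legTime av c p j (t % p) = arr av j c (arr av c j t) := by
  have h : dl av (t % p + dl av t c j) j c = dl av (t + dl av t c j) j c := by
    rw [← hn.dl_mod, Nat.mod_add_mod, hn.dl_mod]
  rw [legTime, if_pos (Nat.mod_lt _ hp), hn.dl_mod, h, arr, arr, add_assoc]

/-- A final trip from `c` to the leaf `j`, in the mode given by the starting time. -/
theorem Net.legTime_add (hn : Net av n p H) (j t : ℕ) :
    t + legTime av c p j (p + t % p) = arr av c j t := by
  rw [legTime, if_neg (by omega), Nat.add_sub_cancel_left, hn.dl_mod, arr]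

theorem Net.dst_mod (hn : Net av n p H) (hp : 0 < p) (j t : ℕ) :
    dst av c p j (t % p) = arr av j c (arr av c j t) % p := by
  rw [dst, if_pos (Nat.mod_lt _ hp), Nat.mod_add_mod, hn.legTime_mod hp]

/-- Every tour is a walk through the residues. -/
theorem Net.exists_modes (hn : Net av n p H) (hp : 0 < p) {l : List ℕ} (hl : l.Nodup)
    (hne : l ≠ []) (t : ℕ) : ∃ φ : ℕ → ℕ, (∀ j, φ j < 2 * p) ∧
      Wlk p (t % p) (l.map (arc av c p φ)) ∧
      t + (l.map fun j => legTime av c p j (φ j)).sum = tour av c l t := by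
  induction l generalizing t with
  | nil => exact absurd rfl hne
  | cons w l ih =>
    obtain ⟨hw, hl⟩ := List.nodup_cons.1 hl
    have hmod := Nat.mod_lt t hp
    cases l with
    | nil =>
      refine ⟨fun _ => p + t % p, fun _ => by simp only; omega, ?_, ?_⟩
      · have h1 : arc av c p (fun _ => p + t % p) w = (t % p, p) := by
          simp [arc, src, dst]
        rw [List.map_cons, List.map_nil, h1]
        exact .cons hmod le_rfl .nil
      · simp [hn.legTime_add, tour]
    | cons w' l =>
      obtain ⟨φ, h1, h2, h3⟩ := ih hl (by simp) (arr av w c (arr av c w t))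
      have hφ : ∀ j ∈ w' :: l, Function.update φ w (t % p) j = φ j := fun j hj =>
        Function.update_of_ne (fun h : j = w => hw (h ▸ hj)) _ _
      refine ⟨Function.update φ w (t % p), fun j => ?_, ?_, ?_⟩
      · rw [Function.update_apply]
        split_ifs
        · omega
        · exact h1 j
      · rw [List.map_cons, List.map_congr_left (g := arc av c p φ) fun j hj => by
          simp only [arc, hφ j hj]]
        have : arc av c p (Function.update φ w (t % p)) w
            = (t % p, arr av w c (arr av c w t) % p) := by
          simp [arc, src, hmod, hn.dst_mod hp]
        rw [this]
        exact .cons hmod (Nat.mod_lt _ hp).le h2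
      · rw [List.map_cons, List.sum_cons,
          List.map_congr_left (g := fun j => legTime av c p j (φ j)) fun j hj => by
          simp only [hφ j hj], Function.update_self, ← add_assoc, hn.legTime_mod hp, h3]
        rfl

/-- Conversely, a walk through the residues that uses every leg once is a tour. -/
theorem Net.tour_eq (hn : Net av n p H) (hp : 0 < p) {φ : ℕ → ℕ} {l : List ℕ} {t : ℕ}
    (hφ : ∀ j ∈ l, φ j < 2 * p) (h : Wlk p (t % p) (l.map (arc av c p φ))) :
    tour av c l t = t + (l.map fun j => legTime av c p j (φ j)).sum := by
  induction l generalizing t with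
  | nil => rfl
  | cons w l ih =>
    have hmod := Nat.mod_lt t hp
    have hφw := hφ w (by simp)
    have hφl : ∀ j ∈ l, φ j < 2 * p := fun j hj => hφ j (by simp [hj])
    rw [List.map_cons] at h
    generalize hr : t % p = r at h
    generalize ha : arc av c p φ w = a at h
    generalize has : l.map (arc av c p φ) = as at h
    cases h with
    | @cons _ r' _ h1 h2 h3 =>
    subst hr has
    simp only [arc, Prod.mk.injEq] at ha
    obtain ⟨hs, hd⟩ := ha
    by_cases hμ : φ w < p
    · rw [src, if_pos hμ] at hs
      rw [hs, hn.dst_mod hp] at hd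
      subst hd
      have := ih hφl h3
      cases l with
      | nil =>
        generalize hq : arr av w c (arr av c w t) % p = q at h3
        have := Nat.mod_lt (arr av w c (arr av c w t)) hp
        cases h3
        omega
      | cons w' l =>
        rw [tour, this, List.map_cons (a := w), List.sum_cons, hs, ← add_assoc,
          hn.legTime_mod hp]
    · rw [src, if_neg hμ] at hs
      have hφw' : φ w = p + t % p := by omega
      rw [dst, if_neg hμ] at hd
      subst hd
      cases l with
      | nil => simp [tour, hφw', hn.legTime_add]
      | cons w' l =>
        exact absurd h3.eq_nil_of_final (by simp)

theorem dst_le (hp : 0 < p) (j μ : ℕ) : dst av c p j μ ≤ p := by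
  rw [dst]
  split_ifs
  · exact (Nat.mod_lt _ hp).le
  · exact le_rfl

theorem src_lt {μ : ℕ} (h : μ < 2 * p) : src p μ < p := by
  rw [src]
  split_ifs <;> omega

theorem passage_index_lt {r r' : ℕ} (hr : r < p) (hr' : r' ≤ p) :
    r * (p + 1) + r' < p * (p + 1) := by
  have : (r + 1) * (p + 1) ≤ p * (p + 1) := Nat.mul_le_mul_right _ hr
  rw [Nat.succ_mul] at this
  omega

theorem wlk_mem {r : ℕ} {as : List (ℕ × ℕ)} (h : Wlk p r as) : ∀ a ∈ as, a.1 < p ∧ a.2 ≤ p := by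
  induction h with
  | nil => simp
  | cons h1 h2 _ ih =>
    intro a ha
    rcases List.mem_cons.1 ha with rfl | ha
    · exact ⟨h1, h2⟩
    · exact ih a ha

/-- The existence of a tour in terms of weights, with no reference to the order of the legs: legs
whose passages are those of a walk can be permuted so that they follow the walk. -/
theorem Net.hasTour_iff (hn : Net av n p H) (hp : 0 < p) {js : List ℕ} (hjs : js.Nodup)
    (hne : js ≠ []) (hB : js.length < B) {t T : ℕ} :
    HasTour av c js.toFinset t T ↔ ∃ C < B ^ (p * (p + 1)), ∃ d, t + d ≤ T ∧
      Assignable av c p B js (C + B ^ (p * (p + 1)) * d) ∧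
      Walkable p B js.length C (t % p) := by
  have hsum : ∀ (φ : ℕ → ℕ) (l : List ℕ), (l.map fun j => weight av c p B j (φ j)).sum
      = ((l.map (arc av c p φ)).map fun a => passage p B a.1 a.2).sum
        + B ^ (p * (p + 1)) * (l.map fun j => legTime av c p j (φ j)).sum := by
    intro φ l
    induction l with
    | nil => simp
    | cons w l ih =>
      rw [List.map_cons, List.sum_cons, ih]
      simp only [List.map_cons, List.sum_cons, weight, arc]
      ring
  let idx : ℕ × ℕ → ℕ := fun a => a.1 * (p + 1) + a.2
  have hidx : ∀ as : List (ℕ × ℕ), (as.map fun a => passage p B a.1 a.2)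
      = (as.map idx).map (B ^ ·) := by
    intro as
    simp [passage, idx, Function.comp_def]
  have harc : ∀ (φ : ℕ → ℕ) (l : List ℕ), (∀ j ∈ l, φ j < 2 * p) →
      ∀ a ∈ l.map (arc av c p φ), a.1 < p ∧ a.2 ≤ p := by
    intro φ l h a ha
    obtain ⟨j, hj, rfl⟩ := List.mem_map.1 ha
    exact ⟨src_lt (h j hj), dst_le hp _ _⟩
  have hlt : ∀ as : List (ℕ × ℕ), (∀ a ∈ as, a.1 < p ∧ a.2 ≤ p) → as.length < B →
      (as.map fun a => passage p B a.1 a.2).sum < B ^ (p * (p + 1)) := by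
    intro as h h'
    rw [hidx]
    refine sum_pow_lt (fun x hx => ?_) (by simpa using h')
    obtain ⟨a, ha, rfl⟩ := List.mem_map.1 hx
    exact passage_index_lt (h a ha).1 (h a ha).2
  constructor
  · rintro ⟨l, h1, h2, h3⟩
    have hperm : l.Perm js := List.perm_of_nodup_nodup_toFinset_eq h1 hjs h2
    have hlne : l ≠ [] := by
      rintro rfl
      exact hne hperm.symm.eq_nil
    obtain ⟨φ, k1, k2, k3⟩ := hn.exists_modes (c := c) hp h1 hlne t
    refine ⟨_, hlt _ (harc φ l fun j _ => k1 j) (by simpa [hperm.length_eq] using hB), _,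
      k3.trans_le h3, ⟨φ, fun j _ => k1 j, ?_⟩, _, k2, by simp [hperm.length_eq], rfl⟩
    rw [← hsum]
    exact (hperm.map _).sum_eq.symm
  · rintro ⟨C, hC, d, hd, ⟨φ, h1, h2⟩, as, h3, h4, h5⟩
    have hlow := hlt _ (harc φ js h1) (by simpa using hB)
    rw [hsum] at h2
    have hK : 0 < B ^ (p * (p + 1)) := by omega
    have hCe := congrArg (· % B ^ (p * (p + 1))) h2
    have hde := congrArg (· / B ^ (p * (p + 1))) h2
    simp only [Nat.add_mul_mod_self_left, Nat.mod_eq_of_lt hlow, Nat.mod_eq_of_lt hC] at hCe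
    simp only [Nat.add_mul_div_left _ _ hK, Nat.div_eq_of_lt hlow, Nat.div_eq_of_lt hC,
      zero_add] at hde
    have hp1 : (as.map idx).Perm ((js.map (arc av c p φ)).map idx) := by
      refine perm_of_sum_pow_eq (B := B) (by simpa [h4] using hB) (by simpa using hB) ?_
      rw [← hidx, ← hidx, h5, hCe]
    rw [List.map_map] at hp1
    obtain ⟨l, hl, hle⟩ := exists_perm_map_eq hp1
    have hlφ : ∀ j ∈ l, φ j < 2 * p := fun j hj => h1 j (hl.mem_iff.1 hj)
    have hdec : ∀ bs : List (ℕ × ℕ), (∀ a ∈ bs, a.1 < p ∧ a.2 ≤ p) →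
        (bs.map idx).map (fun x => (x / (p + 1), x % (p + 1))) = bs := by
      intro bs h
      rw [List.map_map]
      conv_rhs => rw [← List.map_id bs]
      refine List.map_congr_left fun a ha => ?_
      have h2 : a.2 < p + 1 := Nat.lt_succ_of_le (h a ha).2
      simp only [idx, Function.comp, id]
      rw [mul_comm, Nat.mul_add_div (by omega), Nat.div_eq_of_lt h2, Nat.mul_add_mod,
        Nat.mod_eq_of_lt h2, add_zero]
    have has : l.map (arc av c p φ) = as := by
      rw [← hdec _ (harc φ l hlφ), ← hdec _ (wlk_mem h3), ← hle, List.map_map, List.map_map]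
      simp
    refine ⟨l, hl.nodup_iff.2 hjs, List.toFinset_eq_of_perm _ _ hl, ?_⟩
    rw [hn.tour_eq hp hlφ (by rw [has]; exact h3), (hl.map _).sum_eq, hde]
    exact hd

end DMVP

namespace DMVP

/-! ### Walks in a spider -/

section Spider

variable {V : Type} [Finite V] {K : SimpleGraph V}

theorem mem_pair_of_ncard_le_two {v x y z : V} (h : (K.neighborSet v).ncard ≤ 2)
    (hx : K.Adj v x) (hy : K.Adj v y) (hxy : x ≠ y) (hz : K.Adj v z) : z = x ∨ z = y := by
  have hsub : ({x, y} : Set V) ⊆ K.neighborSet v := by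
    rintro _ (rfl | rfl)
    · exact hx
    · exact hy
  have := Set.eq_of_subset_of_ncard_le hsub (by rw [Set.ncard_pair hxy]; exact h)
    (Set.toFinite _)
  have hz' : z ∈ K.neighborSet v := hz
  rw [← this] at hz'
  simpa using hz'

theorem eq_of_ncard_le_one {v x z : V} (h : (K.neighborSet v).ncard ≤ 1) (hx : K.Adj v x)
    (hz : K.Adj v z) : z = x :=
  (Set.ncard_le_one (Set.toFinite _)).1 h z hz x hx

/-- A walk between two leaves of a spider passes through the center: otherwise there is a path that
contains all neighbors of its vertices, and is therefore the whole tree. -/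
theorem center_mem_support (hK : K.IsTree) {c w w' : V}
    (hc : ∀ v, v ≠ c → (K.neighborSet v).ncard ≤ 2) (hw : (K.neighborSet w).ncard ≤ 1)
    (hw' : (K.neighborSet w').ncard ≤ 1) (hne : w ≠ w') (q : K.Walk w w') : c ∈ q.support := by
  classical
  by_contra hcq
  set r := q.bypass with hr
  have hrp : r.IsPath := q.bypass_isPath
  have hcr : c ∉ r.support := fun h => hcq (q.support_bypass_subset_support h)
  have hpos : 0 < r.length := by
    rw [Nat.pos_iff_ne_zero]
    exact fun h => hne (SimpleGraph.Walk.eq_of_length_eq_zero h)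
  have hclosed : ∀ v ∈ r.support, ∀ z, K.Adj v z → z ∈ r.support := by
    intro v hv z hz
    obtain ⟨i, rfl, hi⟩ := SimpleGraph.Walk.mem_support_iff_exists_getVert.1 hv
    rcases Nat.eq_zero_or_pos i with rfl | hi0
    · have h1 := r.adj_getVert_succ hpos
      rw [r.getVert_zero] at h1 hz
      rw [eq_of_ncard_le_one hw h1 hz]
      exact r.getVert_mem_support _
    rcases hi.eq_or_lt with rfl | hlt
    · have h1 := r.adj_getVert_succ (i := r.length - 1) (by omega)
      rw [Nat.sub_add_cancel hpos] at h1
      rw [r.getVert_length] at h1 hz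
      rw [eq_of_ncard_le_one hw' h1.symm hz]
      exact r.getVert_mem_support _
    · have h1 := r.adj_getVert_succ (i := i - 1) (by omega)
      rw [Nat.sub_add_cancel hi0] at h1
      have h2 := r.adj_getVert_succ hlt
      have h3 : r.getVert (i - 1) ≠ r.getVert (i + 1) := fun h => by
        have := hrp.getVert_injOn (by simp; omega) (by simp; omega) h
        omega
      rcases mem_pair_of_ncard_le_two (hc _ fun h => hcr (h ▸ hv)) h1.symm h2 h3 hz with h | h
      · rw [h]; exact r.getVert_mem_support _
      · rw [h]; exact r.getVert_mem_support _
  have hall : ∀ {a b : V} (s : K.Walk a b), a ∈ r.support → b ∈ r.support := by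
    intro a b s
    induction s with
    | nil => exact id
    | cons h _ ih => exact fun ha => ih (hclosed _ ha _ h)
  obtain ⟨s⟩ := hK.1.preconnected w c
  exact hcr (hall s r.start_mem_support)

/-- Every vertex `v` of a tree lies between a given vertex `c` and some leaf, or is `c` itself. -/
theorem exists_leaf_beyond (hK : K.IsTree) (c v : V) : ∃ x,
    (x = c ∨ (K.neighborSet x).ncard ≤ 1) ∧ ∀ q : K.Walk c x, v ∈ q.support := by
  classical
  by_cases hvc : v = c
  · exact ⟨c, Or.inl rfl, fun q => hvc ▸ q.start_mem_support⟩
  -- A longest path from `c` through `v` ends in a leaf.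
  let A : Set ℕ := {m | ∃ (x : V) (q : K.Walk c x), q.IsPath ∧ v ∈ q.support ∧ q.length = m}
  have hne : A.Nonempty := by
    obtain ⟨q⟩ := hK.1.preconnected c v
    exact ⟨_, v, q.bypass, q.bypass_isPath, SimpleGraph.Walk.end_mem_support _, rfl⟩
  have hfin : ∀ m ∈ A, m ≤ Nat.card V := by
    have := Fintype.ofFinite V
    rintro m ⟨x, q, hq, _, rfl⟩
    rw [Nat.card_eq_fintype_card]
    exact hq.length_lt.le
  obtain ⟨x, q, hq, hvq, hlen⟩ := Nat.sSup_mem hne ⟨_, hfin⟩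
  have hmax : ∀ m ∈ A, m ≤ q.length := fun m hm => hlen ▸ le_csSup ⟨_, hfin⟩ hm
  have huniq : ∀ q' : K.Walk c x, v ∈ q'.support := fun q' => by
    have : q'.bypass = q := by
      have := (hK.2.subsingleton_path _ _).elim ⟨q'.bypass, q'.bypass_isPath⟩ ⟨q, hq⟩
      exact congrArg Subtype.val this
    exact q'.support_bypass_subset_support (this ▸ hvq)
  refine ⟨x, Or.inr ?_, huniq⟩
  rw [Set.ncard_le_one (Set.toFinite _)]
  have hpen : ∀ y, K.Adj x y → y = q.penultimate := by
    intro y hy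
    by_cases hyq : y ∈ q.support
    · have h1 : (q.dropUntil y hyq) = SimpleGraph.Walk.cons hy.symm .nil := by
        have := (hK.2.subsingleton_path _ _).elim ⟨q.dropUntil y hyq, hq.dropUntil hyq⟩
          ⟨SimpleGraph.Walk.cons hy.symm .nil, by simp [hy.ne']⟩
        exact congrArg Subtype.val this
      have h2 := q.take_spec hyq
      rw [h1] at h2
      rw [← h2, ← SimpleGraph.Walk.concat_eq_append, SimpleGraph.Walk.penultimate_concat]
    · have := hmax (q.length + 1) ⟨y, q.concat hy, hq.concat hyq hy, by simp [hvq], by simp⟩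
      omega
  intro a ha b hb
  rw [hpen a ha, hpen b hb]

end Spider

/-! ### From instances to nets -/

/-- Availability of edges for vertices that are numbers. -/
def natAvail {n : ℕ} (G : TVG (Fin n)) (t u w : ℕ) : Prop :=
  ∃ (hu : u < n) (hw : w < n), G.Avail t ⟨u, hu⟩ ⟨w, hw⟩

section Instance

variable {n p : ℕ} {G : TVG (Fin n)}

theorem natAvail_fin {t : ℕ} {u w : Fin n} : natAvail G t u w ↔ G.Avail t u w :=
  ⟨fun ⟨_, _, h⟩ => h, fun h => ⟨u.2, w.2, h⟩⟩

theorem TVG.Avail.symm {V : Type} {G : TVG V} {t : ℕ} {u w : V} (h : G.Avail t u w) :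
    G.Avail t w u :=
  ⟨h.1.symm, by rw [Sym2.eq_swap]; exact h.2⟩

theorem avail_add (hG : G.Periodic p) {t k : ℕ} {u w : Fin n} :
    G.Avail (t + k * p) u w ↔ G.Avail t u w := by
  unfold TVG.Avail
  refine and_congr_right fun h => ?_
  exact (hG.2 _ h t k).symm

/-- The positions of a timed walk form a walk in the underlying graph. -/
theorem exists_walk {τ T : ℕ} {f : ℕ → ℕ} (hf : TW (natAvail G) τ T f) (h : τ ≤ T)
    (h0 : f τ < n) : ∃ h1 : f T < n, ∃ q : G.graph.Walk ⟨f τ, h0⟩ ⟨f T, h1⟩,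
      ∀ v ∈ q.support, ∃ t, τ ≤ t ∧ t ≤ T ∧ f t = v := by
  induction T, h using Nat.le_induction with
  | base => exact ⟨h0, .nil, by simpa using ⟨τ, le_rfl, le_rfl, rfl⟩⟩
  | succ T hT ih =>
    obtain ⟨h1, q, hq⟩ := ih (hf.mono le_rfl (by omega))
    have hq' : ∀ v ∈ q.support, ∃ t, τ ≤ t ∧ t ≤ T + 1 ∧ f t = v := fun v hv => by
      obtain ⟨t, k1, k2, k3⟩ := hq v hv
      exact ⟨t, k1, by omega, k3⟩
    rcases hf T hT (by omega) with h | ⟨_, h2, h⟩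
    · have h2 : f (T + 1) < n := by rw [h]; exact h1
      exact ⟨h2, q.copy rfl (by simp [h]), by simpa using hq'⟩
    · refine ⟨h2, q.concat h.1, fun v hv => ?_⟩
      rw [SimpleGraph.Walk.support_concat] at hv
      rcases List.mem_append.1 hv with hv | hv
      · exact hq' v hv
      · rw [List.mem_singleton] at hv
        exact ⟨T + 1, by omega, le_rfl, by rw [hv]⟩

/-- A timed walk is a walk in every graph `K` that contains the available edges. -/
theorem rch_reachable {τ u T w : ℕ} (h : Rch (natAvail G) τ u T w) (hu : u < n)
    (K : SimpleGraph (Fin n)) (hK : ∀ t a b, G.Avail t a b → K.Adj a b) :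
    ∃ hw : w < n, K.Reachable ⟨u, hu⟩ ⟨w, hw⟩ := by
  induction h with
  | refl => exact ⟨hu, .refl _⟩
  | wait _ ih => exact ih
  | move _ hm ih =>
    obtain ⟨h1, h2⟩ := ih
    obtain ⟨_, h3, h4⟩ := hm
    exact ⟨h3, h2.trans (hK _ _ _ h4).reachable⟩

/-- If everything can be reached from `s` at all, then every edge of the tree is available at some
time, because it is a bridge. -/
theorem exists_avail (hG : G.graph.IsTree) {s : ℕ} (hs : s < n)
    (h : ∀ v < n, ∃ T, Rch (natAvail G) 0 s T v) {u w : Fin n} (hadj : G.graph.Adj u w) :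
    ∃ t, G.Avail t u w := by
  by_contra hno
  push Not at hno
  have hb := SimpleGraph.isAcyclic_iff_forall_adj_isBridge.1 hG.2 hadj
  rw [SimpleGraph.isBridge_iff] at hb
  have hK : ∀ t a b, G.Avail t a b → (G.graph \ SimpleGraph.fromEdgeSet {s(u, w)}).Adj a b := by
    intro t a b hab
    refine (SimpleGraph.sdiff_adj ..).2 ⟨hab.1, fun hd => ?_⟩
    rw [SimpleGraph.fromEdgeSet_adj, Set.mem_singleton_iff, Sym2.eq_iff] at hd
    rcases hd.1 with ⟨rfl, rfl⟩ | ⟨rfl, rfl⟩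
    · exact hno t hab
    · exact hno t hab.symm
  obtain ⟨T, h1⟩ := h u u.2
  obtain ⟨T', h2⟩ := h w w.2
  obtain ⟨_, h1⟩ := rch_reachable h1 hs _ hK
  obtain ⟨_, h2⟩ := rch_reachable h2 hs _ hK
  exact hb (h1.symm.trans h2)

/-- If every edge is available at some time, then from every vertex one gets to every other one
within `p * n` steps: one can follow a path and cross one edge in each period. -/
theorem net_of_avail (hp : 0 < p) (hG : G.Periodic p)
    (h : ∀ u w, G.graph.Adj u w → ∃ t, G.Avail t u w) : Net (natAvail G) n p (p * n) where
  lt := fun ⟨hu, hw, _⟩ => ⟨hu, hw⟩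
  per t u w := by
    have := fun a b => avail_add (t := t) (k := 1) (u := a) (w := b) hG
    simp only [one_mul] at this
    exact exists_congr fun _ => exists_congr fun _ => this _ _
  conn τ u w hu hw := by
    have hedge : ∀ (t : ℕ) (a b : Fin n), G.graph.Adj a b → Rch (natAvail G) t a (t + p) b := by
      intro t a b hab
      obtain ⟨t₀, h0⟩ := h a b hab
      have h1 : G.Avail (t₀ % p) a b := by
        rw [← avail_add hG (k := t₀ / p), Nat.mod_add_div']
        exact h0
      -- A time in the period that starts at `t` with the residue of `t₀`.
      obtain ⟨d, hd, hav⟩ : ∃ d < p, G.Avail (t + d) a b := by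
        have e1 := Nat.mod_lt t₀ hp
        have e2 := Nat.mod_lt t hp
        have e3 := Nat.mod_add_div' t p
        by_cases hle : t % p ≤ t₀ % p
        · refine ⟨t₀ % p - t % p, by omega, ?_⟩
          rw [show t + (t₀ % p - t % p) = t₀ % p + t / p * p by omega]
          exact (avail_add hG).2 h1
        · refine ⟨p + t₀ % p - t % p, by omega, ?_⟩
          rw [show t + (p + t₀ % p - t % p) = t₀ % p + (t / p + 1) * p by
            rw [Nat.succ_mul]; omega]
          exact (avail_add hG).2 h1
      exact ((Rch.stay _ (a : ℕ) (by omega : t ≤ t + d)).move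
        (natAvail_fin.2 hav)).mono (by omega)
    have hwalk : ∀ {a b : Fin n} (q : G.graph.Walk a b) (t : ℕ),
        Rch (natAvail G) t a (t + p * q.length) b := by
      intro a b q
      induction q with
      | nil => intro t; simpa using Rch.refl
      | cons hab _ ih =>
        intro t
        have := (hedge t _ _ hab).trans (ih (t + p))
        rw [SimpleGraph.Walk.length_cons, Nat.mul_succ]
        exact this.mono (by omega)
    classical
    obtain ⟨q⟩ := hG.1.preconnected ⟨u, hu⟩ ⟨w, hw⟩
    have hlen := (q.bypass_isPath).length_lt
    rw [Fintype.card_fin] at hlen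
    exact (hwalk q.bypass τ).mono (Nat.add_le_add_left (Nat.mul_le_mul_left _ hlen.le) _)

/-- The number of neighbors of a vertex. -/
noncomputable def degree (K : SimpleGraph (Fin n)) (x : Fin n) : ℕ := (K.neighborSet x).ncard

/-- Timed walks between different leaves of a spider pass through the center. -/
theorem sep_leaves (hK : G.graph.IsTree) {c : Fin n} (hc : ∀ v, v ≠ c → degree G.graph v ≤ 2) :
    Sep (natAvail G) c {x | ∃ h : x < n, degree G.graph ⟨x, h⟩ ≤ 1} := by
  rintro τ T f hf hT ⟨h1, h2⟩ ⟨h3, h4⟩ hne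
  obtain ⟨_, q, hq⟩ := exists_walk hf hT h1
  exact hq c (center_mem_support hK hc h2 h4 (fun h => hne (Fin.mk.inj_iff.1 h)) q)

/-- A walk that visits the center and all leaves visits everything. -/
theorem visits_all (hK : G.graph.IsTree) (c : Fin n) {T : ℕ} {f : ℕ → ℕ}
    (hf : TW (natAvail G) 0 T f) (hf0 : f 0 < n)
    (hvis : ∀ x : Fin n, x = c ∨ degree G.graph x ≤ 1 → ∃ t ≤ T, f t = x) (v : Fin n) :
    ∃ t ≤ T, f t = v := by
  obtain ⟨x, hx, hq⟩ := exists_leaf_beyond hK c v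
  obtain ⟨t₁, k1, k2⟩ := hvis c (Or.inl rfl)
  obtain ⟨t₂, l1, l2⟩ := hvis x hx
  have hlt : ∀ t ≤ T, f t < n := fun t ht =>
    (exists_walk (hf.mono le_rfl ht) (Nat.zero_le t) hf0).1
  rcases le_total t₁ t₂ with h | h
  · obtain ⟨_, q, hq'⟩ := exists_walk (hf.mono (Nat.zero_le _) l1) h (hlt _ k1)
    obtain ⟨t, m1, m2, m3⟩ := hq' v (by
      have := hq (q.copy (Fin.ext k2) (Fin.ext l2))
      simpa using this)
    exact ⟨t, m2.trans l1, m3⟩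
  · obtain ⟨_, q, hq'⟩ := exists_walk (hf.mono (Nat.zero_le _) k1) h (hlt _ l1)
    obtain ⟨t, m1, m2, m3⟩ := hq' v (by
      have := hq (q.reverse.copy (Fin.ext k2) (Fin.ext l2))
      simpa using this)
    exact ⟨t, m2.trans k1, m3⟩

end Instance

end DMVP

namespace DMVP

/-! ### Journeys and timed walks -/

section Journey

variable {n : ℕ} {G : TVG (Fin n)}

/-- The starting vertex is visited anyway. -/
theorem Cov.insert_self {av : ℕ → ℕ → ℕ → Prop} {u τ T : ℕ} {U : Set ℕ} (h : Cov av u τ U T) :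
    Cov av u τ (insert u U) T :=
  ((Rch.refl (av := av) (τ := τ) (u := u)).cov h).subset (by intro x; simp)

theorem IsJourney.le {V : Type} {G : TVG V} {u : V} {τ : ℕ} {J : List (V × ℕ)}
    (h : IsJourney G u τ J) : ∀ e ∈ J, τ ≤ e.2 := by
  induction J generalizing u τ with
  | nil => simp
  | cons a J ih =>
    obtain ⟨v, t⟩ := a
    obtain ⟨h1, h2, h3⟩ := h
    intro e he
    rcases List.mem_cons.1 he with rfl | he
    · exact h1
    · exact (h1.trans (Nat.le_succ t)).trans (ih h3 e he)

theorem IsJourney.lt_arrival {V : Type} {G : TVG V} {u : V} {τ : ℕ} {J : List (V × ℕ)}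
    (h : IsJourney G u τ J) : ∀ e ∈ J, e.2 < arrival J := by
  induction J generalizing u τ with
  | nil => simp
  | cons a J ih =>
    obtain ⟨v, t⟩ := a
    obtain ⟨h1, h2, h3⟩ := h
    cases J with
    | nil => simp [arrival]
    | cons b J =>
      have harr : arrival ((v, t) :: b :: J) = arrival (b :: J) := by simp [arrival]
      intro e he
      rw [harr]
      rcases List.mem_cons.1 he with rfl | he
      · exact (Nat.lt_of_succ_le (h3.le b (by simp))).trans (ih h3 b (by simp))
      · exact ih h3 e he

theorem arrival_le {V : Type} {J : List (V × ℕ)} {T : ℕ} (h : ∀ e ∈ J, e.2 < T) :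
    arrival J ≤ T := by
  rw [arrival]
  split
  · exact Nat.zero_le _
  · next v t heq => exact h _ (List.mem_of_getLast? heq)

theorem IsJourney.cov {u : Fin n} {τ T : ℕ} {J : List (Fin n × ℕ)} (h : IsJourney G u τ J)
    (hτ : τ ≤ T) (hT : ∀ e ∈ J, e.2 < T) :
    Cov (natAvail G) u τ {x | ∃ e ∈ J, (e.1 : ℕ) = x} T := by
  induction J generalizing u τ with
  | nil => exact (cov_empty hτ).subset (by intro x; simp)
  | cons a J ih =>
    obtain ⟨v, t⟩ := a
    obtain ⟨h1, h2, h3⟩ := h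
    have := ih h3 (hT (v, t) (by simp)) fun e he => hT e (by simp [he])
    refine (((Rch.stay _ (u : ℕ) h1).move (natAvail_fin.2 h2)).cov this).subset ?_
    rintro x ⟨e, he, rfl⟩
    rcases List.mem_cons.1 he with rfl | he
    · simp
    · exact Or.inr (Or.inr ⟨e, he, rfl⟩)

theorem IsCovering.cov {s : Fin n} {J : List (Fin n × ℕ)} (h : IsCovering G s J) :
    Cov (natAvail G) s 0 {x | x < n} (arrival J) := by
  refine (h.1.cov (Nat.zero_le _) h.1.lt_arrival).insert_self.subset fun x hx => ?_
  rcases h.2 ⟨x, hx⟩ with h | h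
  · exact Or.inl (congrArg Fin.val h)
  · obtain ⟨e, he, h⟩ := List.mem_map.1 h
    exact Or.inr ⟨e, he, by rw [h]⟩

/-- The journey along the positions `f`, from time `τ` on for `d` time steps. -/
def moves (f : ℕ → Fin n) : ℕ → ℕ → List (Fin n × ℕ)
  | _, 0 => []
  | τ, d + 1 => if f (τ + 1) = f τ then moves f (τ + 1) d
      else (f (τ + 1), τ) :: moves f (τ + 1) d

theorem IsJourney.earlier {V : Type} {G : TVG V} {u : V} {τ τ' : ℕ} {J : List (V × ℕ)}
    (h : IsJourney G u τ J) (hτ : τ' ≤ τ) : IsJourney G u τ' J := by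
  cases J with
  | nil => trivial
  | cons a J => exact ⟨hτ.trans h.1, h.2⟩

theorem isJourney_moves {f : ℕ → Fin n} {τ d : ℕ}
    (hf : ∀ t, τ ≤ t → t < τ + d → f (t + 1) = f t ∨ G.Avail t (f t) (f (t + 1))) :
    IsJourney G (f τ) τ (moves f τ d) := by
  induction d generalizing τ with
  | zero => trivial
  | succ d ih =>
    have h := ih (τ := τ + 1) fun t h1 h2 => hf t (by omega) (by omega)
    rw [moves]
    split_ifs with heq
    · rw [← heq]
      exact h.earlier (Nat.le_succ _)
    · exact ⟨le_rfl, (hf τ le_rfl (by omega)).resolve_left heq, h⟩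

theorem moves_lt {f : ℕ → Fin n} {τ d : ℕ} : ∀ e ∈ moves f τ d, e.2 < τ + d := by
  induction d generalizing τ with
  | zero => simp [moves]
  | succ d ih =>
    have ih : ∀ e ∈ moves f (τ + 1) d, e.2 < τ + (d + 1) := fun e he => by
      have := ih e he
      omega
    rw [moves]
    split_ifs with heq
    · exact ih
    · intro e he
      rcases List.mem_cons.1 he with rfl | he
      · simp
      · exact ih e he

/-- The journey visits all positions. -/
theorem mem_moves {f : ℕ → Fin n} {τ d t : ℕ} (h1 : τ ≤ t) (h2 : t ≤ τ + d) :
    f t = f τ ∨ f t ∈ (moves f τ d).map Prod.fst := by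
  induction d generalizing τ with
  | zero => exact Or.inl (by rw [show t = τ by omega])
  | succ d ih =>
    rcases h1.eq_or_lt with rfl | h1
    · exact Or.inl rfl
    have := ih (τ := τ + 1) h1 (by omega)
    rw [moves]
    split_ifs with heq
    · rwa [heq] at this
    · rw [List.map_cons, List.mem_cons]
      exact Or.inr this

theorem journeyCode_moves (f : ℕ → Fin n) (τ d : ℕ) : journeyCode (moves f τ d) =
    (List.range' τ d).flatMap fun t =>
      if f (t + 1) = f t then [] else [(f (t + 1) : ℕ), t] := by
  induction d generalizing τ with
  | zero => rfl
  | succ d ih =>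
    rw [moves, List.range'_succ, List.flatMap_cons, ← ih]
    split_ifs with heq
    · rfl
    · simp [journeyCode]

end Journey

/-! ### Reading an instance -/

/-- Reading entry `j` of block `i` in a concatenation of blocks of length `k`. -/
theorem getD_flatMap {α : Type*} {f : α → List ℕ} {k : ℕ} {l : List α}
    (hf : ∀ a ∈ l, (f a).length = k) {i j : ℕ} (hi : i < l.length) (hj : j < k) :
    (l.flatMap f).getD (i * k + j) 0 = (f l[i]).getD j 0 := by
  induction l generalizing i with
  | nil => simp at hi
  | cons a l ih =>
    have ha := hf a (by simp)
    rw [List.flatMap_cons]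
    cases i with
    | zero => rw [List.getD_append _ _ _ _ (by omega)]; simp
    | succ i =>
      rw [List.getD_append_right _ _ _ _ (by rw [ha, Nat.succ_mul]; omega), ha,
        show (i + 1) * k + j - k = i * k + j by rw [Nat.succ_mul]; omega,
        ih (fun b hb => hf b (by simp [hb])) (by simpa using hi)]
      simp

theorem matrixCode_eq {n : ℕ} (A : Fin n → Fin n → Bool) : matrixCode A =
    (List.finRange n).flatMap fun u => List.ofFn fun v => (A u v).toNat := by
  rw [matrixCode, List.ofFn_eq_map, List.flatMap_def]

theorem length_matrixCode {n : ℕ} (A : Fin n → Fin n → Bool) : (matrixCode A).length = n * n := by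
  simp [matrixCode_eq, List.length_flatMap]

theorem getD_matrixCode {n : ℕ} (A : Fin n → Fin n → Bool) (u v : Fin n) :
    (matrixCode A).getD (u * n + v) 0 = (A u v).toNat := by
  rw [matrixCode_eq, getD_flatMap (by simp) (by simp) v.2]
  simp [List.getD_eq_getElem?_getD]

section Code

variable {p : ℕ} (I : SpiderInstance p)

theorem SpiderInstance.getD_code (i j : ℕ) (hi : i < I.phases.length)
    (hj : j < I.n * I.n + 1) : I.code.getD (3 + (i * (I.n * I.n + 1) + j)) 0 =
      (I.phases[i].2 :: matrixCode I.phases[i].1).getD j 0 := by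
  rw [SpiderInstance.code, add_comm 3]
  simp only [List.getD_cons_succ]
  exact getD_flatMap (by simp [length_matrixCode]) hi hj

theorem SpiderInstance.length_code :
    I.code.length = 3 + I.phases.length * (I.n * I.n + 1) := by
  simp [SpiderInstance.code, List.length_flatMap, length_matrixCode]
  omega

theorem SpiderInstance.phases_length_pos (hp : 0 < p) : 0 < I.phases.length := by
  rw [List.length_pos_iff]
  intro h
  have := I.period_le
  rw [h] at this
  simp [Phases.duration] at this
  omega

theorem length_le_inputSize (w : List ℕ) : w.length ≤ RAM.inputSize w := by
  induction w with
  | nil => simp [RAM.inputSize]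
  | cons a w ih =>
    simp only [RAM.inputSize, List.map_cons, List.sum_cons, List.length_cons] at ih ⊢
    omega

/-- The index of the static graph in force at time `t`: the number of static graphs that have ended
by then. -/
def phaseIndex (l : List ℕ) (t : ℕ) : ℕ := ∑ i ∈ Finset.range l.length,
  if ∑ j ∈ Finset.range l.length, (if j ≤ i then l.getD j 0 else 0) ≤ t then 1 else 0

theorem phaseIndex_cons (a : ℕ) (l : List ℕ) (t : ℕ) : phaseIndex (a :: l) t =
    if t < a then 0 else phaseIndex l (t - a) + 1 := by
  have hz : ∑ i ∈ Finset.range l.length, (if i + 1 ≤ 0 then l.getD i 0 else 0) = 0 :=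
    Finset.sum_eq_zero fun i _ => if_neg (by omega)
  rw [phaseIndex, List.length_cons]
  simp only [Finset.sum_range_succ' _ l.length, List.getD_cons_succ, List.getD_cons_zero,
    Nat.zero_le, if_true, Nat.add_le_add_iff_right, hz, zero_add]
  by_cases h : t < a
  · rw [if_pos h, if_neg (by omega), add_zero]
    exact Finset.sum_eq_zero fun i _ => if_neg (by omega)
  · rw [if_neg h, if_pos (by omega), phaseIndex]
    congr 1
    refine Finset.sum_congr rfl fun i _ => ?_
    congr 1
    exact propext (by omega)

/-- The matrix in force at time `t` is the one at `phaseIndex`. -/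
theorem at_eq {n : ℕ} {L : Phases n} {t : ℕ} (ht : t < L.duration) :
    ∃ h : phaseIndex (L.map Prod.snd) t < L.length,
      L.at t = some (L[phaseIndex (L.map Prod.snd) t]).1 := by
  induction L generalizing t with
  | nil => simp [Phases.duration] at ht
  | cons a L ih =>
    obtain ⟨A, d⟩ := a
    simp only [List.map_cons, phaseIndex_cons, Phases.at]
    by_cases h : t < d
    · simp [h]
    · simp only [h, if_false]
      obtain ⟨h1, h2⟩ := ih (t := t - d) (by simp [Phases.duration] at ht ⊢; omega)
      exact ⟨by simpa using h1, by simpa using h2⟩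

/-- The entries of the input that tell whether an edge is available. -/
theorem SpiderInstance.getD_code_eq_zero {t : ℕ} (ht : t < p) (u v : Fin I.n) :
    I.code.getD (3 + (phaseIndex (I.phases.map Prod.snd) t * (I.n * I.n + 1)
      + (1 + (u * I.n + v)))) 0 ≠ 0 ↔ I.G.Avail t u v := by
  obtain ⟨h1, h2⟩ := at_eq (ht.trans_le I.period_le)
  have hlt : u * I.n + v < I.n * I.n := by
    have : (u + 1) * I.n ≤ I.n * I.n := Nat.mul_le_mul_right _ u.2
    rw [Nat.succ_mul] at this
    omega
  rw [I.getD_code _ _ h1 (by omega), add_comm 1, List.getD_cons_succ, getD_matrixCode,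
    ← I.describes t _ h2]
  cases (I.phases[phaseIndex (I.phases.map Prod.snd) t]).1 u v <;> simp

theorem SpiderInstance.getD_code_duration {i : ℕ} (hi : i < I.phases.length) :
    I.code.getD (3 + i * (I.n * I.n + 1)) 0 = (I.phases.map Prod.snd).getD i 0 := by
  have := I.getD_code i 0 hi (by omega)
  simpa [hi] using this

end Code

end DMVP

namespace RAM

/-! ### Arithmetic and logic with expressions -/

/-- An expression is true when its value is not zero. -/
def Ex.Holds (e : Ex) (v : Env) : Prop := e.eval v ≠ 0

namespace Ex

instance (e : Ex) (v : Env) : Decidable (e.Holds v) := inferInstanceAs (Decidable (_ ≠ 0))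

/-- Negation: `1 - e`. -/
def not (e : Ex) : Ex := .sub (.const 1) e

/-- `e < f`, as the truncated difference `f - e`. -/
def lt (e f : Ex) : Ex := .sub f e

/-- `e ≤ f`, with the value `1` if true. -/
def le (e f : Ex) : Ex := .sub (.const 1) (.sub e f)

/-- Equality, with the value `1` if true. -/
def eq (e f : Ex) : Ex := .sub (.const 1) (.add (.sub e f) (.sub f e))

/-- Conjunction; the value is that of `f` if `e` holds. -/
def and (e f : Ex) : Ex := .ite e f (.const 0)

/-- The number of values of `x` below `b` for which `e` is true. -/
def count (x b : ℕ) (e : Ex) : Ex := .sum x b (.ite e (.const 1) (.const 0))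

/-- The product of the variable `b`, which has to be a loop bound, and the expression `e`. -/
def mul (b : ℕ) (e : Ex) : Ex := .letv 31 e (.sum 30 b (.var 31))

/-- The quotient of the variables `x` and `b`, if it is at most `k`. -/
def div (x b k : ℕ) : Ex := count 32 k (le (mul b (.add (.var 32) (.const 1))) (.var x))

variable {v : Env} {e f g : Ex} {x b : ℕ}

@[simp] theorem holds_not : (not e).Holds v ↔ ¬ e.Holds v := by
  simp only [Holds, not, eval]; omega

@[simp] theorem holds_lt : (lt e f).Holds v ↔ e.eval v < f.eval v := by
  simp only [Holds, lt, eval]; omega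

@[simp] theorem holds_le : (le e f).Holds v ↔ e.eval v ≤ f.eval v := by
  simp only [Holds, le, eval]; omega

@[simp] theorem holds_eq : (eq e f).Holds v ↔ e.eval v = f.eval v := by
  simp only [Holds, eq, eval]; omega

@[simp] theorem holds_and : (and e f).Holds v ↔ e.Holds v ∧ f.Holds v := by
  simp only [Holds, and, eval]
  split_ifs with h <;> simp [h]

@[simp] theorem holds_add : (add e f).Holds v ↔ e.Holds v ∨ f.Holds v := by
  simp only [Holds, eval]; omega

@[simp] theorem holds_sum : (sum x b e).Holds v ↔ ∃ i < v.var b, e.Holds (v.setV x i) := by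
  simp [Holds, eval]

@[simp] theorem holds_letv : (letv x e f).Holds v ↔ f.Holds (v.setV x (e.eval v)) := Iff.rfl

theorem holds_ite : (ite e f g).Holds v ↔ if e.Holds v then f.Holds v else g.Holds v := by
  by_cases h : e.eval v = 0 <;> simp [Holds, eval, h]

theorem holds_var : (var x).Holds v ↔ v.var x ≠ 0 := Iff.rfl

theorem eval_ite : (ite e f g).eval v = if e.Holds v then f.eval v else g.eval v := by
  by_cases h : e.eval v = 0 <;> simp [Holds, eval, h]

theorem eval_count : (count x b e).eval v =
    ((Finset.range (v.var b)).filter fun i => e.Holds (v.setV x i)).card := by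
  rw [Finset.card_filter]
  exact Finset.sum_congr rfl fun i _ => eval_ite

@[simp] theorem eval_mul (hb : b < 30) : (mul b e).eval v = v.var b * e.eval v := by
  simp [mul, eval, Env.setV_var, show b ≠ 31 by omega]

/-- A quotient counts the multiples of `b` up to `t`. -/
theorem card_filter_mul_le {b t k : ℕ} (hb : 0 < b) (h : t / b ≤ k) :
    ((Finset.range k).filter fun i => b * (i + 1) ≤ t).card = t / b := by
  rw [show ((Finset.range k).filter fun i => b * (i + 1) ≤ t) = Finset.range (t / b) from ?_,
    Finset.card_range]
  ext i
  rw [Finset.mem_filter, Finset.mem_range, Finset.mem_range, mul_comm,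
    ← Nat.le_div_iff_mul_le hb]
  omega

theorem eval_div {k : ℕ} (hb : b < 30) (hx : x ≠ 32)
    (h0 : 0 < v.var b) (h : v.var x / v.var b ≤ v.var k) :
    (div x b k).eval v = v.var x / v.var b := by
  rw [div, eval_count, ← card_filter_mul_le h0 h]
  congr 1
  refine Finset.filter_congr fun i _ => ?_
  simp [hb, eval, Env.setV_var, hx, show b ≠ 32 by omega]

/-- The defining property of tables. -/
theorem exists_table (v : Env) (a x b : ℕ) (e f : Ex) : ∃ T : ℕ → ℕ,
    (tab a x b e f).eval v = f.eval (v.setA a T) ∧ ∀ i < v.var b, ∃ T' : ℕ → ℕ,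
      (∀ j < i, T' j = T j) ∧ T i = e.eval ((v.setA a T').setV x i) :=
  ⟨_, rfl, fun i hi => ⟨tabSeq _ i, fun _ hj => tabSeq_eq_of_lt _ hj (hj.trans hi),
    tabSeq_of_lt _ hi⟩⟩

/-- A table with rows of length `col`: the entry at `d * col + j` is computed from `d`, in the
variable `q`, and `j`, in the variable `y`. -/
def tab₂ (a x size col rows q y : ℕ) (e f : Ex) : Ex :=
  .tab a x size (.letv q (div x col rows) (.letv y (.sub (.var x) (mul col (.var q))) e)) f

/-- Encoding a position in a table with rows of length `a`. -/
theorem index_lt {a d y D : ℕ} (hd : d < D) (hy : y < a) : a * d + y < a * D := by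
  have : a * (d + 1) ≤ a * D := Nat.mul_le_mul_left _ hd
  rw [Nat.mul_succ] at this
  omega

theorem index_div {a d y : ℕ} (hy : y < a) : (a * d + y) / a = d := by
  rw [Nat.mul_add_div (by omega), Nat.div_eq_of_lt hy, add_zero]

/-- The defining property of tables with rows: the entry in row `d` and column `j` is computed when
the rows above are known. -/
theorem exists_table₂ {v : Env} {a x size col rows q y : ℕ} (e f : Ex) (hx : 32 < x)
    (hq : 32 < q) (hxq : x ≠ q) (hcol : col < 30) (hrows : rows < 30)
    (hsize : v.var size = v.var col * (v.var rows + 1) ∨ v.var size = v.var col * v.var rows) :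
    ∃ T : ℕ → ℕ, (tab₂ a x size col rows q y e f).eval v = f.eval (v.setA a T) ∧
      ∀ d, v.var col * (d + 1) ≤ v.var size → ∀ j < v.var col, ∃ T' : ℕ → ℕ,
        (∀ d' < d, ∀ j' < v.var col, T' (v.var col * d' + j') = T (v.var col * d' + j')) ∧
        T (v.var col * d + j) = e.eval
          ((((v.setA a T').setV x (v.var col * d + j)).setV q d).setV y j) := by
  obtain ⟨T, hT, hrec⟩ := exists_table v a x size
    (.letv q (div x col rows) (.letv y (.sub (.var x) (mul col (.var q))) e)) f
  refine ⟨T, hT, fun d hd j hj => ?_⟩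
  have hd' : d < v.var rows + 1 := by
    rcases hsize with h | h <;> rw [h] at hd <;>
      have := Nat.le_of_mul_le_mul_left hd (by omega) <;> omega
  obtain ⟨T', hT', hTi⟩ := hrec (v.var col * d + j) (by rw [Nat.mul_succ] at hd; omega)
  refine ⟨T', fun d' hd' j' hj' => hT' _ ?_, ?_⟩
  · have := index_lt hd' hj'
    omega
  · have hdiv : (div x col rows).eval ((v.setA a T').setV x (v.var col * d + j)) = d := by
      rw [eval_div hcol (by omega)] <;>
        simp only [Env.setV_var, Env.setA_var, if_true, show col ≠ x by omega,
          show rows ≠ x by omega, if_false, index_div hj]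
      · omega
      · omega
    rw [hTi, Ex.eval, hdiv, Ex.eval]
    congr 2
    simp [Ex.eval, hcol, Env.setV_var, hxq, show col ≠ x by omega, show col ≠ q by omega]

section Ok

variable {m : ℕ}

theorem ok_not : (not e).Ok m ↔ e.Ok m := by simp [not, Ok]

theorem ok_lt : (lt e f).Ok m ↔ e.Ok m ∧ f.Ok m := by simp [lt, Ok, and_comm]

theorem ok_le : (le e f).Ok m ↔ e.Ok m ∧ f.Ok m := by simp [le, Ok]

theorem ok_eq : (eq e f).Ok m ↔ e.Ok m ∧ f.Ok m := by simp [eq, Ok]; tauto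

theorem ok_and : (and e f).Ok m ↔ e.Ok m ∧ f.Ok m := by simp [and, Ok]

theorem ok_count : (count x b e).Ok m ↔ m ≤ x ∧ b < m ∧ e.Ok m := by simp [count, Ok]

theorem ok_mul (h : m ≤ 30) : (mul b e).Ok m ↔ b < m ∧ e.Ok m := by
  simp only [mul, Ok]
  constructor
  · tauto
  · exact fun h' => ⟨by omega, h'.2, by omega, h'.1, trivial⟩

theorem ok_div {k : ℕ} (h : m ≤ 30) (hb : b < m) (hk : k < m) : (div x b k).Ok m := by
  simp [div, ok_count, ok_le, ok_mul h, Ok, hb, hk]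
  omega

theorem ok_tab₂ {a size col rows q y : ℕ} (h : m ≤ 30) (hx : 30 ≤ x) (hq : 30 ≤ q) (hy : 30 ≤ y)
    (hs : size < m) (hc : col < m) (hr : rows < m) (he : e.Ok m) (hf : f.Ok m) :
    (tab₂ a x size col rows q y e f).Ok m := by
  simp only [tab₂, Ok, ok_div h hc hr, ok_mul h, he, hf]
  simp only [true_and, and_true]
  omega

end Ok

end Ex

end RAM

namespace DMVP

open RAM RAM.Ex

/-! ### Parameters -/

/-- The parameters that bound the loops, for period `p`, `n` vertices and `m` static graphs.
With `H = p * n`, sums of at most `n` passage weights are below `K = (n + 1) ^ (p * (p + 1))`, and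
optimal journeys end before the time `n * H + 1`. -/
def bound (p n m : ℕ) : ℕ → ℕ
  | 0 => n
  | 1 => m
  | 2 => n * n
  | 3 => p
  | 4 => p + 1
  | 5 => n + 1
  | 6 => (n + 1) ^ (p * (p + 1))
  | 7 => p * (p + 1)
  | 8 => p * n + 1
  | 9 => n * (p * n + 1)
  | 10 => n * (p * n) + 1
  | 11 => (n + 1) ^ (p * (p + 1)) * (n * (p * n) + 1)
  | 12 => (n + 1) * ((n + 1) ^ (p * (p + 1)) * (n * (p * n) + 1))
  | 13 => (p + 1) * (n + 1) ^ (p * (p + 1))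
  | 14 => (n + 1) * ((p + 1) * (n + 1) ^ (p * (p + 1)))
  | 15 => 2 * p
  | 16 => n * (p * n) + 1 + 2 * (p * n + 1) + p
  | _ => n * (p * n) + 2

/-- The environment holds the input `w` in array 0, and the parameters that bound the loops in the
variables below 18. Variables 18, 19 and 20 are used for the center of the spider, for the existence
of a solution and for the optimum. Variables from 30 on are bound in expressions, and array 1 and
the following ones are filled with tables. -/
structure Base (w : List ℕ) (p n m : ℕ) (v : Env) : Prop where
  arr : v.arr 0 = inputArr w
  var : ∀ j < 18, v.var j = bound p n m j

theorem Base.setV {w : List ℕ} {p n m x i : ℕ} {v : Env} (h : Base w p n m v) (hx : 18 ≤ x) :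
    Base w p n m (v.setV x i) :=
  ⟨h.arr, fun j hj => by rw [Env.setV_var, if_neg (by omega), h.var j hj]⟩

theorem Base.setA {w : List ℕ} {p n m a : ℕ} {T : ℕ → ℕ} {v : Env} (h : Base w p n m v)
    (ha : a ≠ 0) : Base w p n m (v.setA a T) :=
  ⟨by rw [Env.setA_arr, if_neg ha.symm, h.arr], h.var⟩

/-- The input, from position `o` on, describes the first `p` time steps of the periodic
availability relation `av` on the vertices below `n`, and the starting vertex `s`. -/
structure Describes (w : List ℕ) (o p n m s : ℕ) (av : ℕ → ℕ → ℕ → Prop) : Prop where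
  period_pos : 0 < p
  start : inputArr w (o + 1) = s
  start_lt : s < n
  lt : ∀ {t u x}, av t u x → u < n ∧ x < n
  per : ∀ t u x, av (t % p) u x ↔ av t u x
  read : ∀ r < p, ∀ u < n, ∀ x < n, inputArr w (o + 3 +
    ((∑ i ∈ Finset.range m, if ∑ j ∈ Finset.range m,
      (if j ≤ i then inputArr w (o + 3 + j * (n * n + 1)) else 0) ≤ r then 1 else 0) * (n * n + 1)
      + (1 + (u * n + x)))) ≠ 0 ↔ av r u x

/-! ### Earliest arrival as an expression -/

/-- The position of the `j`-th static graph in the input, relative to the first one. -/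
def eBlock (x : ℕ) : Ex := .add (mul 2 (.var x)) (.var x)

/-- The index of the static graph in force at the time in variable 33. -/
def ePhase (o : ℕ) : Ex :=
  count 34 1 (le (.sum 35 1 (.ite (le (.var 35) (.var 34))
    (.get 0 (.add (.const (o + 3)) (eBlock 35))) (.const 0))) (.var 33))

/-- The availability of the edge between the vertices in variables 36 and 37 at the time in
variable 33, which has to be less than `p`. -/
def eAvail (o : ℕ) : Ex :=
  .letv 38 (ePhase o) (.get 0 (.add (.const (o + 3)) (.add (eBlock 38)
    (.add (.const 1) (.add (mul 0 (.var 36)) (.var 37))))))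

/-- The residue modulo `p` of variable 39. -/
def eMod : Ex := .sub (.var 39) (mul 3 (div 39 3 16))

/-- The entry at `n * d + y` of array 1, with `d` in variable 45 and `y` in variable 46, tells
whether the vertex `y` can be reached within `d` steps from the vertex in variable 40, starting at
the time in variable 42. -/
def eReachEntry (o : ℕ) : Ex :=
  .ite (.var 45)
    (.letv 49 (.sub (.var 45) (.const 1))
      (.add (.get 1 (.add (mul 0 (.var 49)) (.var 46)))
        (.sum 47 0 (and (.get 1 (.add (mul 0 (.var 49)) (.var 47)))
          (.letv 39 (.add (.var 42) (.var 49)) (.letv 33 eMod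
            (.letv 36 (.var 47) (.letv 37 (.var 46) (eAvail o)))))))))
    (eq (.var 46) (.var 40))

/-- The table of `eReachEntry` in array 1, for use in `f`. -/
def eReach (o : ℕ) (f : Ex) : Ex := tab₂ 1 44 9 0 8 45 46 (eReachEntry o) f

/-- The least number of steps from the vertex in variable 40 to the one in variable 41, starting at
the time in variable 42. -/
def eDelay (o : ℕ) : Ex :=
  eReach o (count 43 8 (not (.get 1 (.add (mul 0 (.var 43)) (.var 41)))))

/-- The earliest arrival at the vertex in variable `y` for an agent that is at the vertex in
variable `x` at time `t`. -/
def eArr (o x y : ℕ) (t : Ex) : Ex :=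
  .letv 48 t (.letv 40 (.var x) (.letv 41 (.var y)
    (.add (.var 48) (.letv 39 (.var 48) (.letv 42 eMod (eDelay o))))))

section

variable {w : List ℕ} {o p n m s c : ℕ} {av : ℕ → ℕ → ℕ → Prop} {v : Env} {k : ℕ}

theorem ok_eAvail (h : 18 ≤ k) (h' : k ≤ 30) : (eAvail o).Ok k := by
  simp only [eAvail, ePhase, eBlock, Ex.Ok, ok_count, ok_le, ok_mul h']
  simp only [true_and, and_true]
  omega

theorem ok_eMod (h : 18 ≤ k) (h' : k ≤ 30) : eMod.Ok k := by
  simp only [eMod, Ex.Ok, ok_mul h', ok_div h' (show 3 < k by omega) (show 16 < k by omega)]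
  simp only [true_and, and_true]
  omega

theorem ok_eReach {f : Ex} (h : 18 ≤ k) (h' : k ≤ 30) (hf : f.Ok k) : (eReach o f).Ok k := by
  refine ok_tab₂ h' (by omega) (by omega) (by omega) (by omega) (by omega) (by omega) ?_ hf
  simp only [eReachEntry, Ex.Ok, ok_mul h', ok_and, ok_eq, ok_eMod h h', ok_eAvail h h']
  simp only [true_and, and_true]
  omega

theorem ok_eArr {x y : ℕ} {t : Ex} (h : 18 ≤ k) (h' : k ≤ 30) (ht : t.Ok k) :
    (eArr o x y t).Ok k := by
  have h1 : (eDelay o).Ok k := ok_eReach h h' (by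
    simp only [ok_count, ok_not, Ex.Ok, ok_mul h']
    simp only [and_true]
    omega)
  simp only [eArr, Ex.Ok, ok_eMod h h', h1, ht]
  simp only [true_and, and_true]
  omega

theorem eval_eAvail (hw : Describes w o p n m s av) (hv : Base w p n m v) (h1 : v.var 33 < p)
    (h2 : v.var 36 < n) (h3 : v.var 37 < n) :
    (eAvail o).Holds v ↔ av (v.var 33) (v.var 36) (v.var 37) := by
  have hb : ∀ (v' : Env) (x : ℕ), Base w p n m v' →
      (eBlock x).eval v' = v'.var x * (n * n + 1) := by
    intro v' x hv'
    simp only [eBlock, Ex.eval, eval_mul (show 2 < 30 by omega), hv'.var 2 (by omega), bound]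
    ring
  have hph : (ePhase o).eval v = ∑ i ∈ Finset.range m, if ∑ j ∈ Finset.range m,
      (if j ≤ i then inputArr w (o + 3 + j * (n * n + 1)) else 0) ≤ v.var 33 then 1 else 0 := by
    rw [ePhase, eval_count, Finset.card_filter, hv.var 1 (by omega)]
    refine Finset.sum_congr rfl fun i _ => if_congr ?_ rfl rfl
    have hv1 : Base w p n m (v.setV 34 i) := hv.setV (by omega)
    rw [holds_le]
    refine iff_of_eq (congrArg₂ _ ?_ (by simp [Ex.eval, Env.setV_var]))
    rw [Ex.eval, hv1.var 1 (by omega)]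
    refine Finset.sum_congr rfl fun j _ => ?_
    simp only [eval_ite, holds_le]
    have hv2 : Base w p n m ((v.setV 34 i).setV 35 j) := hv1.setV (by omega)
    simp only [Ex.eval, hb _ _ hv2, hv2.arr]
    simp [Env.setV_var]
  rw [← hw.read _ h1 _ h2 _ h3, ← hph]
  have hv1 : Base w p n m (v.setV 38 ((ePhase o).eval v)) := hv.setV (by omega)
  rw [eAvail, holds_letv, Holds]
  simp only [Ex.eval, hb _ _ hv1, hv1.arr, eval_mul (show 0 < 30 by omega),
    hv1.var 0 (by omega), bound]
  simp [Env.setV_var, mul_comm]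

theorem eval_eMod (hp : 0 < p) (hv : Base w p n m v) (h : v.var 39 ≤ bound p n m 16) :
    eMod.eval v = v.var 39 % p := by
  have h3 : v.var 3 = p := hv.var 3 (by omega)
  rw [eMod, Ex.eval, eval_mul (by omega), Ex.eval, eval_div (by omega) (by omega)
    (by omega), h3]
  · have := Nat.mod_add_div (v.var 39) p
    omega
  · rw [hv.var 16 (by omega)]
    exact (Nat.div_le_self _ _).trans h

/-- Correctness of the table of reachable vertices, which does not depend on connectedness. -/
theorem exists_reach (hw : Describes w o p n m s av) (hv : Base w p n m v)
    (h2 : v.var 42 < p) (f : Ex) : ∃ T : ℕ → ℕ, (eReach o f).eval v = f.eval (v.setA 1 T) ∧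
      ∀ d < p * n + 1, ∀ y < n,
        T (n * d + y) ≠ 0 ↔ Rch av (v.var 42) (v.var 40) (v.var 42 + d) y := by
  obtain ⟨T, hT, hrec⟩ := exists_table₂ (v := v) (a := 1) (x := 44) (size := 9) (col := 0)
    (rows := 8) (q := 45) (y := 46) (eReachEntry o) f (by omega) (by omega) (by omega) (by omega)
    (by omega) (Or.inr (by simp only [hv.var _ (show 9 < 18 by omega),
      hv.var _ (show 0 < 18 by omega), hv.var _ (show 8 < 18 by omega), bound]))
  simp only [hv.var _ (show 9 < 18 by omega), hv.var _ (show 0 < 18 by omega), bound] at hrec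
  refine ⟨T, hT, fun d => ?_⟩
  have entry : ∀ d < p * n + 1, ∀ y < n, T (n * d + y) ≠ 0 ↔
      if d = 0 then y = v.var 40 else T (n * (d - 1) + y) ≠ 0 ∨ ∃ x < n,
        T (n * (d - 1) + x) ≠ 0 ∧ av (v.var 42 + (d - 1)) x y := by
    intro d hd y hy
    obtain ⟨T', hT', hTi⟩ := hrec d (Nat.mul_le_mul_left _ hd) y hy
    rw [hTi, ← Holds, eReachEntry]
    simp only [holds_ite, holds_var]
    rcases Nat.eq_zero_or_pos d with rfl | hd0
    · simp [Env.setV_var, Ex.eval]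
    · have hd1 : d ≠ 0 := by omega
      have hv3 : Base w p n m ((((v.setA 1 T').setV 44 (n * d + y)).setV 45 d).setV 46 y) :=
        (((hv.setA (by omega)).setV (by omega)).setV (by omega)).setV (by omega)
      set v3 := (((v.setA 1 T').setV 44 (n * d + y)).setV 45 d).setV 46 y with hv3d
      have e45 : v3.var 45 = d := by simp [hv3d, Env.setV_var]
      have e42 : v3.var 42 = v.var 42 := by simp [hv3d, Env.setV_var]
      have e46 : v3.var 46 = y := by simp [hv3d, Env.setV_var]
      have a1 : v3.arr 1 = T' := by simp [hv3d, Env.setA_arr]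
      have hget : ∀ (v' : Env) (x : ℕ), Base w p n m v' → v'.arr 1 = T' → v'.var 49 = d - 1 →
          v'.var x < n → ((Ex.get 1 (.add (mul 0 (.var 49)) (.var x))).Holds v' ↔
            T (n * (d - 1) + v'.var x) ≠ 0) := by
        intro v' x hb ha h49 hx
        rw [Holds, Ex.eval, Ex.eval, eval_mul (by omega), Ex.eval, Ex.eval, ha, h49,
          hb.var 0 (by omega)]
        simp only [bound]
        rw [hT' _ (by omega) _ hx]
      simp only [e45, hd1, ne_eq, not_false_eq_true, if_true, if_false]
      rw [holds_letv, holds_add, holds_sum, Ex.eval, Ex.eval, Ex.eval, e45]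
      have hv4 : Base w p n m (v3.setV 49 (d - 1)) := hv3.setV (by omega)
      refine or_congr ?_ ?_
      · rw [hget _ _ hv4 (by simp [a1]) (by simp [Env.setV_var])] <;>
          simp [Env.setV_var, e46, hy]
      · rw [hv4.var 0 (by omega)]
        refine exists_congr fun x => and_congr_right fun hx => ?_
        simp only [bound] at hx
        have hv5 : Base w p n m ((v3.setV 49 (d - 1)).setV 47 x) := hv4.setV (by omega)
        rw [holds_and, hget _ _ hv5 (by simp [a1]) (by simp [Env.setV_var])
          (by simpa [Env.setV_var] using hx), holds_letv, holds_letv, holds_letv, holds_letv]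
        refine and_congr (by simp [Env.setV_var]) ?_
        have hmod := eval_eMod (v := ((v3.setV 49 (d - 1)).setV 47 x).setV 39
          (v.var 42 + (d - 1))) hw.period_pos (hv5.setV (by omega)) (by
            simp only [Env.setV_var, bound, if_true]
            omega)
        simp only [Ex.eval, Env.setV_var, e42] at hmod ⊢
        norm_num at hmod ⊢
        rw [hmod, eval_eAvail hw ((((hv5.setV (by omega)).setV (by omega)).setV
          (by omega)).setV (by omega))] <;> simp only [Env.setV_var] <;> norm_num
        · rw [e46, hw.per]
        · exact Nat.mod_lt _ hw.period_pos
        · exact hx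
        · rw [e46]; exact hy
  induction d with
  | zero =>
    intro hd y hy
    rw [entry 0 hd y hy, if_pos rfl, add_zero, rch_self, eq_comm]
  | succ d ih =>
    intro hd y hy
    rw [entry (d + 1) hd y hy, if_neg (by omega), rch_add_succ, Nat.add_sub_cancel]
    refine or_congr (ih (by omega) y hy) ⟨?_, ?_⟩
    · rintro ⟨x, hx, h3, h4⟩
      exact ⟨x, (ih (by omega) x hx).1 h3, h4⟩
    · rintro ⟨x, h3, h4⟩
      exact ⟨x, (hw.lt h4).1, (ih (by omega) x (hw.lt h4).1).2 h3, h4⟩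

theorem eval_eDelay (hw : Describes w o p n m s av) (hn : Net av n p (p * n))
    (hv : Base w p n m v) (h1 : v.var 40 < n) (h2 : v.var 42 < p) (h3 : v.var 41 < n) :
    (eDelay o).eval v = dl av (v.var 42) (v.var 40) (v.var 41) := by
  obtain ⟨T, hT, hrec⟩ := exists_reach hw hv h2
    (count 43 8 (not (.get 1 (.add (mul 0 (.var 43)) (.var 41)))))
  rw [eDelay, hT, eval_count, Finset.card_filter, ← hn.dl_eq_sum (v.var 42) h1 h3
    (fun d => T (n * d + v.var 41)) fun d hd => by rw [← hrec d hd _ h3, not_not]]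
  have hv1 : Base w p n m (v.setA 1 T) := hv.setA (by omega)
  rw [hv1.var 8 (by omega)]
  refine Finset.sum_congr rfl fun d _ => if_congr ?_ rfl rfl
  have hv2 : Base w p n m ((v.setA 1 T).setV 43 d) := hv1.setV (by omega)
  rw [holds_not, Holds, not_not]
  simp [Ex.eval, hv2.var 0 (by omega), bound, Env.setV_var, Env.setA_arr]

theorem eval_eArr (hw : Describes w o p n m s av) (hn : Net av n p (p * n))
    (hv : Base w p n m v) {x y : ℕ} {t : Ex} (hx : x < 39 ∨ 49 < x) (hy : y < 39 ∨ 49 < y)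
    (h1 : v.var x < n) (h2 : v.var y < n) (h3 : t.eval v ≤ bound p n m 16) :
    (eArr o x y t).eval v = arr av (v.var x) (v.var y) (t.eval v) := by
  have hp := hw.period_pos
  have hx' : x ≠ 48 ∧ x ≠ 40 := by omega
  have hy' : y ≠ 48 ∧ y ≠ 40 := by omega
  simp only [eArr, Ex.eval, arr]
  have hmod := eval_eMod (v := ((((v.setV 48 (t.eval v)).setV 40 (v.var x)).setV 41
    (v.var y)).setV 39 (t.eval v))) hp ((((hv.setV (by omega)).setV (by omega)).setV
      (by omega)).setV (by omega)) (by simpa [Env.setV_var] using h3)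
  simp only [Env.setV_var, hx', hy'] at hmod ⊢
  norm_num at hmod ⊢
  rw [hmod, eval_eDelay hw hn (((((hv.setV (by omega)).setV (by omega)).setV (by omega)).setV
    (by omega)).setV (by omega))] <;> simp only [Env.setV_var] <;> norm_num
  · exact hn.dl_mod _ _ _
  · exact h1
  · exact Nat.mod_lt _ hp
  · exact h2

end

end DMVP

namespace DMVP

open RAM RAM.Ex

/-! ### The weights of the legs as expressions -/

/-- The time spent in the leg of the leaf in variable 50 in the mode in variable 51. Variable 18
holds the center. -/
def eLegTime (o : ℕ) : Ex :=
  .ite (lt (.var 51) (.var 3))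
    (.letv 52 (eArr o 18 50 (.var 51)) (.sub (eArr o 50 18 (.var 52)) (.var 51)))
    (.letv 53 (.sub (.var 51) (.var 3)) (.sub (eArr o 18 50 (.var 53)) (.var 53)))

/-- The residue at which the leg of the leaf in variable 50 is left in the mode in variable 51. -/
def eDst (o : ℕ) : Ex :=
  .ite (lt (.var 51) (.var 3)) (.letv 39 (.add (.var 51) (eLegTime o)) eMod) (.var 3)

/-- The residue at which a leg is entered in the mode in variable 51. -/
def eSrc : Ex := .ite (lt (.var 51) (.var 3)) (.var 51) (.sub (.var 51) (.var 3))

/-- The weight of a passage from the residue in variable 57 to the one in variable 58, taken from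
a table of powers. -/
def ePassage : Ex :=
  .tab 2 56 7 (.ite (.var 56) (mul 5 (.get 2 (.sub (.var 56) (.const 1)))) (.const 1))
    (.get 2 (.add (mul 4 (.var 57)) (.var 58)))

/-- The weight of the leg of the leaf in variable 50 in the mode in variable 51. -/
def eWeight (o : ℕ) : Ex :=
  .letv 54 (eLegTime o) (.letv 58 (eDst o) (.letv 57 eSrc (.add ePassage (mul 6 (.var 54)))))

/-- The vertex in variable 60 is a leaf that has to be visited: it belongs to the set of targets in
array 3 and is neither the center nor the vertex in variable 61. The value `n` of that variable
leaves out no leaf. -/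
def eActive : Ex :=
  and (.get 3 (.var 60)) (and (not (eq (.var 60) (.var 18))) (not (eq (.var 60) (.var 61))))

/-- The vertices below `i` in `U` other than `c` and `x`. -/
def jobs (U : ℕ → ℕ) (c x i : ℕ) : List ℕ :=
  (List.range i).filter fun j => U j ≠ 0 ∧ j ≠ c ∧ j ≠ x

/-- The table in array 4 of the total weights that the leaves below `i` can have. -/
def eAssign (o : ℕ) (f : Ex) : Ex :=
  tab₂ 4 62 12 11 5 63 64
    (.ite (.var 63)
      (.letv 65 (.sub (.var 63) (.const 1))
        (.ite (.letv 60 (.var 65) eActive)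
          (.sum 51 15 (.letv 50 (.var 65) (.letv 66 (eWeight o) (and (le (.var 66) (.var 64))
            (.get 4 (.add (mul 11 (.var 65)) (.sub (.var 64) (.var 66))))))))
          (.get 4 (.add (mul 11 (.var 65)) (.var 64)))))
      (eq (.var 64) (.const 0))) f

/-- The table in array 5 of the weights that walks of length `ℓ` can have. -/
def eWalk (f : Ex) : Ex :=
  tab₂ 5 67 14 13 5 68 69
    (.letv 70 (div 69 4 6) (.letv 57 (.sub (.var 69) (mul 4 (.var 70)))
      (.ite (.var 68)
        (and (lt (.var 57) (.var 3)) (.sum 58 4 (.letv 71 ePassage (and (le (.var 71) (.var 70))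
          (.get 5 (.add (mul 13 (.sub (.var 68) (.const 1)))
            (.add (mul 4 (.sub (.var 70) (.var 71))) (.var 58))))))))
        (and (eq (.var 57) (.var 3)) (eq (.var 70) (.const 0)))))) f

/-- Some tour of the active leaves that starts at the center at the time in variable 72 ends by the
time in variable 73: some passage weight `C`, in variable 75, and duration `d`, in variable 76, can
be assigned to the leaves and belong to a walk. -/
def eTour (o : ℕ) : Ex :=
  .letv 74 (count 60 0 eActive)
    (.ite (.var 74)
      (.letv 39 (.var 72) (.letv 77 eMod (eAssign o (eWalk (.sum 75 6 (.sum 76 10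
        (and (le (.add (.var 72) (.var 76)) (.var 73))
          (and (.get 4 (.add (mul 11 (.var 0)) (.add (mul 6 (.var 76)) (.var 75))))
            (.get 5 (.add (mul 13 (.var 74))
              (.add (mul 4 (.var 75)) (.var 77))))))))))))
      (le (.var 72) (.var 73)))

/-- An agent that is at the vertex in variable 78 at the time in variable 79 can visit the targets
in array 3 by the time in variable 73. -/
def eCover (o : ℕ) : Ex :=
  .letv 61 (.var 0)
    (.add (.letv 72 (eArr o 78 18 (.var 79)) (eTour o))
      (.add (.sum 80 0 (and (.letv 60 (.var 80) eActive)
          (.letv 72 (.letv 81 (eArr o 78 80 (.var 79)) (eArr o 80 18 (.var 81)))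
            (.letv 61 (.var 80) (eTour o)))))
        (.add (and (not (.get 3 (.var 18)))
            (.sum 80 0 (and (.letv 60 (.var 80) eActive) (and (eq (count 60 0 eActive) (.const 1))
              (le (eArr o 78 80 (.var 79)) (.var 73))))))
          (and (not (.sum 80 0 (.get 3 (.var 80)))) (le (.var 79) (.var 73))))))

section

variable {w : List ℕ} {o p n m s c : ℕ} {av : ℕ → ℕ → ℕ → Prop} {v : Env} {k : ℕ}

theorem ok_eLegTime (h : 18 ≤ k) (h' : k ≤ 30) : (eLegTime o).Ok k := by
  simp only [eLegTime, Ex.Ok, ok_lt, ok_eArr h h' (show (Ex.var 51).Ok k from trivial),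
    ok_eArr h h' (show (Ex.var 52).Ok k from trivial),
    ok_eArr h h' (show (Ex.var 53).Ok k from trivial)]
  simp only [and_true, true_and]
  omega

theorem ok_ePassage (h : 18 ≤ k) (h' : k ≤ 30) : ePassage.Ok k := by
  simp only [ePassage, Ex.Ok, ok_mul h']
  simp only [and_true, true_and]
  omega

theorem ok_eWeight (h : 18 ≤ k) (h' : k ≤ 30) : (eWeight o).Ok k := by
  simp only [eWeight, eDst, eSrc, Ex.Ok, ok_mul h', ok_lt, ok_eLegTime h h', ok_ePassage h h',
    ok_eMod h h']
  simp only [and_true, true_and]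
  omega

theorem ok_eActive : eActive.Ok k := by
  simp only [eActive, Ex.Ok, ok_and, ok_not, ok_eq]
  trivial

theorem ok_eAssign {f : Ex} (h : 18 ≤ k) (h' : k ≤ 30) (hf : f.Ok k) : (eAssign o f).Ok k := by
  refine ok_tab₂ h' (by omega) (by omega) (by omega) (by omega) (by omega) (by omega) ?_ hf
  simp only [Ex.Ok, ok_mul h', ok_and, ok_le, ok_eq, ok_eWeight h h', ok_eActive]
  simp only [and_true, true_and]
  omega

theorem ok_eWalk {f : Ex} (h : 18 ≤ k) (h' : k ≤ 30) (hf : f.Ok k) : (eWalk f).Ok k := by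
  refine ok_tab₂ h' (by omega) (by omega) (by omega) (by omega) (by omega) (by omega) ?_ hf
  simp only [Ex.Ok, ok_mul h', ok_and, ok_le, ok_eq, ok_lt, ok_ePassage h h',
    ok_div h' (show 4 < k by omega) (show 6 < k by omega)]
  simp only [and_true, true_and]
  omega

theorem ok_eTour (h : 18 ≤ k) (h' : k ≤ 30) : (eTour o).Ok k := by
  have h1 := ok_eAssign (o := o) h h' (ok_eWalk h h' (f := .sum 75 6 (.sum 76 10
        (and (le (.add (.var 72) (.var 76)) (.var 73))
          (and (.get 4 (.add (mul 11 (.var 0)) (.add (mul 6 (.var 76)) (.var 75))))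
            (.get 5 (.add (mul 13 (.var 74)) (.add (mul 4 (.var 75)) (.var 77)))))))) (by
    simp only [Ex.Ok, ok_mul h', ok_and, ok_le]
    simp only [and_true, true_and]
    omega))
  simp only [eTour, Ex.Ok, ok_count, ok_le, ok_eActive, ok_eMod h h', h1]
  simp only [and_true, true_and]
  omega

theorem ok_eCover (h : 18 ≤ k) (h' : k ≤ 30) : (eCover o).Ok k := by
  simp only [eCover, Ex.Ok, ok_and, ok_le, ok_not, ok_eq, ok_count, ok_eActive, ok_eTour h h',
    ok_eArr h h' (show (Ex.var 79).Ok k from trivial),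
    ok_eArr h h' (show (Ex.var 81).Ok k from trivial)]
  simp only [and_true, true_and]
  omega

theorem legTime_le (hn : Net av n p (p * n)) {j μ : ℕ} (hc : c < n) (hj : j < n) :
    legTime av c p j μ ≤ 2 * (p * n) := by
  rw [legTime]
  split_ifs
  · have := hn.dl_le μ hc hj
    have := hn.dl_le (μ + dl av μ c j) hj hc
    omega
  · have := hn.dl_le (μ - p) hc hj
    omega

theorem eval_eLegTime (hw : Describes w o p n m s av) (hn : Net av n p (p * n))
    (hv : Base w p n m v) (hc : v.var 18 < n) (hj : v.var 50 < n) (hμ : v.var 51 < 2 * p) :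
    (eLegTime o).eval v = legTime av (v.var 18) p (v.var 50) (v.var 51) := by
  have h3 : v.var 3 = p := hv.var 3 (by omega)
  rw [eLegTime, eval_ite, legTime]
  simp only [holds_lt, Ex.eval, h3]
  split_ifs with h
  · have h1 := eval_eArr hw hn hv (x := 18) (y := 50) (t := .var 51) (by omega) (by omega) hc hj
      (by simp only [Ex.eval, bound]; omega)
    have hdl := hn.dl_le (v.var 51) hc hj
    rw [h1, eval_eArr hw hn (hv.setV (by omega)) (by omega) (by omega)] <;>
      simp only [Ex.eval, Env.setV_var, bound] <;> norm_num
    · simp only [DMVP.arr]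
      omega
    · exact hj
    · exact hc
    · simp only [DMVP.arr]
      omega
  · rw [eval_eArr hw hn (hv.setV (by omega)) (by omega) (by omega)] <;>
      simp only [Ex.eval, Env.setV_var, bound] <;> norm_num
    · simp only [DMVP.arr]
      omega
    · exact hc
    · exact hj
    · omega

theorem eval_eDst (hw : Describes w o p n m s av) (hn : Net av n p (p * n))
    (hv : Base w p n m v) (hc : v.var 18 < n) (hj : v.var 50 < n) (hμ : v.var 51 < 2 * p) :
    (eDst o).eval v = dst av (v.var 18) p (v.var 50) (v.var 51) := by
  have h3 : v.var 3 = p := hv.var 3 (by omega)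
  rw [eDst, eval_ite, dst]
  simp only [holds_lt, Ex.eval, h3]
  split_ifs with h
  · have hle := legTime_le hn (μ := v.var 51) hc hj
    rw [eval_eMod hw.period_pos (hv.setV (by omega))] <;>
      simp only [Env.setV_var, eval_eLegTime hw hn hv hc hj hμ, if_true, bound]
    omega
  · rfl

theorem eval_ePassage (hv : Base w p n m v) (h1 : v.var 57 < p) (h2 : v.var 58 ≤ p) :
    ePassage.eval v = passage p (n + 1) (v.var 57) (v.var 58) := by
  obtain ⟨T, hT, hrec⟩ := exists_table v 2 56 7
    (.ite (.var 56) (mul 5 (.get 2 (.sub (.var 56) (.const 1)))) (.const 1))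
    (.get 2 (.add (mul 4 (.var 57)) (.var 58)))
  have hpow : ∀ i < p * (p + 1), T i = (n + 1) ^ i := by
    intro i
    induction i with
    | zero =>
      intro hi
      obtain ⟨T', -, hTi⟩ := hrec 0 (by rw [hv.var 7 (by omega)]; exact hi)
      rw [hTi, eval_ite]
      simp [holds_var, Env.setV_var, Ex.eval]
    | succ i ih =>
      intro hi
      obtain ⟨T', hT', hTi⟩ := hrec (i + 1) (by rw [hv.var 7 (by omega)]; exact hi)
      have hv1 : Base w p n m ((v.setA 2 T').setV 56 (i + 1)) :=
        (hv.setA (by omega)).setV (by omega)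
      rw [hTi, eval_ite]
      simp only [holds_var, Env.setV_var, if_true]
      rw [if_pos (by omega), eval_mul (by omega), hv1.var 5 (by omega)]
      simp [Ex.eval, Env.setV_var, Env.setA_arr, hT', ih (by omega), bound, pow_succ, mul_comm]
  have hv1 : Base w p n m (v.setA 2 T) := hv.setA (by omega)
  rw [ePassage, hT, Ex.eval, Ex.eval, eval_mul (by omega), hv1.var 4 (by omega)]
  simp only [bound, Ex.eval, Env.setA_var, Env.setA_arr, if_true]
  rw [mul_comm, hpow _ (passage_index_lt h1 h2), passage]

theorem eval_eWeight (hw : Describes w o p n m s av) (hn : Net av n p (p * n))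
    (hv : Base w p n m v) (hc : v.var 18 < n) (hj : v.var 50 < n) (hμ : v.var 51 < 2 * p) :
    (eWeight o).eval v = weight av (v.var 18) p (n + 1) (v.var 50) (v.var 51) := by
  have hp := hw.period_pos
  have h3 : v.var 3 = p := hv.var 3 (by omega)
  rw [eWeight, Ex.eval, Ex.eval, Ex.eval, eval_eLegTime hw hn hv hc hj hμ]
  have hv1 : Base w p n m (v.setV 54 (legTime av (v.var 18) p (v.var 50) (v.var 51))) :=
    hv.setV (by omega)
  have hd := eval_eDst hw hn hv1 (by simpa [Env.setV_var] using hc)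
    (by simpa [Env.setV_var] using hj) (by simpa [Env.setV_var] using hμ)
  simp only [Env.setV_var] at hd
  norm_num at hd
  rw [hd]
  set v2 := (v.setV 54 (legTime av (v.var 18) p (v.var 50) (v.var 51))).setV 58
    (dst av (v.var 18) p (v.var 50) (v.var 51)) with hv2d
  have hv2 : Base w p n m v2 := hv1.setV (by omega)
  have hs : eSrc.eval v2 = src p (v.var 51) := by
    rw [eSrc, eval_ite, src]
    refine if_congr ?_ ?_ ?_ <;> simp [Ex.eval, hv2d, Env.setV_var, h3]
  rw [hs]
  have hv3 : Base w p n m (v2.setV 57 (src p (v.var 51))) := hv2.setV (by omega)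
  rw [Ex.eval, eval_ePassage hv3, eval_mul (by omega), hv3.var 6 (by omega), weight]
  · simp [Ex.eval, hv2d, Env.setV_var, bound]
  · simpa [hv2d, Env.setV_var] using src_lt hμ
  · simpa [hv2d, Env.setV_var] using dst_le hp _ _

theorem eval_eActive : eActive.Holds v ↔
    v.arr 3 (v.var 60) ≠ 0 ∧ v.var 60 ≠ v.var 18 ∧ v.var 60 ≠ v.var 61 := by
  simp [eActive, Ex.eval]
  simp [Holds, Ex.eval]

theorem jobs_succ (U : ℕ → ℕ) (c x i : ℕ) : jobs U c x (i + 1) =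
    if U i ≠ 0 ∧ i ≠ c ∧ i ≠ x then jobs U c x i ++ [i] else jobs U c x i := by
  simp only [jobs, List.range_succ, List.filter_append, List.filter_cons, List.filter_nil,
    decide_eq_true_eq]
  split_ifs <;> simp

theorem not_mem_jobs (U : ℕ → ℕ) (c x i : ℕ) : i ∉ jobs U c x i := by
  simp [jobs]

theorem nodup_jobs (U : ℕ → ℕ) (c x i : ℕ) : (jobs U c x i).Nodup :=
  List.nodup_range.filter _

theorem length_jobs_le (U : ℕ → ℕ) (c x i : ℕ) : (jobs U c x i).length ≤ i :=
  (List.length_filter_le _ _).trans_eq List.length_range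

/-- Correctness of the table of total weights: by induction on `i`, row `i` tells which weights the
legs of the active leaves below `i` can have. -/
theorem exists_assign (hw : Describes w o p n m s av) (hn : Net av n p (p * n))
    (hv : Base w p n m v) (hc : v.var 18 < n) (f : Ex) :
    ∃ T : ℕ → ℕ, (eAssign o f).eval v = f.eval (v.setA 4 T) ∧ ∀ i < n + 1,
      ∀ C < bound p n m 11, T (bound p n m 11 * i + C) ≠ 0 ↔
        Assignable av (v.var 18) p (n + 1) (jobs (v.arr 3) (v.var 18) (v.var 61) i) C := by
  obtain ⟨T, hT, hrec⟩ := exists_table₂ (v := v) (a := 4) (x := 62) (size := 12) (col := 11)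
    (rows := 5) (q := 63) (y := 64) (.ite (.var 63)
      (.letv 65 (.sub (.var 63) (.const 1))
        (.ite (.letv 60 (.var 65) eActive)
          (.sum 51 15 (.letv 50 (.var 65) (.letv 66 (eWeight o) (and (le (.var 66) (.var 64))
            (.get 4 (.add (mul 11 (.var 65)) (.sub (.var 64) (.var 66))))))))
          (.get 4 (.add (mul 11 (.var 65)) (.var 64)))))
      (eq (.var 64) (.const 0))) f (by omega) (by omega) (by omega) (by omega)
    (by omega) (Or.inr (by simp only [hv.var _ (show 12 < 18 by omega),
      hv.var _ (show 11 < 18 by omega), hv.var _ (show 5 < 18 by omega), bound, mul_comm]))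
  have h12 : bound p n m 12 = bound p n m 11 * (n + 1) := mul_comm _ _
  simp only [hv.var _ (show 12 < 18 by omega), hv.var _ (show 11 < 18 by omega), h12] at hrec
  refine ⟨T, hT, fun i => ?_⟩
  induction i with
  | zero =>
    intro _ C hC
    obtain ⟨T', hT', hTi⟩ := hrec 0 (Nat.mul_le_mul_left _ (by omega)) C hC
    rw [hTi, ← Holds]
    simp only [holds_ite, holds_var]
    simp [Env.setV_var, Ex.eval, jobs, assignable_nil]
  | succ i ih =>
    intro hi C hC
    have ih := ih (by omega)
    obtain ⟨T', hT', hTi⟩ := hrec (i + 1) (Nat.mul_le_mul_left _ hi) C hC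
    rw [hTi, ← Holds]
    set v1 := ((((v.setA 4 T').setV 62 (bound p n m 11 * (i + 1) + C)).setV 63 (i + 1)).setV 64 C)
      with hv1d
    have hv1 : Base w p n m v1 :=
      (((hv.setA (by omega)).setV (by omega)).setV (by omega)).setV (by omega)
    have e63 : v1.var 63 = i + 1 := by simp [hv1d, Env.setV_var]
    have hsub : (Ex.sub (.var 63) (.const 1)).eval v1 = i := by simp [Ex.eval, e63]
    simp only [holds_ite, holds_var, e63, ne_eq, Nat.add_eq_zero_iff, one_ne_zero, and_false,
      not_false_eq_true, if_true, holds_letv, hsub]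
    set v2 := v1.setV 65 i with hv2d
    have hv2 : Base w p n m v2 := hv1.setV (by omega)
    have a4 : v2.arr 4 = T' := by simp [hv2d, hv1d, Env.setA_arr]
    have a3 : v2.arr 3 = v.arr 3 := by simp [hv2d, hv1d, Env.setA_arr]
    have e65 : v2.var 65 = i := by simp [hv2d, Env.setV_var]
    have e64 : v2.var 64 = C := by simp [hv2d, hv1d, Env.setV_var]
    have e18 : v2.var 18 = v.var 18 := by simp [hv2d, hv1d, Env.setV_var]
    have e61 : v2.var 61 = v.var 61 := by simp [hv2d, hv1d, Env.setV_var]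
    have hact : eActive.Holds (v2.setV 60 ((Ex.var 65).eval v2)) ↔
        v.arr 3 i ≠ 0 ∧ i ≠ v.var 18 ∧ i ≠ v.var 61 := by
      rw [eval_eActive]
      simp [Env.setV_var, Ex.eval, a3, e65, e18, e61]
    rw [jobs_succ]
    by_cases hA : v.arr 3 i ≠ 0 ∧ i ≠ v.var 18 ∧ i ≠ v.var 61
    · rw [if_pos (hact.2 hA), if_pos hA, assignable_append (not_mem_jobs _ _ _ _), holds_sum,
        hv2.var 15 (by omega)]
      refine exists_congr fun μ => and_congr_right fun hμ => ?_
      simp only [bound] at hμ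
      rw [holds_letv, holds_letv]
      set v3 := (v2.setV 51 μ).setV 50 ((Ex.var 65).eval (v2.setV 51 μ)) with hv3d
      have hv3 : Base w p n m v3 := (hv2.setV (by omega)).setV (by omega)
      have e50 : v3.var 50 = i := by simp [hv3d, Env.setV_var, Ex.eval, e65]
      have e51 : v3.var 51 = μ := by simp [hv3d, Env.setV_var]
      have f18 : v3.var 18 = v.var 18 := by simp [hv3d, Env.setV_var, e18]
      rw [eval_eWeight hw hn hv3 (by rw [f18]; exact hc) (by rw [e50]; omega)
        (by rw [e51]; exact hμ), e50, e51, f18]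
      set W := weight av (v.var 18) p (n + 1) i μ with hW
      have hv4 : Base w p n m (v3.setV 66 W) := hv3.setV (by omega)
      rw [holds_and, holds_le]
      have e64' : (v3.setV 66 W).var 64 = C := by simp [hv3d, Env.setV_var, e64]
      have e65' : (v3.setV 66 W).var 65 = i := by simp [hv3d, Env.setV_var, e65]
      have e66' : (v3.setV 66 W).var 66 = W := by simp [Env.setV_var]
      have a4' : (v3.setV 66 W).arr 4 = T' := by simp [hv3d, a4]
      rw [Ex.eval, Ex.eval, e64', e66']
      refine and_congr_right fun hWC => ?_
      rw [← ih (C - W) (by omega), ← hT' i (by omega) (C - W) (by omega), Holds, Ex.eval, Ex.eval,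
        eval_mul (by omega), hv4.var 11 (by omega), Ex.eval, Ex.eval, Ex.eval, Ex.eval, a4', e64',
        e65', e66']
    · rw [if_neg (fun h => hA (hact.1 h)), if_neg hA, ← ih C hC, ← hT' i (by omega) C hC, Holds,
        Ex.eval, Ex.eval, eval_mul (by omega), hv2.var 11 (by omega), Ex.eval, Ex.eval, a4, e64,
        e65]

/-- Correctness of the table of walks: row `ℓ` tells which weights walks of length `ℓ` can have. -/
theorem exists_walkTable (hv : Base w p n m v) (f : Ex) :
    ∃ T : ℕ → ℕ, (eWalk f).eval v = f.eval (v.setA 5 T) ∧ ∀ ℓ < n + 1,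
      ∀ C < bound p n m 6, ∀ r < p + 1, T (bound p n m 13 * ℓ + ((p + 1) * C + r)) ≠ 0 ↔
        Walkable p (n + 1) ℓ C r := by
  obtain ⟨T, hT, hrec⟩ := exists_table₂ (v := v) (a := 5) (x := 67) (size := 14) (col := 13)
    (rows := 5) (q := 68) (y := 69) (.letv 70 (div 69 4 6) (.letv 57 (.sub (.var 69)
      (mul 4 (.var 70))) (.ite (.var 68)
        (and (lt (.var 57) (.var 3)) (.sum 58 4 (.letv 71 ePassage (and (le (.var 71) (.var 70))
          (.get 5 (.add (mul 13 (.sub (.var 68) (.const 1)))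
            (.add (mul 4 (.sub (.var 70) (.var 71))) (.var 58))))))))
        (and (eq (.var 57) (.var 3)) (eq (.var 70) (.const 0))))))
    f (by omega) (by omega) (by omega) (by omega)
    (by omega) (Or.inr (by simp only [hv.var _ (show 14 < 18 by omega),
      hv.var _ (show 13 < 18 by omega), hv.var _ (show 5 < 18 by omega), bound]
                           ring))
  have h14 : bound p n m 14 = bound p n m 13 * (n + 1) := mul_comm _ _
  have h13 : bound p n m 13 = (p + 1) * bound p n m 6 := rfl
  simp only [hv.var _ (show 14 < 18 by omega), hv.var _ (show 13 < 18 by omega), h14] at hrec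
  refine ⟨T, hT, fun ℓ => ?_⟩
  have entry : ∀ ℓ < n + 1, ∀ C < bound p n m 6, ∀ r < p + 1,
      T (bound p n m 13 * ℓ + ((p + 1) * C + r)) ≠ 0 ↔
      if ℓ = 0 then r = p ∧ C = 0 else r < p ∧ ∃ r' < p + 1, passage p (n + 1) r r' ≤ C ∧
        T (bound p n m 13 * (ℓ - 1) + ((p + 1) * (C - passage p (n + 1) r r') + r')) ≠ 0 := by
    intro ℓ hℓ C hC r hr
    have hj : (p + 1) * C + r < bound p n m 13 := h13 ▸ index_lt hC hr
    obtain ⟨T', hT', hTi⟩ := hrec ℓ (Nat.mul_le_mul_left _ hℓ) _ hj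
    rw [hTi, ← Holds, holds_letv]
    set v1 := ((((v.setA 5 T').setV 67 (bound p n m 13 * ℓ + ((p + 1) * C + r))).setV 68 ℓ).setV 69
      ((p + 1) * C + r)) with hv1d
    have hv1 : Base w p n m v1 :=
      (((hv.setA (by omega)).setV (by omega)).setV (by omega)).setV (by omega)
    have e69 : v1.var 69 = (p + 1) * C + r := by simp [hv1d, Env.setV_var]
    have h4 : v1.var 4 = p + 1 := hv1.var 4 (by omega)
    have hdiv : (div 69 4 6).eval v1 = C := by
      rw [eval_div (by omega) (by omega) (by omega)] <;> rw [h4, e69, index_div hr]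
      rw [hv1.var 6 (by omega)]
      exact hC.le
    rw [hdiv, holds_letv]
    have hv2 : Base w p n m (v1.setV 70 C) := hv1.setV (by omega)
    have hsub : (Ex.sub (.var 69) (mul 4 (.var 70))).eval (v1.setV 70 C) = r := by
      simp [Ex.eval, hv2.var 4 (by omega), bound, Env.setV_var, e69]
    rw [hsub]
    set v3 := (v1.setV 70 C).setV 57 r with hv3d
    have hv3 : Base w p n m v3 := hv2.setV (by omega)
    have e68 : v3.var 68 = ℓ := by simp [hv3d, hv1d, Env.setV_var]
    have e57 : v3.var 57 = r := by simp [hv3d, Env.setV_var]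
    have e70 : v3.var 70 = C := by simp [hv3d, Env.setV_var]
    have e3 : v3.var 3 = p := hv3.var 3 (by omega)
    have a5 : v3.arr 5 = T' := by simp [hv3d, hv1d, Env.setA_arr]
    simp only [holds_ite, holds_var, e68]
    by_cases hℓ0 : ℓ = 0
    · simp [hℓ0, Ex.eval, e57, e70, e3]
    · simp only [hℓ0, ne_eq, not_false_eq_true, if_true, if_false]
      rw [holds_and, holds_lt, Ex.eval, Ex.eval, e57, e3]
      refine and_congr_right fun hrp => ?_
      rw [holds_sum, hv3.var 4 (by omega)]
      refine exists_congr fun r' => and_congr_right fun hr' => ?_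
      simp only [bound] at hr'
      have hv4 : Base w p n m (v3.setV 58 r') := hv3.setV (by omega)
      rw [holds_letv, eval_ePassage hv4 (by simpa [Env.setV_var, e57] using hrp)
        (by simpa [Env.setV_var] using Nat.lt_succ_iff.1 hr')]
      have g57 : (v3.setV 58 r').var 57 = r := by simp [Env.setV_var, e57]
      have g58 : (v3.setV 58 r').var 58 = r' := by simp [Env.setV_var]
      rw [g57, g58]
      set P := passage p (n + 1) r r' with hP
      have hv5 : Base w p n m ((v3.setV 58 r').setV 71 P) := hv4.setV (by omega)
      set v5 := (v3.setV 58 r').setV 71 P with hv5d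
      have i70 : v5.var 70 = C := by simp [hv5d, Env.setV_var, e70]
      have i71 : v5.var 71 = P := by simp [hv5d, Env.setV_var]
      have i68 : v5.var 68 = ℓ := by simp [hv5d, Env.setV_var, e68]
      have i58 : v5.var 58 = r' := by simp [hv5d, Env.setV_var]
      have b5 : v5.arr 5 = T' := by simp [hv5d, a5]
      rw [holds_and, holds_le, Ex.eval, Ex.eval, i70, i71]
      refine and_congr_right fun hPC => ?_
      rw [← ne_eq, ← hT' (ℓ - 1) (by omega) _ (h13 ▸ index_lt (show C - P < _ by omega) hr'), Holds,
        Ex.eval, Ex.eval, eval_mul (by omega), hv5.var 13 (by omega), Ex.eval,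
        eval_mul (by omega), hv5.var 4 (by omega)]
      simp only [Ex.eval, b5, i68, i58, i70, i71]
      rfl
  induction ℓ with
  | zero =>
    intro hℓ C hC r hr
    rw [entry 0 hℓ C hC r hr, if_pos rfl, walkable_zero]
  | succ ℓ ih =>
    intro hℓ C hC r hr
    rw [entry (ℓ + 1) hℓ C hC r hr, if_neg (by omega), walkable_succ, Nat.add_sub_cancel]
    refine and_congr_right fun _ => exists_congr fun r' => and_congr_right fun hr' =>
      and_congr_right fun hP => ?_
    exact ih (by omega) _ (by omega) _ hr'

/-- The set of leaves that have to be visited, apart from `x`. -/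
def activeSet (U : ℕ → ℕ) (c x n : ℕ) : Finset ℕ :=
  (Finset.range n).filter fun j => U j ≠ 0 ∧ j ≠ c ∧ j ≠ x

theorem toFinset_jobs (U : ℕ → ℕ) (c x n : ℕ) : (jobs U c x n).toFinset = activeSet U c x n := by
  ext j
  simp [jobs, activeSet]

theorem length_jobs (U : ℕ → ℕ) (c x n : ℕ) :
    (jobs U c x n).length = (activeSet U c x n).card := by
  rw [← toFinset_jobs, List.toFinset_card_of_nodup (nodup_jobs _ _ _ _)]

theorem eval_count_eActive (hv : Base w p n m v) : (count 60 0 eActive).eval v =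
    (activeSet (v.arr 3) (v.var 18) (v.var 61) n).card := by
  rw [eval_count, hv.var 0 (by omega), activeSet]
  congr 1
  refine Finset.filter_congr fun j _ => ?_
  rw [eval_eActive]
  simp [Env.setV_var]

/-- Correctness of the decision whether a tour exists, by `Net.hasTour_iff`. -/
theorem eval_eTour (hw : Describes w o p n m s av) (hn : Net av n p (p * n))
    (hv : Base w p n m v) (hc : v.var 18 < n) (h72 : v.var 72 ≤ bound p n m 16)
    (h73 : v.var 73 < bound p n m 10) : (eTour o).Holds v ↔
      HasTour av (v.var 18) (activeSet (v.arr 3) (v.var 18) (v.var 61) n)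
        (v.var 72) (v.var 73) := by
  have hp := hw.period_pos
  rw [eTour, holds_letv, eval_count_eActive hv, ← length_jobs, ← toFinset_jobs]
  set js := jobs (v.arr 3) (v.var 18) (v.var 61) n with hjs
  have hv1 : Base w p n m (v.setV 74 js.length) := hv.setV (by omega)
  simp only [holds_ite, holds_var, Env.setV_var, if_true]
  by_cases hne : js = []
  · simp [hne, Ex.eval, Env.setV_var, HasTour, tour]
  have hlen : js.length ≠ 0 := by simpa using hne
  have hlen' : js.length ≤ n := length_jobs_le _ _ _ _
  rw [if_pos hlen, hn.hasTour_iff hp (nodup_jobs _ _ _ _) hne (Nat.lt_succ_of_le hlen'),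
    holds_letv, holds_letv]
  set v2 := (v.setV 74 js.length).setV 39 ((Ex.var 72).eval (v.setV 74 js.length)) with hv2d
  have e39 : v2.var 39 = v.var 72 := by simp [hv2d, Env.setV_var, Ex.eval]
  have hv2 : Base w p n m v2 := hv1.setV (by omega)
  rw [eval_eMod hp hv2 (by rw [e39]; exact h72), e39]
  have hv3 : Base w p n m (v2.setV 77 (v.var 72 % p)) := hv2.setV (by omega)
  set v3 := v2.setV 77 (v.var 72 % p) with hv3d
  have e18 : v3.var 18 = v.var 18 := by simp [hv3d, hv2d, Env.setV_var]
  have e61 : v3.var 61 = v.var 61 := by simp [hv3d, hv2d, Env.setV_var]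
  have e72 : v3.var 72 = v.var 72 := by simp [hv3d, hv2d, Env.setV_var]
  have e73 : v3.var 73 = v.var 73 := by simp [hv3d, hv2d, Env.setV_var]
  have e74 : v3.var 74 = js.length := by simp [hv3d, hv2d, Env.setV_var]
  have e77 : v3.var 77 = v.var 72 % p := by simp [hv3d, Env.setV_var]
  have a3 : v3.arr 3 = v.arr 3 := by simp [hv3d, hv2d]
  set body : Ex := .sum 75 6 (.sum 76 10
        (and (le (.add (.var 72) (.var 76)) (.var 73))
          (and (.get 4 (.add (mul 11 (.var 0)) (.add (mul 6 (.var 76)) (.var 75))))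
            (.get 5 (.add (mul 13 (.var 74)) (.add (mul 4 (.var 75)) (.var 77))))))) with hbody
  obtain ⟨T, hT, hTA⟩ := exists_assign hw hn hv3 (by rw [e18]; exact hc) (eWalk body)
  have hv4 : Base w p n m (v3.setA 4 T) := hv3.setA (by omega)
  obtain ⟨T₂, hT₂, hTW⟩ := exists_walkTable hv4 body
  have hv5 : Base w p n m ((v3.setA 4 T).setA 5 T₂) := hv4.setA (by omega)
  rw [Holds, hT, hT₂, ← Holds, hbody, holds_sum, hv5.var 6 (by omega)]
  refine exists_congr fun C => and_congr_right fun hC => ?_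
  have hv6 : Base w p n m (((v3.setA 4 T).setA 5 T₂).setV 75 C) := hv5.setV (by omega)
  rw [holds_sum, hv6.var 10 (by omega)]
  have key : ∀ d < bound p n m 10, (and (le (.add (.var 72) (.var 76)) (.var 73))
          (and (.get 4 (.add (mul 11 (.var 0)) (.add (mul 6 (.var 76)) (.var 75))))
            (.get 5 (.add (mul 13 (.var 74)) (.add (mul 4 (.var 75)) (.var 77)))))).Holds
          ((((v3.setA 4 T).setA 5 T₂).setV 75 C).setV 76 d) ↔ v.var 72 + d ≤ v.var 73 ∧
            Assignable av (v.var 18) p (n + 1) js (C + (n + 1) ^ (p * (p + 1)) * d) ∧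
              Walkable p (n + 1) js.length C (v.var 72 % p) := by
    intro d hd
    have hv7 : Base w p n m ((((v3.setA 4 T).setA 5 T₂).setV 75 C).setV 76 d) :=
      hv6.setV (by omega)
    set v7 := (((v3.setA 4 T).setA 5 T₂).setV 75 C).setV 76 d with hv7d
    have i72 : v7.var 72 = v.var 72 := by simp [hv7d, Env.setV_var, e72]
    have i73 : v7.var 73 = v.var 73 := by simp [hv7d, Env.setV_var, e73]
    have i74 : v7.var 74 = js.length := by simp [hv7d, Env.setV_var, e74]
    have i75 : v7.var 75 = C := by simp [hv7d, Env.setV_var]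
    have i76 : v7.var 76 = d := by simp [hv7d, Env.setV_var]
    have i77 : v7.var 77 = v.var 72 % p := by simp [hv7d, Env.setV_var, e77]
    have b4 : v7.arr 4 = T := by simp [hv7d, Env.setA_arr]
    have b5 : v7.arr 5 = T₂ := by simp [hv7d, Env.setA_arr]
    rw [holds_and, holds_and, holds_le, Holds, Holds]
    simp only [Ex.eval, eval_mul (show 11 < 30 by omega), eval_mul (show 6 < 30 by omega),
      eval_mul (show 13 < 30 by omega), eval_mul (show 4 < 30 by omega),
      hv7.var 0 (by omega), hv7.var 4 (by omega), hv7.var 6 (by omega), hv7.var 11 (by omega),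
      hv7.var 13 (by omega), i72, i73, i74, i75, i76, i77, b4, b5]
    rw [show bound p n m 0 = n from rfl, show bound p n m 4 = p + 1 from rfl,
      hTA n (by omega) _ (index_lt (a := bound p n m 6) (D := bound p n m 10) hd hC),
      hTW _ (Nat.lt_succ_of_le hlen') _ hC _ ((Nat.mod_lt _ hp).trans (Nat.lt_succ_self p)),
      a3, e18, e61, ← hjs, add_comm C]
    rfl
  constructor
  · rintro ⟨d, hd, h⟩
    exact ⟨d, (key d hd).1 h⟩
  · rintro ⟨d, h⟩
    have hd : d < bound p n m 10 := by omega
    exact ⟨d, hd, (key d hd).2 h⟩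

/-- Correctness of the decision whether the targets can be visited in time, by `Net.cov_iff`. -/
theorem eval_eCover (hw : Describes w o p n m s av) (hn : Net av n p (p * n))
    (hv : Base w p n m v) (hc : v.var 18 < n) {L : Set ℕ} (hL : Sep av (v.var 18) L)
    (hU : ∀ x < n, v.arr 3 x ≠ 0 → x ≠ v.var 18 → x ∈ L) (h78 : v.var 78 < n)
    (h79 : v.var 79 ≤ bound p n m 10) (h73 : v.var 73 < bound p n m 10) :
    (eCover o).Holds v ↔
      Cov av (v.var 78) (v.var 79) {x | x < n ∧ v.arr 3 x ≠ 0} (v.var 73) := by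
  set U := v.arr 3 with hUd
  set c := v.var 18 with hcd
  have herase : ∀ x, (activeSet U c n n).erase x = activeSet U c x n := by
    intro x
    ext j
    simp only [activeSet, Finset.mem_erase, Finset.mem_filter, Finset.mem_range]
    constructor
    · tauto
    · rintro ⟨h1, h2, h3, h4⟩
      exact ⟨h4, h1, h2, h3, h1.ne⟩
  have hb : bound p n m 16 = bound p n m 10 + 2 * (p * n + 1) + p := rfl
  rw [hn.cov_iff (U := {x | x < n ∧ U x ≠ 0}) (S := activeSet U c n n) hc hL (fun x hx => ?_)
    (fun x => ?_) h78]
  · rw [eCover, holds_letv, Ex.eval, hv.var 0 (by omega), show bound p n m 0 = n from rfl]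
    have hv1 : Base w p n m (v.setV 61 n) := hv.setV (by omega)
    set v1 := v.setV 61 n with hv1d
    have e18 : v1.var 18 = c := by simp [hv1d, Env.setV_var, hcd]
    have e61 : v1.var 61 = n := by simp [hv1d, Env.setV_var]
    have e73 : v1.var 73 = v.var 73 := by simp [hv1d, Env.setV_var]
    have e78 : v1.var 78 = v.var 78 := by simp [hv1d, Env.setV_var]
    have e79 : v1.var 79 = v.var 79 := by simp [hv1d, Env.setV_var]
    have a3 : v1.arr 3 = U := rfl
    have hact : ∀ x < n, eActive.Holds ((v1.setV 80 x).setV 60 ((Ex.var 80).eval (v1.setV 80 x))) ↔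
        x ∈ activeSet U c n n := by
      intro x hx
      rw [eval_eActive]
      simp [Env.setV_var, Ex.eval, a3, e18, e61, activeSet, hx]
    have harr : ∀ x < n, (eArr o 78 80 (.var 79)).eval (v1.setV 80 x)
        = arr av (v.var 78) x (v.var 79) := by
      intro x hx
      rw [eval_eArr hw hn (hv1.setV (by omega)) (by omega) (by omega)] <;>
        simp [Env.setV_var, Ex.eval, e78, e79, hx, h78]
      omega
    rw [holds_add, holds_add, holds_add, holds_letv, holds_sum, hv1.var 0 (by omega),
      show bound p n m 0 = n from rfl]
    refine or_congr ?_ (or_congr ?_ (or_congr ?_ ?_))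
    · rw [eval_eArr hw hn hv1 (by omega) (by omega) (by rw [e78]; exact h78)
        (by rw [e18]; exact hc) (by rw [Ex.eval, e79]; omega), e78, e18, Ex.eval, e79]
      have hdl := hn.dl_le (v.var 79) h78 hc
      rw [eval_eTour hw hn (hv1.setV (by omega))] <;> simp [Env.setV_var, e18, e61, e73, a3, hc]
      · simp only [arr]
        omega
      · exact h73
    · refine exists_congr fun x => ?_
      rw [holds_and]
      have key : x < n → ((Ex.letv 72 (.letv 81 (eArr o 78 80 (.var 79)) (eArr o 80 18 (.var 81)))
          (.letv 61 (.var 80) (eTour o))).Holds (v1.setV 80 x) ↔ HasTour av c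
            ((activeSet U c n n).erase x) (arr av x c (arr av (v.var 78) x (v.var 79)))
              (v.var 73)) := by
        intro hx
        have hdl := hn.dl_le (v.var 79) h78 hx
        have hdl' := hn.dl_le (arr av (v.var 78) x (v.var 79)) hx hc
        have hv2 : Base w p n m (v1.setV 80 x) := hv1.setV (by omega)
        have hle : arr av (v.var 78) x (v.var 79) ≤ bound p n m 10 + (p * n) := by
          simp only [arr]
          omega
        have hle' : arr av x c (arr av (v.var 78) x (v.var 79)) ≤ bound p n m 16 := by
          rw [arr]
          omega
        rw [holds_letv, Ex.eval, harr x hx, eval_eArr hw hn (hv2.setV (by omega)) (by omega)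
          (by omega)] <;> simp only [Ex.eval, Env.setV_var] <;> norm_num
        · rw [e18, eval_eTour hw hn ((hv2.setV (by omega)).setV (by omega))] <;>
            simp [Env.setV_var, Ex.eval, e18, e73, a3, herase, hc, hle', h73]
        · exact hx
        · rw [e18]
          exact hc
        · omega
      constructor
      · rintro ⟨hx, h1, h2⟩
        exact ⟨(hact x hx).1 h1, (key hx).1 h2⟩
      · rintro ⟨h1, h2⟩
        have hx : x < n := Finset.mem_range.1 (Finset.mem_filter.1 h1).1
        exact ⟨hx, (hact x hx).2 h1, (key hx).2 h2⟩
    · rw [holds_and, holds_not, holds_sum, hv1.var 0 (by omega)]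
      refine and_congr ?_ (exists_congr fun x => ?_)
      · simp [Holds, Ex.eval, a3, e18, hc]
      · rw [holds_and, holds_and, holds_eq, holds_le]
        have hv2 : Base w p n m (v1.setV 80 x) := hv1.setV (by omega)
        rw [eval_count_eActive hv2]
        constructor
        · rintro ⟨hx, h1, h2, h3⟩
          have hxS := (hact x hx).1 h1
          rw [harr x hx] at h3
          simp only [Env.setV_arr, Env.setV_var, a3] at h2
          norm_num [e18, e61, Ex.eval] at h2
          obtain ⟨y, hy⟩ := Finset.card_eq_one.1 h2
          refine ⟨hxS, ?_, ?_⟩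
          · rw [hy] at hxS ⊢
            rw [Finset.mem_singleton.1 hxS]
          · simpa [Ex.eval, Env.setV_var, e73] using h3
        · rintro ⟨h1, h2, h3⟩
          have hx : x < n := Finset.mem_range.1 (Finset.mem_filter.1 h1).1
          refine ⟨hx, (hact x hx).2 h1, ?_, ?_⟩
          · simp only [Env.setV_arr, Env.setV_var, a3]
            norm_num [e18, e61, Ex.eval]
            rw [h2, Finset.card_singleton]
          · rw [harr x hx]
            simpa [Ex.eval, Env.setV_var, e73] using h3
    · rw [holds_and, holds_not, holds_sum, holds_le, hv1.var 0 (by omega), Ex.eval, Ex.eval, e79,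
        e73, show bound p n m 0 = n from rfl]
      refine and_congr ?_ Iff.rfl
      rw [Set.eq_empty_iff_forall_notMem]
      simp [Holds, Ex.eval, Env.setV_var, a3]
  · simp only [activeSet, Finset.mem_filter, Finset.mem_range] at hx
    exact ⟨hU x hx.1 hx.2.1 hx.2.2.1, hx.1⟩
  · simp only [activeSet, Finset.mem_filter, Finset.mem_range, Set.mem_ofPred_eq]
    constructor
    · tauto
    · rintro ⟨⟨h1, h2⟩, h3⟩
      exact ⟨h1, h2, h3, h1.ne⟩

end

end DMVP

namespace DMVP

open RAM RAM.Ex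

/-! ### Optimal routes -/

/-- The positions of an agent that starts at `s` and moves step by step to the first vertex from
which it can still visit the rest of `X` by time `T`, with the sets of vertices visited so far. -/
noncomputable def route (av : ℕ → ℕ → ℕ → Prop) (X : Set ℕ) (T s : ℕ) : ℕ → ℕ × Set ℕ
  | 0 => (s, {s})
  | i + 1 =>
    let x := sInf {x | (x = (route av X T s i).1 ∨ av i (route av X T s i).1 x) ∧
      Cov av x (i + 1) (X \ insert x (route av X T s i).2) T}
    (x, insert x (route av X T s i).2)

section

variable {av : ℕ → ℕ → ℕ → Prop} {X : Set ℕ} {T s : ℕ}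

theorem mem_route_iff {i x : ℕ} :
    x ∈ (route av X T s i).2 ↔ ∃ j ≤ i, (route av X T s j).1 = x := by
  induction i with
  | zero => simp [route, eq_comm]
  | succ i ih =>
    rw [route, Set.mem_insert_iff, ih]
    constructor
    · rintro (h | ⟨j, h1, h2⟩)
      · exact ⟨i + 1, le_rfl, h.symm⟩
      · exact ⟨j, by omega, h2⟩
    · rintro ⟨j, h1, h2⟩
      rcases Nat.le_succ_iff.1 h1 with h1 | rfl
      · exact Or.inr ⟨j, h1, h2⟩
      · exact Or.inl h2.symm

/-- As long as time remains, some next step keeps the rest of `X` within reach. -/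
theorem route_spec (h : Cov av s 0 (X \ {s}) T) {i : ℕ} (hi : i ≤ T) :
    Cov av (route av X T s i).1 i (X \ (route av X T s i).2) T ∧ (i < T → ∃ x,
      (x = (route av X T s i).1 ∨ av i (route av X T s i).1 x) ∧
        Cov av x (i + 1) (X \ insert x (route av X T s i).2) T) := by
  have step : ∀ i, i < T → Cov av (route av X T s i).1 i (X \ (route av X T s i).2) T → ∃ x,
      (x = (route av X T s i).1 ∨ av i (route av X T s i).1 x) ∧
        Cov av x (i + 1) (X \ insert x (route av X T s i).2) T := by
    intro i hi h
    obtain ⟨x, h1, h2⟩ := h.step hi fun h => h.2 (mem_route_iff.2 ⟨i, le_rfl, rfl⟩)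
    refine ⟨x, h1, h2.subset ?_⟩
    intro y hy
    exact ⟨⟨hy.1, fun h => hy.2 (Or.inr h)⟩, fun h => hy.2 (Or.inl h)⟩
  suffices h' : Cov av (route av X T s i).1 i (X \ (route av X T s i).2) T from
    ⟨h', fun hi => step i hi h'⟩
  induction i with
  | zero => exact h
  | succ i ih =>
    have := Nat.sInf_mem (step i hi (ih (by omega)))
    exact this.2

theorem route_succ (h : Cov av s 0 (X \ {s}) T) {i : ℕ} (hi : i < T) :
    (route av X T s (i + 1)).1 = (route av X T s i).1 ∨
      av i (route av X T s i).1 (route av X T s (i + 1)).1 :=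
  (Nat.sInf_mem ((route_spec h hi.le).2 hi)).1

/-- At the end of the route there is no time left, so nothing remains to be visited. -/
theorem route_visits (h : Cov av s 0 (X \ {s}) T) {x : ℕ} (hx : x ∈ X) :
    ∃ t ≤ T, (route av X T s t).1 = x := by
  have h1 := (route_spec h le_rfl).1.eq_empty fun h => h.2 (mem_route_iff.2 ⟨T, le_rfl, rfl⟩)
  by_contra hno
  exact Set.notMem_empty x (h1 ▸ ⟨hx, fun hm => hno (mem_route_iff.1 hm)⟩)

theorem route_lt {n p H : ℕ} (hn : Net av n p H) (hs : s < n) (h : Cov av s 0 (X \ {s}) T) {i : ℕ}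
    (hi : i ≤ T) : (route av X T s i).1 < n := by
  induction i with
  | zero => exact hs
  | succ i ih =>
    rcases route_succ h hi with h' | h'
    · rw [h']
      exact ih (by omega)
    · exact (hn.lt h').2

end

/-- Counting the numbers below which a property does not occur finds its first occurrence. -/
theorem card_filter_not_exists_le {n : ℕ} {Q : ℕ → Prop}
    [DecidablePred fun i => ¬ ∃ x < n, x ≤ i ∧ Q x]
    (hQ : ∀ x, Q x → x < n) (hne : ∃ x, Q x) :
    ((Finset.range n).filter fun i => ¬ ∃ x < n, x ≤ i ∧ Q x).card = sInf {x | Q x} := by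
  have hmem : Q (sInf {x | Q x}) := Nat.sInf_mem hne
  rw [show (Finset.range n).filter (fun i => ¬ ∃ x < n, x ≤ i ∧ Q x)
    = Finset.range (sInf {x | Q x}) from ?_, Finset.card_range]
  ext i
  rw [Finset.mem_filter, Finset.mem_range, Finset.mem_range]
  constructor
  · rintro ⟨h1, h2⟩
    by_contra h
    exact h2 ⟨_, hQ _ hmem, by omega, hmem⟩
  · intro h
    refine ⟨h.trans (hQ _ hmem), ?_⟩
    rintro ⟨x, -, h1, h2⟩
    have := Nat.sInf_le (s := {x | Q x}) h2
    omega

/-! ### The route as an expression -/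

/-- The number of vertices to which there is an edge from `x` at some time. -/
noncomputable def deg (av : ℕ → ℕ → ℕ → Prop) (n p x : ℕ) : ℕ := by
  classical
  exact ((Finset.range n).filter fun y => ∃ r < p, av r x y).card

/-- The center: the vertex of degree greater than two, if there is exactly one, and `s`, if there is
none. -/
noncomputable def center (av : ℕ → ℕ → ℕ → Prop) (n p s : ℕ) : ℕ := by
  classical
  exact if ∃ x < n, 2 < deg av n p x then ∑ x ∈ Finset.range n, if 2 < deg av n p x then x else 0
    else s

/-- The center `c` and the leaves; an agent that visits these visits all vertices. -/
def targets (av : ℕ → ℕ → ℕ → Prop) (n p c : ℕ) : Set ℕ :=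
  {x | x < n ∧ (x = c ∨ deg av n p x ≤ 1)}

/-- The degree of the vertex in variable 82. -/
def eDeg (o : ℕ) : Ex :=
  count 83 0 (.sum 33 3 (.letv 36 (.var 82) (.letv 37 (.var 83) (eAvail o))))

/-- The center of the spider, as an expression. -/
def eCenter (o : ℕ) : Ex :=
  .ite (.sum 82 0 (lt (.const 2) (eDeg o)))
    (.sum 82 0 (.ite (lt (.const 2) (eDeg o)) (.var 82) (.const 0))) (.get 0 (.const (o + 1)))

/-- All vertices can be reached from the starting vertex. -/
def eFeasible (o : ℕ) : Ex :=
  .letv 40 (.get 0 (.const (o + 1))) (.letv 42 (.const 0) (eReach o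
    (eq (count 90 0 (.get 1 (.add (mul 0 (.sub (.var 8) (.const 1))) (.var 90)))) (.var 0))))

/-- The agent can visit the targets except for those for which `g` is true when they are in
variable 84. -/
def eCoverExcept (o : ℕ) (g : Ex) : Ex :=
  .tab 3 84 0 (and (.letv 82 (.var 84) (.add (eq (.var 82) (.var 18)) (le (eDeg o) (.const 1))))
    (not g)) (eCover o)

/-- The least time by which all vertices can be visited, if variable 19 tells that this is
possible. -/
def eOptimum (o : ℕ) : Ex :=
  .ite (.var 19) (count 73 10 (not (.letv 78 (.get 0 (.const (o + 1))) (.letv 79 (.const 0)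
    (eCoverExcept o (eq (.var 84) (.var 78))))))) (.const 0)

/-- The agent can move to the vertex in variable 87 at the time in variable 86, and visit the
remaining targets from there by the time in variable 20. Array 6 contains the positions up to the
time in variable 86, which is the predecessor of variable 85. -/
def eStep (o : ℕ) : Ex :=
  and (.add (eq (.var 87) (.get 6 (.var 86))) (.letv 39 (.var 86) (.letv 33 eMod
      (.letv 36 (.get 6 (.var 86)) (.letv 37 (.var 87) (eAvail o))))))
    (.letv 73 (.var 20) (.letv 78 (.var 87) (.letv 79 (.var 85) (eCoverExcept o
      (.add (eq (.var 84) (.var 78)) (.sum 88 17 (and (lt (.var 88) (.var 85))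
        (eq (.get 6 (.var 88)) (.var 84)))))))))

/-- Array 6 contains the positions on the route. -/
def eRoute (o : ℕ) (f : Ex) : Ex :=
  .tab 6 85 17 (.ite (.var 85)
    (.letv 86 (.sub (.var 85) (.const 1))
      (count 89 0 (not (.sum 87 0 (and (le (.var 87) (.var 89)) (eStep o))))))
    (.get 0 (.const (o + 1)))) f

section

variable {w : List ℕ} {o p n m s c : ℕ} {av : ℕ → ℕ → ℕ → Prop} {v : Env} {k : ℕ}

theorem ok_eDeg (h : 18 ≤ k) (h' : k ≤ 30) : (eDeg o).Ok k := by
  simp only [eDeg, Ex.Ok, ok_count, ok_eAvail h h']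
  simp only [and_true, true_and]
  omega

theorem ok_eCenter (h : 18 ≤ k) (h' : k ≤ 30) : (eCenter o).Ok k := by
  simp only [eCenter, Ex.Ok, ok_lt, ok_eDeg h h']
  simp only [and_true]
  omega

theorem ok_eFeasible (h : 18 ≤ k) (h' : k ≤ 30) : (eFeasible o).Ok k := by
  have : (eq (count 90 0 (.get 1 (.add (mul 0 (.sub (.var 8) (.const 1))) (.var 90))))
      (.var 0)).Ok k := by
    simp only [Ex.Ok, ok_eq, ok_count, ok_mul h']
    simp only [and_true]
    omega
  simp only [eFeasible, Ex.Ok, ok_eReach h h' this]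
  simp only [and_true, true_and]
  omega

theorem ok_eCoverExcept {g : Ex} (h : 18 ≤ k) (h' : k ≤ 30) (hg : g.Ok k) :
    (eCoverExcept o g).Ok k := by
  simp only [eCoverExcept, Ex.Ok, ok_and, ok_not, ok_eq, ok_le, ok_eDeg h h', ok_eCover h h', hg]
  simp only [and_true]
  omega

theorem ok_eOptimum (h : 18 ≤ k) (h' : k ≤ 30) : (eOptimum o).Ok k := by
  have : (eq (.var 84) (.var 78)).Ok k := by simp [ok_eq, Ex.Ok]
  simp only [eOptimum, Ex.Ok, ok_count, ok_not, ok_eCoverExcept h h' this]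
  simp only [and_true, true_and]
  omega

theorem ok_eRoute {f : Ex} (h : 18 ≤ k) (h' : k ≤ 30) (hf : f.Ok k) : (eRoute o f).Ok k := by
  have : (Ex.add (eq (.var 84) (.var 78)) (.sum 88 17 (and (lt (.var 88) (.var 85))
        (eq (.get 6 (.var 88)) (.var 84))))).Ok k := by
    simp only [Ex.Ok, ok_eq, ok_and, ok_lt]
    simp only [and_true, true_and]
    omega
  simp only [eRoute, eStep, Ex.Ok, ok_count, ok_not, ok_and, ok_le, ok_eq, ok_eMod h h',
    ok_eAvail h h', ok_eCoverExcept h h' this, hf]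
  simp only [and_true, true_and]
  omega

theorem eval_eDeg (hw : Describes w o p n m s av) (hv : Base w p n m v) (h : v.var 82 < n) :
    (eDeg o).eval v = deg av n p (v.var 82) := by
  classical
  rw [eDeg, eval_count, deg, hv.var 0 (by omega)]
  simp only [bound]
  congr 1
  refine Finset.filter_congr fun y hy => ?_
  have hv1 : Base w p n m (v.setV 83 y) := hv.setV (by omega)
  rw [holds_sum, hv1.var 3 (by omega)]
  simp only [bound]
  refine exists_congr fun r => and_congr_right fun hr => ?_
  rw [holds_letv, holds_letv, eval_eAvail hw (((hv1.setV (by omega)).setV (by omega)).setV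
    (by omega))] <;> simp [Env.setV_var, Ex.eval, hr, h, Finset.mem_range.1 hy]

/-- This holds on all instances, although `center` is meaningful only if every edge is available at
some time. -/
theorem eval_eCenter (hw : Describes w o p n m s av) (hv : Base w p n m v) :
    (eCenter o).eval v = center av n p s := by
  classical
  have key : ∀ x < n, (eDeg o).eval (v.setV 82 x) = deg av n p x := by
    intro x hx
    rw [eval_eDeg hw (hv.setV (by omega))] <;> simp [Env.setV_var, hx]
  rw [eCenter, eval_ite, center]
  simp only [holds_sum, hv.var 0 (show 0 < 18 by omega), bound, holds_lt, Ex.eval]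
  refine if_congr (exists_congr fun x => and_congr_right fun hx => by rw [key x hx]) ?_ ?_
  · refine Finset.sum_congr rfl fun x hx => ?_
    have := eval_ite (v := v.setV 82 x) (e := lt (.const 2) (eDeg o)) (f := .var 82) (g := .const 0)
    simp only [holds_lt, Ex.eval, key x (Finset.mem_range.1 hx), Env.setV_var, if_true] at this ⊢
    exact this
  · rw [hv.arr]
    exact hw.start

theorem center_le (hs : s < n) : center av n p s ≤ n * n + n := by
  classical
  rw [center]
  split_ifs
  · refine (Finset.sum_le_card_nsmul _ _ n fun x hx => ?_).trans ?_
    · have := Finset.mem_range.1 hx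
      split_ifs <;> omega
    · simp
  · omega

theorem eval_eFeasible (hw : Describes w o p n m s av) (hv : Base w p n m v)
    [Decidable (∀ y < n, Rch av 0 s (p * n) y)] :
    (eFeasible o).eval v = if ∀ y < n, Rch av 0 s (p * n) y then 1 else 0 := by
  have hs : v.arr 0 (o + 1) = s := by rw [hv.arr]; exact hw.start
  rw [eFeasible]
  simp only [Ex.eval, hs]
  have hv1 : Base w p n m ((v.setV 40 s).setV 42 0) := (hv.setV (by omega)).setV (by omega)
  obtain ⟨T, hT, hrec⟩ := exists_reach (v := (v.setV 40 s).setV 42 0) hw hv1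
    (by simpa [Env.setV_var] using hw.period_pos)
    (eq (count 90 0 (.get 1 (.add (mul 0 (.sub (.var 8) (.const 1))) (.var 90)))) (.var 0))
  have hv2 : Base w p n m (((v.setV 40 s).setV 42 0).setA 1 T) := hv1.setA (by omega)
  set v2 := ((v.setV 40 s).setV 42 0).setA 1 T with hv2d
  have hcount : (count 90 0 (.get 1 (.add (mul 0 (.sub (.var 8) (.const 1))) (.var 90)))).eval v2
      = n ↔ ∀ y < n, Rch av 0 s (p * n) y := by
    rw [eval_count, hv2.var 0 (by omega)]
    simp only [bound]
    conv_lhs => rhs; rw [← Finset.card_range n]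
    rw [Finset.card_filter_eq_iff]
    refine forall_congr' fun y => ?_
    rw [Finset.mem_range]
    refine imp_congr_right fun hy => ?_
    have := hrec (p * n) (by omega) y hy
    simp [Env.setV_var] at this
    rw [← this, Holds]
    have e0 : v.var 0 = n := hv.var 0 (by omega)
    have e8 : v.var 8 = p * n + 1 := hv.var 8 (by omega)
    simp [Ex.eval, e0, e8, Env.setV_var, hv2d, Env.setA_arr]
  rw [hT]
  simp only [eq, Ex.eval, hv2.var 0 (show 0 < 18 by omega), bound]
  split_ifs with h
  · rw [hcount.2 h]
    omega
  · have := mt hcount.1 h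
    omega

theorem eval_eCoverExcept (hw : Describes w o p n m s av) (hn : Net av n p (p * n))
    (hv : Base w p n m v) (hc : v.var 18 = c) (hcn : c < n)
    (hL : Sep av c {x | x < n ∧ deg av n p x ≤ 1}) {g : Ex} {E : Set ℕ}
    (hg : ∀ y < n, ∀ T, g.Holds ((v.setA 3 T).setV 84 y) ↔ y ∈ E) (h78 : v.var 78 < n)
    (h79 : v.var 79 ≤ bound p n m 10) (h73 : v.var 73 < bound p n m 10) :
    (eCoverExcept o g).Holds v ↔
      Cov av (v.var 78) (v.var 79) (targets av n p c \ E) (v.var 73) := by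
  obtain ⟨T, hT, hrec⟩ := exists_table v 3 84 0 (and (.letv 82 (.var 84)
    (.add (eq (.var 82) (.var 18)) (le (eDeg o) (.const 1)))) (not g)) (eCover o)
  rw [Holds, eCoverExcept, hT, ← Holds]
  have hTy : ∀ y < n, T y ≠ 0 ↔ y ∈ targets av n p c \ E := by
    intro y hy
    obtain ⟨T', -, hTi⟩ := hrec y (by rw [hv.var 0 (by omega)]; exact hy)
    have hv1 : Base w p n m ((v.setA 3 T').setV 84 y) := (hv.setA (by omega)).setV (by omega)
    rw [hTi, ← Holds, holds_and, holds_not, hg y hy, Set.mem_sdiff]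
    refine and_congr ?_ Iff.rfl
    rw [holds_letv, holds_add, holds_eq, holds_le, eval_eDeg hw (hv1.setV (by omega))] <;>
      simp [Env.setV_var, Ex.eval, hc, targets, hy]
  have hset : {x | x < n ∧ T x ≠ 0} = targets av n p c \ E := by
    ext x
    constructor
    · rintro ⟨h1, h2⟩
      exact (hTy x h1).1 h2
    · exact fun h => ⟨h.1.1, (hTy x h.1.1).2 h⟩
  have a3 : (v.setA 3 T).arr 3 = T := by simp [Env.setA_arr]
  have := eval_eCover (v := v.setA 3 T) (L := {x | x < n ∧ deg av n p x ≤ 1}) hw hn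
    (hv.setA (by omega)) (by simpa [hc] using hcn) (by simpa [hc] using hL) (fun x hx h1 h2 => by
      rw [a3] at h1
      have := ((hTy x hx).1 h1).1
      exact ⟨hx, this.2.resolve_left (by simpa [hc] using h2)⟩) h78 h79 h73
  rw [this, a3, hset]
  rfl

/-- The least time by which the targets can be visited from `s`. -/
noncomputable def optimum (av : ℕ → ℕ → ℕ → Prop) (X : Set ℕ) (s : ℕ) : ℕ :=
  sInf {T | Cov av s 0 (X \ {s}) T}

theorem Net.cov_optimum {H : ℕ} (hn : Net av n p H) (hs : s < n) {X : Set ℕ} (hX : ∀ x ∈ X, x < n) :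
    Cov av s 0 (X \ {s}) (optimum av X s) ∧ optimum av X s ≤ n * H := by
  have h := hn.cov_all hs (U := X \ {s}) fun x hx => hX x hx.1
  exact ⟨Nat.sInf_mem (s := {T | Cov av s 0 (X \ {s}) T}) ⟨_, h⟩, Nat.sInf_le h⟩

theorem eval_eOptimum (hw : Describes w o p n m s av) (hn : Net av n p (p * n))
    (hv : Base w p n m v) (hc : v.var 18 = c) (hcn : c < n)
    (hL : Sep av c {x | x < n ∧ deg av n p x ≤ 1}) (h19 : v.var 19 ≠ 0) :
    (eOptimum o).eval v = optimum av (targets av n p c) s := by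
  have hs : v.arr 0 (o + 1) = s := by rw [hv.arr]; exact hw.start
  obtain ⟨hcov, hle⟩ := hn.cov_optimum hw.start_lt (X := targets av n p c) fun x hx => hx.1
  rw [eOptimum, eval_ite, if_pos (holds_var.2 h19), eval_count, hv.var 10 (by omega)]
  simp only [bound]
  rw [show (Finset.range _).filter _ = Finset.range (optimum av (targets av n p c) s) from ?_,
    Finset.card_range]
  ext T
  rw [Finset.mem_filter, Finset.mem_range, Finset.mem_range]
  have hv1 : Base w p n m (((v.setV 73 T).setV 78 s).setV 79 0) :=
    ((hv.setV (by omega)).setV (by omega)).setV (by omega)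
  have key : T < n * (p * n) + 1 → ((Ex.letv 78 (.get 0 (.const (o + 1))) (.letv 79 (.const 0)
      (eCoverExcept o (eq (.var 84) (.var 78))))).Holds (v.setV 73 T) ↔
      Cov av s 0 (targets av n p c \ {s}) T) := by
    intro hT
    rw [holds_letv, holds_letv]
    simp only [Ex.eval, Env.setV_arr, hs]
    rw [eval_eCoverExcept (E := {s}) hw hn hv1 (by simpa [Env.setV_var] using hc) hcn hL] <;>
      simp [Env.setV_var, Ex.eval, hw.start_lt]
    exact hT
  constructor
  · rintro ⟨h1, h2⟩
    by_contra h
    exact (holds_not.1 h2) ((key h1).2 (hcov.mono (by omega)))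
  · intro h
    have h1 : T < n * (p * n) + 1 := by omega
    exact ⟨h1, holds_not.2 fun h' => Nat.notMem_of_lt_sInf h ((key h1).1 h')⟩

/-- Correctness of the table of positions, up to the end of the route. -/
theorem exists_route (hw : Describes w o p n m s av) (hn : Net av n p (p * n))
    (hv : Base w p n m v) (hc : v.var 18 = c) (hcn : c < n)
    (hL : Sep av c {x | x < n ∧ deg av n p x ≤ 1})
    (h20 : v.var 20 = optimum av (targets av n p c) s) (f : Ex) :
    ∃ P : ℕ → ℕ, (eRoute o f).eval v = f.eval (v.setA 6 P) ∧
      ∀ i ≤ optimum av (targets av n p c) s,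
        P i = (route av (targets av n p c) (optimum av (targets av n p c) s) s i).1 := by
  have hs : v.arr 0 (o + 1) = s := by rw [hv.arr]; exact hw.start
  obtain ⟨hcov, hle⟩ := hn.cov_optimum hw.start_lt (X := targets av n p c) fun x hx => hx.1
  set X := targets av n p c with hX
  set T := optimum av X s with hTd
  obtain ⟨P, hP, hrec⟩ := exists_table v 6 85 17 (.ite (.var 85)
    (.letv 86 (.sub (.var 85) (.const 1))
      (count 89 0 (not (.sum 87 0 (and (le (.var 87) (.var 89)) (eStep o))))))
    (.get 0 (.const (o + 1)))) f
  refine ⟨P, hP, fun i => ?_⟩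
  induction i using Nat.strong_induction_on with
  | _ i ih =>
  intro hi
  obtain ⟨P', hP', hPi⟩ := hrec i (by rw [hv.var 17 (by omega)]; simp only [bound]; omega)
  rw [hPi, eval_ite]
  cases i with
  | zero => simp [holds_var, Env.setV_var, Ex.eval, Env.setA_arr, hs, route]
  | succ i =>
  simp only [holds_var, Env.setV_var, if_true]
  rw [if_pos (by omega), Ex.eval]
  have hv1 : Base w p n m (((v.setA 6 P').setV 85 (i + 1)).setV 86 i) :=
    ((hv.setA (by omega)).setV (by omega)).setV (by omega)
  simp only [Ex.eval, Env.setV_var, if_true, Nat.add_sub_cancel]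
  set v1 := ((v.setA 6 P').setV 85 (i + 1)).setV 86 i with hv1d
  rw [eval_count, hv1.var 0 (by omega)]
  have hPj : ∀ j ≤ i, P' j = (route av X T s j).1 := fun j hj => by
    rw [hP' j (by omega), ih j (by omega) (by omega)]
  have hcur := route_lt hn hw.start_lt hcov (show i ≤ T by omega)
  set cur := (route av X T s i).1 with hcurd
  set Q : ℕ → Prop := fun x => (x = cur ∨ av i cur x) ∧
    Cov av x (i + 1) (X \ insert x (route av X T s i).2) T with hQ
  have hstep : ∀ y < n, ∀ x < n, (eStep o).Holds ((v1.setV 89 y).setV 87 x) ↔ Q x := by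
    intro y _ x hx
    set v2 := (v1.setV 89 y).setV 87 x with hv2d
    have hv2 : Base w p n m v2 := (hv1.setV (by omega)).setV (by omega)
    have e18 : v2.var 18 = c := by simp [hv2d, hv1d, Env.setV_var, hc]
    have e20 : v2.var 20 = T := by simp [hv2d, hv1d, Env.setV_var, h20]
    have e85 : v2.var 85 = i + 1 := by simp [hv2d, hv1d, Env.setV_var]
    have e86 : v2.var 86 = i := by simp [hv2d, hv1d, Env.setV_var]
    have e87 : v2.var 87 = x := by simp [hv2d, Env.setV_var]
    have a6 : v2.arr 6 = P' := by simp [hv2d, hv1d, Env.setA_arr]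
    have hget : (Ex.get 6 (.var 86)).eval v2 = cur := by
      rw [Ex.eval, Ex.eval, e86, a6, hPj i le_rfl]
    rw [eStep, holds_and, holds_add, holds_eq, hget, Ex.eval, e87]
    refine and_congr (or_congr Iff.rfl ?_) ?_
    · rw [holds_letv, Ex.eval, e86, holds_letv]
      have hmod := eval_eMod (v := v2.setV 39 i) hw.period_pos (hv2.setV (by omega))
        (by simp only [Env.setV_var, if_true, bound]; omega)
      simp only [Env.setV_var, if_true] at hmod
      rw [hmod, holds_letv, holds_letv, eval_eAvail hw ((((hv2.setV (by omega)).setV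
        (by omega)).setV (by omega)).setV (by omega))] <;>
          simp [Env.setV_var, Ex.eval, e86, e87, a6, hPj i le_rfl, hw.per]
      · exact Iff.rfl
      · exact Nat.mod_lt _ hw.period_pos
      · exact hcur
      · exact hx
    · rw [holds_letv, holds_letv, holds_letv]
      rw [eval_eCoverExcept (c := c) (E := insert x (route av X T s i).2) hw hn
        (((hv2.setV (by omega)).setV (by omega)).setV (by omega))
        (by simpa [Env.setV_var] using e18) hcn hL]
      · simp [Env.setV_var, Ex.eval, e20, e85, e87, hX]
      · intro z hz T'
        rw [holds_add, holds_sum, Set.mem_insert_iff, mem_route_iff]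
        refine or_congr ?_ ?_
        · simp [Env.setV_var, Ex.eval, e87]
        · have hv3 : Base w p n m (((((v2.setV 73 ((Ex.var 20).eval v2)).setV 78 ((Ex.var 87).eval
            (v2.setV 73 ((Ex.var 20).eval v2)))).setV 79 ((Ex.var 85).eval
            ((v2.setV 73 ((Ex.var 20).eval v2)).setV 78 ((Ex.var 87).eval
            (v2.setV 73 ((Ex.var 20).eval v2)))))).setA 3 T').setV 84 z) :=
            ((((hv2.setV (by omega)).setV (by omega)).setV (by omega)).setA (by omega)).setV
              (by omega)
          rw [hv3.var 17 (by omega)]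
          simp only [bound, holds_and, holds_lt, holds_eq]
          simp only [Ex.eval, Env.setV_var, Env.setV_arr, Env.setA_arr, Env.setA_var]
          norm_num [e85, a6]
          constructor
          · rintro ⟨j, -, h1, h2⟩
            exact ⟨j, by omega, (hPj j (by omega)).symm.trans h2⟩
          · rintro ⟨j, h1, h2⟩
            exact ⟨j, by omega, by omega, (hPj j h1).trans h2⟩
      · simpa [Env.setV_var, Ex.eval, e87] using hx
      · simp [Env.setV_var, Ex.eval, e85, bound]
        omega
      · simp [Env.setV_var, Ex.eval, e20, bound]
        omega
  have hQn : ∀ x, Q x → x < n := by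
    rintro x ⟨rfl | h, -⟩
    · exact hcur
    · exact (hn.lt h).2
  classical
  rw [route, ← card_filter_not_exists_le hQn ((route_spec hcov (by omega)).2 (by omega))]
  dsimp only
  congr 1
  refine Finset.filter_congr fun y hy => ?_
  have hv2 : Base w p n m (v1.setV 89 y) := hv1.setV (by omega)
  rw [holds_not, holds_sum, hv2.var 0 (by omega)]
  refine not_congr (exists_congr fun x => and_congr_right fun hx => ?_)
  rw [holds_and, holds_le, hstep y (Finset.mem_range.1 hy) x hx]
  simp [Ex.eval, Env.setV_var]

end

end DMVP

namespace DMVP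

open RAM RAM.Ex

/-! ### Instances of the visitation problem -/

section

variable {n p : ℕ} {G : TVG (Fin n)}

/-- If all edges are available at some time, degrees can be read off the availability relation. -/
theorem deg_eq_degree (hp : 0 < p) (hG : G.Periodic p)
    (h : ∀ u w, G.graph.Adj u w → ∃ t, G.Avail t u w) (x : Fin n) :
    deg (natAvail G) n p x = degree G.graph x := by
  classical
  rw [deg, degree, ← Set.ncard_image_of_injective _ Fin.val_injective, ← Set.ncard_coe_finset]
  congr 1
  ext y
  simp only [Finset.coe_filter, Finset.mem_range, Set.mem_ofPred_eq, Set.mem_image,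
    SimpleGraph.mem_neighborSet]
  constructor
  · rintro ⟨hy, r, _, _, _, hr⟩
    exact ⟨⟨y, hy⟩, hr.1, rfl⟩
  · rintro ⟨z, hz, rfl⟩
    obtain ⟨t, ht⟩ := h x z hz
    refine ⟨z.2, t % p, Nat.mod_lt _ hp, natAvail_fin.2 ?_⟩
    rwa [← avail_add (k := t / p) hG, mul_comm, Nat.mod_add_div]

/-- In a spider, all vertices other than the center have degree at most two. -/
theorem center_spec {K : SimpleGraph (Fin n)} (hK : IsSpider K) {av : ℕ → ℕ → ℕ → Prop}
    (hd : ∀ x : Fin n, deg av n p x = degree K x) (s : Fin n) :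
    ∃ c : Fin n, center av n p s = c ∧ ∀ v, v ≠ c → degree K v ≤ 2 := by
  classical
  rw [center]
  split_ifs with h
  · obtain ⟨c, hc, hdc⟩ := h
    have huniq : ∀ v : Fin n, 2 < degree K v → v = ⟨c, hc⟩ := fun v hv =>
      hK.2 _ _ hv (hdc.trans_eq (hd ⟨c, hc⟩))
    refine ⟨⟨c, hc⟩, ?_, fun v hv => not_lt.1 (mt (huniq v) hv)⟩
    rw [Finset.sum_eq_single c, if_pos hdc]
    · intro b hb hbc
      refine if_neg fun hdb => hbc ?_
      have hb' := Finset.mem_range.1 hb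
      exact congrArg Fin.val (huniq ⟨b, hb'⟩ (hd ⟨b, hb'⟩ ▸ hdb))
    · exact fun h => absurd (Finset.mem_range.2 hc) h
  · refine ⟨s, rfl, fun v _ => not_lt.1 fun hv => h ⟨v, v.2, ?_⟩⟩
    rwa [hd v]

end

namespace SpiderInstance

variable {p : ℕ} (I : SpiderInstance p)

/-- All vertices can be reached from the starting vertex within `p * n` time steps. -/
def Feasible : Prop := ∀ y < I.n, Rch (natAvail I.G) 0 I.start (p * I.n) y

/-- The vertices that the algorithm visits: the center and the leaves. -/
def stops : Set ℕ := targets (natAvail I.G) I.n p (center (natAvail I.G) I.n p I.start)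

/-- The earliest possible arrival of a covering journey, if there is one. -/
noncomputable def best : ℕ := optimum (natAvail I.G) I.stops I.start

theorem exists_avail_of_reach (h : ∀ v < I.n, ∃ T, Rch (natAvail I.G) 0 I.start T v) :
    ∀ u w, I.G.graph.Adj u w → ∃ t, I.G.Avail t u w :=
  fun _ _ hadj => exists_avail I.spider.1 I.start.2 h hadj

/-- A covering journey reaches all vertices at some time, hence every edge is available at some
time, hence `p * n` steps suffice to reach any vertex. -/
theorem feasible_of_isCovering (hp : 0 < p) {J : List (Fin I.n × ℕ)}
    (h : IsCovering I.G I.start J) : I.Feasible := by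
  obtain ⟨h0, f, h1, h2, h3⟩ := h.cov
  have hn := net_of_avail hp I.periodic (I.exists_avail_of_reach fun v hv => by
    obtain ⟨t, h4, h5, h6⟩ := h3 v hv
    have := h1.rch_of_le le_rfl h4 h5
    rw [h2, h6] at this
    exact ⟨t, this⟩)
  intro y hy
  have := hn.conn 0 I.start y I.start.2 hy
  rwa [zero_add] at this

theorem Feasible.exists_avail {I : SpiderInstance p} (h : I.Feasible) :
    ∀ u w, I.G.graph.Adj u w → ∃ t, I.G.Avail t u w :=
  I.exists_avail_of_reach fun v hv => ⟨_, h v hv⟩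

theorem Feasible.net {I : SpiderInstance p} (hp : 0 < p) (h : I.Feasible) :
    Net (natAvail I.G) I.n p (p * I.n) :=
  net_of_avail hp I.periodic h.exists_avail

theorem Feasible.center {I : SpiderInstance p} (hp : 0 < p) (h : I.Feasible) : ∃ c : Fin I.n,
    center (natAvail I.G) I.n p I.start = c ∧ (∀ v, v ≠ c → degree I.G.graph v ≤ 2) ∧
      Sep (natAvail I.G) c {x | x < I.n ∧ deg (natAvail I.G) I.n p x ≤ 1} := by
  have hd := deg_eq_degree hp I.periodic h.exists_avail
  obtain ⟨c, h1, h2⟩ := center_spec I.spider hd I.start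
  refine ⟨c, h1, h2, ?_⟩
  convert sep_leaves I.spider.1 h2 using 1
  ext x
  constructor
  · exact fun ⟨hx, hdx⟩ => ⟨hx, hd ⟨x, hx⟩ ▸ hdx⟩
  · exact fun ⟨hx, hdx⟩ => ⟨hx, (hd ⟨x, hx⟩).trans_le hdx⟩

theorem Feasible.cov_best {I : SpiderInstance p} (hp : 0 < p) (h : I.Feasible) :
    Cov (natAvail I.G) I.start 0 (I.stops \ {(I.start : ℕ)}) I.best ∧
      I.best ≤ I.n * (p * I.n) :=
  (h.net hp).cov_optimum I.start.2 fun _ hx => hx.1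

theorem best_le {J : List (Fin I.n × ℕ)} (hJ : IsCovering I.G I.start J) :
    I.best ≤ arrival J :=
  Nat.sInf_le (hJ.cov.subset fun _ hx => hx.1.1)

/-- The positions on the route. -/
noncomputable def pos (t : ℕ) : Fin I.n :=
  if h : (route (natAvail I.G) I.stops I.best I.start t).1 < I.n then ⟨_, h⟩ else I.start

theorem Feasible.val_pos {I : SpiderInstance p} (hp : 0 < p) (h : I.Feasible) {t : ℕ}
    (ht : t ≤ I.best) :
    (I.pos t : ℕ) = (route (natAvail I.G) I.stops I.best I.start t).1 := by
  rw [pos, dif_pos (route_lt (h.net hp) I.start.2 (h.cov_best hp).1 ht)]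

theorem Feasible.isCovering {I : SpiderInstance p} (hp : 0 < p) (h : I.Feasible) :
    IsCovering I.G I.start (moves I.pos 0 I.best) := by
  obtain ⟨hcov, -⟩ := h.cov_best hp
  have h0 : I.pos 0 = I.start := Fin.val_injective (h.val_pos hp (Nat.zero_le _))
  have hstep : ∀ t < I.best,
      I.pos (t + 1) = I.pos t ∨ I.G.Avail t (I.pos t) (I.pos (t + 1)) := by
    intro t ht
    have := route_succ hcov ht
    rw [← h.val_pos hp ht.le, ← h.val_pos hp ht] at this
    exact this.imp (fun h => Fin.val_injective h) natAvail_fin.1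
  constructor
  · have := isJourney_moves (G := I.G) (f := I.pos) (τ := 0) (d := I.best)
      fun t _ ht => hstep t (by omega)
    rwa [h0] at this
  · intro v
    obtain ⟨c, hc, hc2, -⟩ := h.center hp
    have hd := deg_eq_degree hp I.periodic h.exists_avail
    obtain ⟨t, ht, htv⟩ := visits_all (T := I.best) (f := fun t => I.pos t) I.spider.1 c
      (fun t _ ht => (hstep t ht).imp (congrArg Fin.val) natAvail_fin.2) (I.pos 0).2
      (fun x hx => by
        obtain ⟨t, ht, htx⟩ := route_visits hcov (x := x) ⟨x.2, by rwa [hd x, hc, Fin.val_inj]⟩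
        exact ⟨t, ht, (h.val_pos hp ht).trans htx⟩) v
    rw [← h0, ← Fin.val_injective htv]
    exact mem_moves (Nat.zero_le _) (by omega)

theorem Feasible.isOptimal {I : SpiderInstance p} (hp : 0 < p) (h : I.Feasible) :
    IsOptimal I.G I.start (moves I.pos 0 I.best) :=
  ⟨h.isCovering hp, fun _ hJ => (arrival_le fun e he => by
    simpa using moves_lt e he).trans (I.best_le hJ)⟩

/-! ### The program -/

/-- The code of an instance describes its availability relation. The offset `o` is `1` in the
decision problem, where the time bound precedes the code. -/
theorem describes_input (hp : 0 < p) {w : List ℕ} {o : ℕ}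
    (h : ∀ i, inputArr w (o + i) = inputArr I.code i) :
    Describes w o p I.n I.phases.length I.start (natAvail I.G) where
  period_pos := hp
  start := h 1
  start_lt := I.start.2
  lt := fun ⟨hu, hx, _⟩ => ⟨hu, hx⟩
  per t u x := by
    constructor
    · rintro ⟨hu, hx, h⟩
      refine ⟨hu, hx, ?_⟩
      rwa [← avail_add (k := t / p) I.periodic, mul_comm, Nat.mod_add_div] at h
    · rintro ⟨hu, hx, h⟩
      refine ⟨hu, hx, ?_⟩
      rwa [← avail_add (k := t / p) I.periodic, mul_comm, Nat.mod_add_div]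
  read r hr u hu x hx := by
    have hdur : ∀ j < I.phases.length, inputArr w (o + 3 + j * (I.n * I.n + 1))
        = (I.phases.map Prod.snd).getD j 0 := by
      intro j hj
      rw [add_assoc, h]
      exact I.getD_code_duration hj
    have hind : (∑ i ∈ Finset.range I.phases.length,
        if ∑ j ∈ Finset.range I.phases.length, (if j ≤ i then
          inputArr w (o + 3 + j * (I.n * I.n + 1)) else 0) ≤ r then 1 else 0)
        = phaseIndex (I.phases.map Prod.snd) r := by
      rw [phaseIndex, List.length_map]
      refine Finset.sum_congr rfl fun i _ => if_congr (iff_of_eq (congrArg (· ≤ r) ?_)) rfl rfl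
      exact Finset.sum_congr rfl fun j hj => by rw [hdur j (Finset.mem_range.1 hj)]
    rw [hind, add_assoc, h]
    exact (I.getD_code_eq_zero hr ⟨u, hu⟩ ⟨x, hx⟩).trans
      (natAvail_fin (u := ⟨u, hu⟩) (w := ⟨x, hx⟩)).symm

open Classical in
/-- The parameters of the program. -/
noncomputable def param (j : ℕ) : ℕ :=
  if j = 18 then DMVP.center (natAvail I.G) I.n p I.start
  else if j = 19 then if I.Feasible then 1 else 0
  else if j = 20 then if I.Feasible then I.best else 0
  else bound p I.n I.phases.length j

end SpiderInstance

/-- The `k`-th power of variable 5. -/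
def ePower (k : ℕ) : Ex := (mul 5)^[k] (.const 1)

theorem eval_ePower (k : ℕ) (v : Env) : (ePower k).eval v = v.var 5 ^ k := by
  induction k with
  | zero => rfl
  | succ k ih =>
    rw [ePower, Function.iterate_succ_apply', eval_mul (by omega), ← ePower, ih, pow_succ, mul_comm]

theorem ok_ePower {m : ℕ} (k : ℕ) (h : 5 < m) (h' : m ≤ 30) : (ePower k).Ok m := by
  induction k with
  | zero => trivial
  | succ k ih =>
    rw [ePower, Function.iterate_succ_apply', ok_mul h']
    exact ⟨h, ih⟩

/-- The parameters as expressions. -/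
def eParams (o p : ℕ) : List Ex :=
  [.get 0 (.const o), .get 0 (.const (o + 2)), mul 0 (.var 0), .const p, .const (p + 1),
    .add (.var 0) (.const 1), ePower (p * (p + 1)), .const (p * (p + 1)),
    .add (mul 0 (.const p)) (.const 1), mul 0 (.var 8), .add (mul 0 (mul 0 (.const p))) (.const 1),
    mul 6 (.var 10), mul 5 (.var 11), mul 4 (.var 6), mul 5 (.var 13), .const (2 * p),
    .add (.add (.var 10) (.add (.var 8) (.var 8))) (.const p), .add (.var 10) (.const 1),
    eCenter o, eFeasible o, eOptimum o]

theorem ok_eParams (o p : ℕ) : ∀ j (h : j < (eParams o p).length), ((eParams o p)[j]).Ok j := by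
  intro j h
  have hj : j < 21 := h
  interval_cases j <;> simp [eParams, Ex.Ok, ok_mul, ok_ePower, ok_eCenter, ok_eFeasible,
    ok_eOptimum]

theorem base_of_good {p : ℕ} (I : SpiderInstance p) {w : List ℕ} {k : ℕ} {v : Env}
    (hv : Good w I.param k v) (hk : 18 ≤ k) : Base w p I.n I.phases.length v :=
  ⟨hv.arr, fun j hj => by
    rw [hv.var j (by omega), SpiderInstance.param, if_neg (by omega), if_neg (by omega),
      if_neg (by omega)]⟩

theorem eval_eParams {p : ℕ} (hp : 0 < p) (I : SpiderInstance p) {w : List ℕ} {o : ℕ}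
    (h : ∀ i, inputArr w (o + i) = inputArr I.code i) (j : ℕ) (hj : j < (eParams o p).length)
    (v : Env) (hv : Good w I.param j v) : ((eParams o p)[j]).eval v = I.param j := by
  have hw := I.describes_input hp h
  have hj' : j < 21 := hj
  by_cases hj18 : j < 18
  · have h0 : v.arr 0 o = I.n := by rw [hv.arr]; exact h 0
    have h2 : v.arr 0 (o + 2) = I.phases.length := by rw [hv.arr]; exact h 2
    have hvar := hv.var
    interval_cases j <;> simp [eParams, Ex.eval, SpiderInstance.param, bound, h0, h2, hvar,
      eval_ePower] <;> first | ring1 | exact Or.inl (by ring)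
  · have hb := base_of_good I hv (by omega)
    interval_cases j
    · exact (eval_eCenter hw hb).trans (by simp [SpiderInstance.param])
    · classical
      refine (eval_eFeasible hw hb).trans ?_
      by_cases hf : I.Feasible
      · refine (if_pos hf).trans ?_
        simp [SpiderInstance.param, hf]
      · refine (if_neg hf).trans ?_
        simp [SpiderInstance.param, hf]
    · have h18 := hv.var 18 (by omega)
      have h19 := hv.var 19 (by omega)
      simp only [SpiderInstance.param, if_true] at h18 h19 ⊢
      norm_num at h19 ⊢
      by_cases hf : I.Feasible
      · obtain ⟨c, hc, -, hsep⟩ := hf.center hp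
        rw [if_pos hf] at h19 ⊢
        rw [hc] at h18
        refine (eval_eOptimum hw (hf.net hp) hb h18 c.2 hsep (by omega)).trans ?_
        rw [SpiderInstance.best, SpiderInstance.stops, hc]
      · rw [if_neg hf] at h19 ⊢
        simp [eParams, eOptimum, Ex.eval, h19]

/-- The parameters as polynomials in a common bound for the number of vertices and of static
graphs. -/
noncomputable def boundPoly (p : ℕ) : ℕ → Polynomial ℕ
  | 0 => .X
  | 1 => .X
  | 2 => .X * .X
  | 3 => .C p
  | 4 => .C (p + 1)
  | 5 => .X + 1
  | 6 => (.X + 1) ^ (p * (p + 1))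
  | 7 => .C (p * (p + 1))
  | 8 => .C p * .X + 1
  | 9 => .X * (.C p * .X + 1)
  | 10 => .X * (.C p * .X) + 1
  | 11 => (.X + 1) ^ (p * (p + 1)) * (.X * (.C p * .X) + 1)
  | 12 => (.X + 1) * ((.X + 1) ^ (p * (p + 1)) * (.X * (.C p * .X) + 1))
  | 13 => .C (p + 1) * (.X + 1) ^ (p * (p + 1))
  | 14 => (.X + 1) * (.C (p + 1) * (.X + 1) ^ (p * (p + 1)))
  | 15 => .C (2 * p)
  | 16 => .X * (.C p * .X) + 1 + 2 * (.C p * .X + 1) + .C p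
  | _ => .X * (.C p * .X) + 2

theorem bound_le {p n m N : ℕ} (hn : n ≤ N) (hm : m ≤ N) (j : ℕ) :
    bound p n m j ≤ (boundPoly p j).eval N := by
  unfold bound boundPoly
  split <;> simp <;> first | assumption | gcongr

/-- The parameters are polynomially bounded: the code contains `m` matrices with `n * n` entries, so
`n` and `m` are at most its length. -/
theorem param_le {p : ℕ} (hp : 0 < p) (I : SpiderInstance p) {N : ℕ} (hN : I.code.length ≤ N)
    {j : ℕ} (hj : j < 21) : I.param j ≤
      ((∑ i ∈ Finset.range 18, boundPoly p i) + (.X * .X + .X) + 1 : Polynomial ℕ).eval N := by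
  have hlen := I.length_code
  have hm := I.phases_length_pos hp
  have hmN : I.phases.length ≤ N := by
    have : I.phases.length ≤ I.phases.length * (I.n * I.n + 1) :=
      Nat.le_mul_of_pos_right _ (by omega)
    omega
  have hnN : I.n ≤ N := by
    have h1 : I.n * I.n + 1 ≤ I.phases.length * (I.n * I.n + 1) := Nat.le_mul_of_pos_left _ hm
    have h2 := Nat.le_mul_self I.n
    omega
  have hsum : ∀ i < 18, bound p I.n I.phases.length i ≤
      ∑ i ∈ Finset.range 18, (boundPoly p i).eval N := fun i hi =>
    (bound_le hnN hmN i).trans (Finset.single_le_sum (f := fun i => (boundPoly p i).eval N)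
      (fun _ _ => Nat.zero_le _) (Finset.mem_range.2 hi))
  simp only [Polynomial.eval_add, Polynomial.eval_finsetSum, Polynomial.eval_mul,
    Polynomial.eval_X, Polynomial.eval_one]
  rw [SpiderInstance.param]
  split_ifs with h1 h2 h3 h4 h5
  · have := center_le (av := natAvail I.G) (p := p) I.start.2
    have := Nat.mul_le_mul hnN hnN
    omega
  · omega
  · omega
  · have := (h5.cov_best hp).2
    have := hsum 10 (by omega)
    simp only [bound] at this
    omega
  · omega
  · exact (hsum j (by omega)).trans (by omega)

/-- A step of the route at the time in variable 91 that is not a wait. -/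
def eMoves (o : ℕ) : Ex :=
  and (.var 19) (and (lt (.var 91) (.var 20)) (eRoute o
    (not (eq (.get 6 (.add (.var 91) (.const 1))) (.get 6 (.var 91))))))

/-- The output of the program for the minimization problem. -/
theorem reported_moves {p : ℕ} (hp : 0 < p) (I : SpiderInstance p) {w : List ℕ} {o : ℕ}
    (h : ∀ i, inputArr w (o + i) = inputArr I.code i) {v : Env} (hv : Good w I.param 21 v) :
    I.IsSolution (reported (.var 19) (eMoves o)
      (eRoute o (.get 6 (.add (.var 91) (.const 1)))) (.var 91) 91 10 v) := by
  have hw := I.describes_input hp h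
  have hb := base_of_good I hv (by omega)
  have h18 := hv.var 18 (by omega)
  have h19 := hv.var 19 (by omega)
  have h20 := hv.var 20 (by omega)
  simp only [SpiderInstance.param, if_true] at h18 h19 h20
  norm_num at h19 h20
  by_cases hf : I.Feasible
  · obtain ⟨c, hc, -, hsep⟩ := hf.center hp
    obtain ⟨hcov, hle⟩ := hf.cov_best hp
    have hst : I.stops = targets (natAvail I.G) I.n p c := by rw [SpiderInstance.stops, hc]
    rw [if_pos hf] at h19 h20
    rw [hc] at h18
    refine Or.inl ⟨_, hf.isOptimal hp, ?_⟩
    rw [reported, Ex.eval, h19, journeyCode_moves, hb.var 10 (by omega)]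
    congr 1
    rw [show bound p I.n I.phases.length 10 = I.best + (I.n * (p * I.n) + 1 - I.best) by
      simp only [bound]; omega, List.range_add, List.flatMap_append, ← List.range_eq_range']
    have key : ∀ t, ((eMoves o).eval (v.setV 91 t) = 0 ↔ (t < I.best → I.pos (t + 1) = I.pos t)) ∧
        (t < I.best → (eRoute o (.get 6 (.add (.var 91) (.const 1)))).eval (v.setV 91 t)
          = I.pos (t + 1)) := by
      intro t
      have hb1 : Base w p I.n I.phases.length (v.setV 91 t) := hb.setV (by omega)
      have hroute := exists_route hw (hf.net hp) hb1 (c := c)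
        (by simpa [Env.setV_var] using h18) c.2 hsep
        (by simpa [Env.setV_var, SpiderInstance.best, hst] using h20)
      rw [← hst] at hroute
      constructor
      · rw [← not_iff_not, ← ne_eq, ← Holds, eMoves, holds_and, holds_and, holds_lt, holds_var]
        simp only [Ex.eval, Env.setV_var]
        norm_num [h19, h20]
        intro ht
        obtain ⟨P, hP, hPi⟩ := hroute
          (not (eq (.get 6 (.add (.var 91) (.const 1))) (.get 6 (.var 91))))
        rw [Holds, hP, ← Holds, holds_not, holds_eq]
        simp only [Ex.eval, Env.setV_var, Env.setA_var, Env.setA_arr, if_true]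
        rw [hPi _ ht, hPi _ ht.le, ← Fin.val_inj, hf.val_pos hp ht, hf.val_pos hp ht.le]
        rfl
      · intro ht
        obtain ⟨P, hP, hPi⟩ := hroute (.get 6 (.add (.var 91) (.const 1)))
        rw [hP]
        simp [Ex.eval, Env.setV_var, Env.setA_arr]
        rw [hPi _ ht, hf.val_pos hp ht]
        rfl
    have hnil : ∀ l : List ℕ, (∀ t ∈ l, I.best ≤ t) → (l.flatMap fun i =>
        if (eMoves o).eval (v.setV 91 i) = 0 then [] else
          [(eRoute o (.get 6 (.add (.var 91) (.const 1)))).eval (v.setV 91 i),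
            (Ex.var 91).eval (v.setV 91 i)]) = [] := fun l hl =>
      List.flatMap_eq_nil_iff.2 fun t ht => if_pos ((key t).1.2 fun h => by
        have := hl t ht
        omega)
    rw [hnil (List.map _ _) fun t ht => ?_, List.append_nil]
    · refine List.flatMap_congr fun t ht => ?_
      have ht := List.mem_range.1 ht
      obtain ⟨h1, h2⟩ := key t
      rw [h2 ht, Ex.eval, Env.setV_var, if_pos rfl]
      exact if_congr (h1.trans ⟨fun h => h ht, fun h _ => h⟩) rfl rfl
    · obtain ⟨d, -, rfl⟩ := List.mem_map.1 ht
      omega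
  · rw [if_neg hf] at h19
    refine Or.inr ⟨fun J hJ => hf (I.feasible_of_isCovering hp hJ), ?_⟩
    have hz : ∀ t, (eMoves o).eval (v.setV 91 t) = 0 := by
      intro t
      simp [eMoves, Ex.and, Ex.eval, Env.setV_var, h19]
    rw [reported]
    simp [hz, Ex.eval, h19]

/-- The output of the program for the decision problem. The value of `le` is `0` or `1`. -/
theorem reported_decision {p : ℕ} (hp : 0 < p) (I : SpiderInstance p) {w : List ℕ} {v : Env}
    (hv : Good w I.param 21 v) :
    I.IsDecision (inputArr w 0) (reported (and (.var 19) (le (.var 20) (.get 0 (.const 0))))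
      (.const 0) (.const 0) (.const 0) 91 10 v) := by
  have h19 := hv.var 19 (by omega)
  have h20 := hv.var 20 (by omega)
  simp only [SpiderInstance.param] at h19 h20
  norm_num at h19 h20
  set t := inputArr w 0 with ht
  have hrep : reported (and (.var 19) (le (.var 20) (.get 0 (.const 0)))) (.const 0) (.const 0)
      (.const 0) 91 10 v = [(and (.var 19) (le (.var 20) (.get 0 (.const 0)))).eval v] := by
    simp [reported, Ex.eval]
  rw [hrep]
  by_cases hf : I.Feasible
  · rw [if_pos hf] at h19 h20
    simp only [Ex.and, le, Ex.eval, h19, h20, hv.arr]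
    by_cases hle : I.best ≤ t
    · refine Or.inl ⟨⟨_, hf.isCovering hp, (arrival_le fun e he => ?_).trans hle⟩, ?_⟩
      · simpa using moves_lt e he
      · simp [hle, ← ht]
    · refine Or.inr ⟨fun J hJ => (not_le.1 hle).trans_le (I.best_le hJ), ?_⟩
      simp [← ht]
      omega
  · rw [if_neg hf] at h19
    refine Or.inr ⟨fun J hJ => absurd (I.feasible_of_isCovering hp hJ) hf, ?_⟩
    simp [Ex.and, Ex.eval, h19]

theorem ok_eMoves (o : ℕ) : (eMoves o).Ok 21 := by
  have := ok_eRoute (o := o) (k := 21) (f := not (eq (.get 6 (.add (.var 91) (.const 1)))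
    (.get 6 (.var 91)))) (by omega) (by omega) (by simp [ok_not, ok_eq, Ex.Ok])
  simp [eMoves, ok_and, ok_lt, Ex.Ok, this]

end DMVP

theorem theorem14 (p : ℕ) (hp : 0 < p) :
    RAM.SolvableInPolyTime
        (fun I : DMVP.SpiderInstance p => I.code)
        (fun I w => I.IsSolution w) ∧
      RAM.SolvableInPolyTime
        (fun x : DMVP.SpiderInstance p × ℕ => x.2 :: x.1.code)
        (fun x w => x.1.IsDecision x.2 w) := by
  constructor
  · refine RAM.solvableInPolyTime_of_ex _ _ (DMVP.eParams 0 p) (fun I => I.param) _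
      (fun j hj => ⟨DMVP.ok_eParams 0 p j hj, fun I v hv =>
        DMVP.eval_eParams hp I (fun i => by rw [zero_add]) j hj v hv⟩)
      (fun I j hj => DMVP.param_le hp I (DMVP.length_le_inputSize _) hj)
      (.var 19) (DMVP.eMoves 0) (DMVP.eRoute 0 (.get 6 (.add (.var 91) (.const 1)))) (.var 91) 91 10
      (Nat.le_of_ble_eq_true rfl) (Nat.le_of_ble_eq_true rfl) trivial (DMVP.ok_eMoves 0)
      (DMVP.ok_eRoute (Nat.le_of_ble_eq_true rfl) (Nat.le_of_ble_eq_true rfl) ⟨trivial, trivial⟩)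
      trivial fun I v hv => ?_
    exact DMVP.reported_moves hp I (fun i => by rw [zero_add]) hv
  · have hin : ∀ x : DMVP.SpiderInstance p × ℕ, ∀ i,
        RAM.inputArr (x.2 :: x.1.code) (1 + i) = RAM.inputArr x.1.code i := fun x i => by
      rw [add_comm]
      rfl
    refine RAM.solvableInPolyTime_of_ex _ _ (DMVP.eParams 1 p) (fun x => x.1.param) _
      (fun j hj => ⟨DMVP.ok_eParams 1 p j hj, fun x v hv =>
        DMVP.eval_eParams hp x.1 (hin x) j hj v hv⟩)
      (fun x j hj => DMVP.param_le hp x.1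
        ((Nat.le_succ _).trans (DMVP.length_le_inputSize (x.2 :: x.1.code))) hj)
      (RAM.Ex.and (.var 19) (RAM.Ex.le (.var 20) (.get 0 (.const 0)))) (.const 0) (.const 0)
      (.const 0) 91 10 (Nat.le_of_ble_eq_true rfl) (Nat.le_of_ble_eq_true rfl)
      (by simp [RAM.Ex.ok_and, RAM.Ex.ok_le, RAM.Ex.Ok]) trivial trivial trivial fun x v hv => ?_
    exact DMVP.reported_decision hp x.1 hv
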